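/- Let $n\ge 2$, let $\widehat X$ be a real analytic manifold of dimension $n$ without boundary, let $g$ be a real analytic Riemannian metric on $\widehat X$, and let $X\subset\widehat X$ be a compact $n$-dimensional submanifold with $C^\infty$ boundary $\partial X$ and interior $X^{\mathrm{int}}=X\setminus\partial X$. Let $S^*X^{\mathrm{int}}$ be the bundle of unit covectors over $X^{\mathrm{int}}$. A geodesic $\gamma:[-T_1,T_2]\to X$, $0<T_1,T_2<\infty$, is called nontangential if $\gamma(-T_1),\gamma(T_2)\in\partial X$, $\gamma(t)\in X^{\mathrm{int}}$ for $-T_1<t<T_2$, and $\dot\gamma(-T_1)$, $\dot\gamma(T_2)$ are not tangent to $\partial X$. A point $\alpha=(\alpha_x,\alpha_\xi)\in S^*X^{\mathrm{int}}$ is generated by the admissible pair of geodesics $\gamma_1:[-T_1,T_2]\to X$, $\gamma_2:[-S_1,S_2]\to X$ if $0<T_1,T_2,S_1,S_2<\infty$, both are nontangential unit speed geodesics, and (i) $\gamma_1(0)=\gamma_2(0)=\alpha_x$; (ii) $\dot\gamma_1(0)+\dot\gamma_2(0)=t_0\alpha_\xi$ for some $0<t_0<2$, where $\alpha_\xi$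 is regarded as a tangent vector by means of $g$; (iii) $\gamma_1(t)=\alpha_x\Leftrightarrow t=0$, $\ \gamma_2(s)=\alpha_x\Leftrightarrow s=0$, and $\gamma_1(t)=\gamma_2(s)$ implies $\gamma_1(t)=\gamma_2(s)=\alpha_x$. Let $\alpha_0\in S^*X^{\mathrm{int}}$ be generated by an admissible pair of geodesics $\gamma_1^0:[-T_1^0,T_2^0]\to X$ and $\gamma_2^0:[-S_1^0,S_2^0]\to X$. Then there is a neighborhood $V$ of $\alpha_0$ in $S^*X^{\mathrm{int}}$ such that every $\alpha\in V$ is generated by an admissible pair of geodesics $$\gamma_1(\alpha):[-T_1(\alpha),T_2(\alpha)]\to X,\qquad \gamma_2(\alpha):[-S_1(\alpha),S_2(\alpha)]\to X,$$ which coincides with the given pair for $\alpha=\alpha_0$ and depends real analytically on $\alpha$: the maps $(\alpha,t)\mapsto\gamma_1(\alpha)(t)$ and $(\alpha,s)\mapsto\gamma_2(\alpha)(s)$, defined for $\alpha\in V$ and $t\in[-T_1(\alpha),T_2(\alpha)]$, respectively $s\in[-S_1(\alpha),S_2(\alpha)]$, extend to real analytic maps into $\widehat X$ on open neighborhoods of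 their domains in $T^*\widehat X\times\mathbb R$. The functions $T_1,T_2,S_1,S_2$ are continuous on $V$. -/

import Mathlib

open Set Filter Bundle
open scoped Manifold ContDiff Topology

noncomputable section

/-- A real analytic Riemannian metric on a real analytic manifold `M` (without boundary) modelled
on `ℝⁿ`. -/
abbrev AnalyticMetric (n : ℕ) (M : Type*) [TopologicalSpace M]
    [ChartedSpace (EuclideanSpace ℝ (Fin n)) M] [IsManifold (𝓡 n) ω M] : Type _ :=
  ContMDiffRiemannianMetric (𝓡 n) ω (EuclideanSpace ℝ (Fin n))
    (fun x : M => TangentSpace (𝓡 n) x)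

/-- The total space of the cotangent bundle `T^*M`. -/
abbrev CotangentBundle (n : ℕ) (M : Type*) [TopologicalSpace M]
    [ChartedSpace (EuclideanSpace ℝ (Fin n)) M] : Type _ :=
  TotalSpace (EuclideanSpace ℝ (Fin n) →L[ℝ] ℝ)
    (fun x : M => TangentSpace (𝓡 n) x →L[ℝ] Trivial M ℝ x)

namespace AdmissiblePairs

variable {n : ℕ} {M : Type*} [TopologicalSpace M]
  [ChartedSpace (EuclideanSpace ℝ (Fin n)) M] [IsManifold (𝓡 n) ω M]

/-! ### Geodesics -/

/-- The metric in the local coordinates around `p`: for `y` in the coordinate domain,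
`coordMetric g p y v w = g_{jk}(y) v^j w^k`, i.e. `coordMetric g p` is the pull-back of the metric
by the inverse of the coordinate map (tangent spaces of `M` are copies of `ℝⁿ` in Mathlib). -/
def coordMetric (g : AnalyticMetric n M) (p : M) (y : EuclideanSpace ℝ (Fin n)) :
    EuclideanSpace ℝ (Fin n) →L[ℝ] EuclideanSpace ℝ (Fin n) →L[ℝ] ℝ :=
  let D : EuclideanSpace ℝ (Fin n) →L[ℝ] EuclideanSpace ℝ (Fin n) :=
    mfderiv 𝓘(ℝ, EuclideanSpace ℝ (Fin n)) (𝓡 n) (extChartAt (𝓡 n) p).symm y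
  let G : EuclideanSpace ℝ (Fin n) →L[ℝ] EuclideanSpace ℝ (Fin n) →L[ℝ] ℝ :=
    g.inner ((extChartAt (𝓡 n) p).symm y)
  G.bilinearComp D D

/-- The Christoffel symbols of the first kind in the local coordinates around `p`, i.e.
`Γ_{jk,l} u^j v^k w^l` with `Γ_{jk,l} = (∂_j g_{kl} + ∂_k g_{jl} - ∂_l g_{jk}) / 2`. -/
def christoffel (g : AnalyticMetric n M) (p : M) (y u v w : EuclideanSpace ℝ (Fin n)) : ℝ :=
  (fderiv ℝ (coordMetric g p) y u v w + fderiv ℝ (coordMetric g p) y v u w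
    - fderiv ℝ (coordMetric g p) y w u v) / 2

/-- The local coordinate expression, around the point `p`, of a curve `γ`. -/
def coordCurve (γ : ℝ → M) (p : M) (t : ℝ) : EuclideanSpace ℝ (Fin n) :=
  extChartAt (𝓡 n) p (γ t)

/-- `γ : [a, b] → M` is a geodesic: it is of class `C^2` on `[a, b]` and, at each time `t`, its
expression `u` in local coordinates around `γ t` solves the geodesic equation
`g_{jl} u''^j + Γ_{jk,l} u'^j u'^k = 0` for all `l`, which is the equation
`u''^j + Γ^j_{kl} u'^k u'^l = 0` with the index lowered by the metric. At the end points derivatives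
are one-sided. The values of `γ` outside `[a, b]` play no role. -/
def IsGeodesic (g : AnalyticMetric n M) (γ : ℝ → M) (a b : ℝ) : Prop :=
  ContMDiffOn 𝓘(ℝ, ℝ) (𝓡 n) 2 γ (Icc a b) ∧
  ∀ t ∈ Icc a b, ∀ w : EuclideanSpace ℝ (Fin n),
    let u := coordCurve γ (γ t)
    let u' := derivWithin u (Icc a b)
    let u'' := derivWithin u' (Icc a b)
    coordMetric g (γ t) (u t) (u'' t) w + christoffel g (γ t) (u t) (u' t) (u' t) w = 0

/-- The velocity `γ'(t)` of a curve `γ : [a, b] → M` (one-sided at the end points). -/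
def velocity (γ : ℝ → M) (a b t : ℝ) : TangentSpace (𝓡 n) (γ t) :=
  mfderivWithin 𝓘(ℝ, ℝ) (𝓡 n) γ (Icc a b) t (1 : ℝ)

/-! ### Domains with smooth boundary -/

/-- `ρ` is a smooth defining function of `X` near `p`: it is `C^∞` near `p`, vanishes at `p`,
`dρ(p) ≠ 0`, and near `p` the set `X` is `{ρ ≤ 0}`. -/
structure IsLocalDefiningFunction (X : Set M) (p : M) (ρ : M → ℝ) : Prop where
  smooth : ContMDiffAt (𝓡 n) 𝓘(ℝ, ℝ) ∞ ρ p
  zero : ρ p = 0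
  deriv_ne_zero : mfderiv (𝓡 n) 𝓘(ℝ, ℝ) ρ p ≠ 0
  mem_iff : ∀ᶠ q in 𝓝 p, q ∈ X ↔ ρ q ≤ 0

/-- `X ⊆ M` is a compact manifold with smooth boundary of the same dimension as `M`. Its boundary
`∂X` is the topological frontier of `X`, and its interior `X^int = X \ ∂X` the topological
interior. -/
structure IsCompactWithSmoothBoundary (n : ℕ) {M : Type*} [TopologicalSpace M]
    [ChartedSpace (EuclideanSpace ℝ (Fin n)) M] (X : Set M) : Prop where
  compact : IsCompact X
  boundary : ∀ p ∈ frontier X, ∃ ρ : M → ℝ, IsLocalDefiningFunction (n := n) X p ρ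

/-- For a boundary point `p` of `X`, the vector `v ∈ T_pM` is not tangent to `∂X`; the tangent
space `T_p∂X` is the kernel of `dρ(p)` for a defining function `ρ` (any two of which differ near
`p` by a factor that is positive at `p`, so that the choice of `ρ` does not matter). -/
def IsNontangentialVector (X : Set M) (p : M) (v : TangentSpace (𝓡 n) p) : Prop :=
  ∃ ρ : M → ℝ, IsLocalDefiningFunction (n := n) X p ρ ∧ mfderiv (𝓡 n) 𝓘(ℝ, ℝ) ρ p v ≠ (0 : ℝ)

/-! ### Nontangential geodesics and admissible pairs -/

/-- `γ : [-T₁, T₂] → X` is a nontangential unit speed geodesic, `0 < T₁, T₂ < ∞`. -/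
structure IsNontangentialGeodesic (g : AnalyticMetric n M) (X : Set M)
    (γ : ℝ → M) (T₁ T₂ : ℝ) : Prop where
  pos_left : 0 < T₁
  pos_right : 0 < T₂
  geodesic : IsGeodesic g γ (-T₁) T₂
  unit_speed : ∀ t ∈ Icc (-T₁) T₂,
    g.inner (γ t) (velocity γ (-T₁) T₂ t) (velocity γ (-T₁) T₂ t) = 1
  left_mem : γ (-T₁) ∈ frontier X
  right_mem : γ T₂ ∈ frontier X
  mem_interior : ∀ t ∈ Ioo (-T₁) T₂, γ t ∈ interior X
  left_nontangential : IsNontangentialVector (n := n) X (γ (-T₁)) (velocity γ (-T₁) T₂ (-T₁))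
  right_nontangential : IsNontangentialVector (n := n) X (γ T₂) (velocity γ (-T₁) T₂ T₂)

/-- The unit cosphere bundle `S^*X^int` over the interior of `X`, as a subset of `T^*M`: covectors
over interior points which are Riemannian dual to tangent vectors of length one. -/
def cosphereInterior (g : AnalyticMetric n M) (X : Set M) : Set (CotangentBundle n M) :=
  {α | α.proj ∈ interior X ∧
    ∃ v : TangentSpace (𝓡 n) α.proj, g.inner α.proj v v = 1 ∧ g.inner α.proj v = α.snd}

/-- `α = (x, ξ)` is generated by the admissible pair of geodesics `γ₁ : [-T₁, T₂] → X` and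
`γ₂ : [-S₁, S₂] → X`. -/
structure IsAdmissiblePair (g : AnalyticMetric n M) (X : Set M) (α : CotangentBundle n M)
    (γ₁ : ℝ → M) (T₁ T₂ : ℝ) (γ₂ : ℝ → M) (S₁ S₂ : ℝ) : Prop where
  nontangential₁ : IsNontangentialGeodesic g X γ₁ T₁ T₂
  nontangential₂ : IsNontangentialGeodesic g X γ₂ S₁ S₂
  base₁ : γ₁ 0 = α.proj
  base₂ : γ₂ 0 = α.proj
  /-- `γ₁'(0) + γ₂'(0) = t₀ ξ` for some `0 < t₀ < 2`, where `ξ` is identified with a tangent vector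
  by the metric. -/
  sum_eq : ∃ t₀ : ℝ, 0 < t₀ ∧ t₀ < 2 ∧ ∃ v₁ v₂ : TangentSpace (𝓡 n) α.proj,
    (⟨γ₁ 0, velocity γ₁ (-T₁) T₂ 0⟩ : TangentBundle (𝓡 n) M) = ⟨α.proj, v₁⟩ ∧
    (⟨γ₂ 0, velocity γ₂ (-S₁) S₂ 0⟩ : TangentBundle (𝓡 n) M) = ⟨α.proj, v₂⟩ ∧
    g.inner α.proj (v₁ + v₂) = t₀ • α.snd
  no_self_intersection₁ : ∀ t ∈ Icc (-T₁) T₂, (γ₁ t = α.proj ↔ t = 0)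
  no_self_intersection₂ : ∀ s ∈ Icc (-S₁) S₂, (γ₂ s = α.proj ↔ s = 0)
  only_intersection : ∀ t ∈ Icc (-T₁) T₂, ∀ s ∈ Icc (-S₁) S₂, γ₁ t = γ₂ s → γ₁ t = α.proj

/-- The curves `Γ α : [-T₁ α, T₂ α] → M`, `α ∈ V ⊆ T^*M`, depend real analytically on `α`: the map
`(α, t) ↦ Γ α t` is real analytic in an open neighbourhood, in `T^*M × ℝ`, of the set of all
`(α, t)` with `α ∈ V` and `t ∈ [-T₁ α, T₂ α]`; and the end points of the intervals depend
continuously on `α ∈ V`. -/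
def DependsAnalytically (V : Set (CotangentBundle n M))
    (Γ : CotangentBundle n M → ℝ → M) (T₁ T₂ : CotangentBundle n M → ℝ) : Prop :=
  ContinuousOn T₁ V ∧ ContinuousOn T₂ V ∧
  ∃ W : Set (CotangentBundle n M × ℝ), IsOpen W ∧
    (∀ α ∈ V, ∀ t ∈ Icc (-T₁ α) (T₂ α), (α, t) ∈ W) ∧
    ContMDiffOn (((𝓡 n).prod 𝓘(ℝ, EuclideanSpace ℝ (Fin n) →L[ℝ] ℝ)).prod 𝓘(ℝ, ℝ)) (𝓡 n) ω
      (fun z : CotangentBundle n M × ℝ => Γ z.1 z.2) W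

end AdmissiblePairs

end

/-!
A pair of geodesics through `x` is determined by its initial velocities at `x`, so it suffices to
choose these velocities as analytic functions of `α = (x, ξ)` and to know that the geodesics, the
times at which they leave `X`, and the absence of further intersections are stable.

*Initial velocities.* With `s` the vector dual to `ξ`, unit vectors with sum `t₀ s` are
`(t₀ / 2) s ± w` with `w` orthogonal to `s` and of squared length `1 - t₀ ^ 2 / 4 > 0`. Keeping `t₀`
fixed, `w` is moved analytically with `(x, ξ)` (`exists_analytic_initialVelocities`).

*Analytic families of geodesics.* In a chart geodesics are the integral curves of an analytic
vector field, and analytic vector fields have analytic local flows (`exists_analytic_flow`). This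
is derived from the analytic implicit function theorem in the Banach space `C([-1, 1], Z)`, on
which superposition with an analytic function is analytic. The geodesic equation is covariant under
changes of charts, so that local flows in finitely many charts can be glued along the compact given
geodesic; the result is a family of geodesics, analytic near the given one up to its end points and
a little beyond (`exists_geodesicFamily`).

*Exit times.* At the end points the geodesic is transversal to `∂X = {ρ = 0}`, so `ρ` is strictly
monotone along all nearby curves, and its unique zero depends continuously on the parameter
(`exists_exitTime`). Before this zero the curve is in the interior of `X`, by compactness away from
the end points, and the speed is constant along geodesics. Therefore nearby members of the family
with unit initial velocity are nontangential unit speed geodesics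
(`IsNontangentialGeodesic.exists_family`).

*Intersections.* Because `0 < t₀ < 2`, the two initial velocities are linearly independent. By
strict differentiability at time `0`, uniformly for nearby pairs, the two curves meet for small
times only at time `0` (`eventually_eq_zero_of_eq`). For the remaining pairs of times, which form a
compact set, the given geodesics are at distinct points, and this is an open condition
(`eventually_forall_ne_of_ne`). As each of the curves is at `x` at time `0`, this includes the
statement that neither returns to `x`.
-/

noncomputable section

namespace AdmissiblePairs

/-! ### Analytic dependence of the solutions of an autonomous ODE on the initial value -/

section AnalyticFlow

variable {K : Type*} [TopologicalSpace K] [CompactSpace K]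
  {Z W : Type*} [NormedAddCommGroup Z] [NormedSpace ℝ Z] [NormedAddCommGroup W] [NormedSpace ℝ W]

/-- The continuous multilinear map on spaces of continuous functions that applies a continuous
multilinear map pointwise. -/
def pointwiseMultilinear (K : Type*) [TopologicalSpace K] [CompactSpace K] {m : ℕ}
    (p : ContinuousMultilinearMap ℝ (fun _ : Fin m => Z) W) :
    ContinuousMultilinearMap ℝ (fun _ : Fin m => C(K, Z)) C(K, W) :=
  MultilinearMap.mkContinuous
    { toFun := fun u => ⟨fun t => p fun i => u i t, by fun_prop⟩
      map_update_add' := by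
        intro inst u i x y
        ext t
        have key : ∀ z : C(K, Z), (fun j => Function.update u i z j t)
            = Function.update (fun j => u j t) i (z t) := by
          intro z
          ext j
          by_cases hj : j = i
          · subst hj; simp
          · simp [hj]
        simp only [ContinuousMap.coe_mk, ContinuousMap.add_apply, key]
        convert p.map_update_add (fun j => u j t) i (x t) (y t)
      map_update_smul' := by
        intro inst u i c x
        ext t
        have key : ∀ z : C(K, Z), (fun j => Function.update u i z j t)
            = Function.update (fun j => u j t) i (z t) := by
          intro z
          ext j
          by_cases hj : j = i
          · subst hj; simp
          · simp [hj]
        simp only [ContinuousMap.coe_mk, ContinuousMap.smul_apply, key]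
        convert p.map_update_smul (fun j => u j t) i c (x t) }
    ‖p‖ (by
      intro u
      refine (ContinuousMap.norm_le _ (by positivity)).2 fun t => ?_
      refine (p.le_opNorm _).trans ?_
      gcongr with i
      exact (u i).norm_coe_le_norm t)

lemma norm_pointwiseMultilinear_le {m : ℕ}
    (p : ContinuousMultilinearMap ℝ (fun _ : Fin m => Z) W) : ‖pointwiseMultilinear K p‖ ≤ ‖p‖ :=
  MultilinearMap.mkContinuous_norm_le _ (norm_nonneg _) _

/-- Superposition with a function that is analytic at `z` is analytic, as an operator on spaces of
continuous functions, at the constant function `z`: its power series is obtained from that of the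
function pointwise. -/
lemma exists_analytic_superposition [CompleteSpace W] {F : Z → W} {z : Z} (hF : AnalyticAt ℝ F z) :
    ∃ N : C(K, Z) → C(K, W), AnalyticAt ℝ N (ContinuousMap.const K z) ∧
      ∀ᶠ u in 𝓝 (ContinuousMap.const K z), ∀ t, N u t = F (u t) := by
  obtain ⟨p, r, hp⟩ := hF
  let P : FormalMultilinearSeries ℝ C(K, Z) C(K, W) := fun m => pointwiseMultilinear K (p m)
  have hrad : p.radius ≤ P.radius := by
    refine ENNReal.le_of_forall_nnreal_lt fun ρ hρ => ?_
    obtain ⟨C, -, hC⟩ := p.norm_mul_pow_le_of_lt_radius hρ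
    refine P.le_radius_of_bound C fun m => le_trans ?_ (hC m)
    gcongr
    exact norm_pointwiseMultilinear_le (p m)
  have hpos : 0 < P.radius := hp.r_pos.trans_le (hp.r_le.trans hrad)
  have hP := P.hasFPowerSeriesOnBall hpos
  refine ⟨fun u => P.sum (u - ContinuousMap.const K z), ?_, ?_⟩
  · have h1 : AnalyticAt ℝ P.sum (ContinuousMap.const K z - ContinuousMap.const K z) := by
      rw [sub_self]; exact hP.analyticAt
    exact AnalyticAt.fun_comp h1 (analyticAt_id.sub analyticAt_const)
  · have h2 : ∀ᶠ u in 𝓝 (ContinuousMap.const K z),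
        u - ContinuousMap.const K z ∈ Metric.eball (0 : C(K, Z)) r := by
      have : Tendsto (fun u : C(K, Z) => u - ContinuousMap.const K z)
          (𝓝 (ContinuousMap.const K z)) (𝓝 0) := by
        have h : Continuous fun u : C(K, Z) => u - ContinuousMap.const K z := by fun_prop
        simpa using h.tendsto (ContinuousMap.const K z)
      exact this (Metric.eball_mem_nhds _ hp.r_pos)
    filter_upwards [h2] with u hu t
    have h3 : HasSum (fun m => P m fun _ => u - ContinuousMap.const K z)
        (P.sum (u - ContinuousMap.const K z)) := by
      have := hP.hasSum (y := u - ContinuousMap.const K z)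
        (Metric.eball_subset_eball (hp.r_le.trans hrad) hu)
      simpa using this
    have h4 := h3.mapL (ContinuousMap.evalCLM ℝ t)
    have h5 : u t - z ∈ Metric.eball (0 : Z) r := by
      rw [Metric.mem_eball, edist_zero_right] at hu ⊢
      refine lt_of_le_of_lt ?_ hu
      rw [← ofReal_norm, ← ofReal_norm]
      exact ENNReal.ofReal_le_ofReal ((u - ContinuousMap.const K z).norm_coe_le_norm t)
    have h6 := hp.hasSum h5
    rw [add_sub_cancel] at h6
    exact h4.unique h6

end AnalyticFlow

section Flow

variable {Z : Type*} [NormedAddCommGroup Z] [NormedSpace ℝ Z] [CompleteSpace Z]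

/-- Integration from `0`, as an operator on `C([-1, 1], Z)`. -/
def integrateFromZero (Z : Type*) [NormedAddCommGroup Z] [NormedSpace ℝ Z] [CompleteSpace Z] :
    C(Icc (-1 : ℝ) 1, Z) →L[ℝ] C(Icc (-1 : ℝ) 1, Z) :=
  LinearMap.mkContinuous
    { toFun := fun u => ⟨fun t => ∫ r in (0 : ℝ)..t, IccExtend (by norm_num) u r, by
        have : Continuous fun t : ℝ => ∫ r in (0 : ℝ)..t, IccExtend (by norm_num) u r :=
          intervalIntegral.continuous_primitive
            (fun a b => (u.continuous.Icc_extend' (h := by norm_num)).intervalIntegrable a b) 0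
        exact this.comp continuous_subtype_val⟩
      map_add' := by
        intro u v
        ext t
        simp only [ContinuousMap.coe_mk, ContinuousMap.add_apply]
        rw [← intervalIntegral.integral_add]
        · rfl
        · exact (u.continuous.Icc_extend' (h := by norm_num)).intervalIntegrable _ _
        · exact (v.continuous.Icc_extend' (h := by norm_num)).intervalIntegrable _ _
      map_smul' := by
        intro c u
        ext t
        simp only [ContinuousMap.coe_mk, ContinuousMap.smul_apply, RingHom.id_apply]
        rw [← intervalIntegral.integral_smul]
        rfl }
    1 (by
      intro u
      refine (ContinuousMap.norm_le _ (by positivity)).2 fun t => ?_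
      refine (intervalIntegral.norm_integral_le_of_norm_le_const
        (C := ‖u‖) fun r _ => u.norm_coe_le_norm _).trans ?_
      have : |(t : ℝ) - 0| ≤ 1 := by
        rw [sub_zero, abs_le]; exact t.2
      rw [one_mul]
      exact mul_le_of_le_one_right (norm_nonneg _) this)

lemma integrateFromZero_apply (u : C(Icc (-1 : ℝ) 1, Z)) (t : Icc (-1 : ℝ) 1) :
    integrateFromZero Z u t = ∫ r in (0 : ℝ)..t, IccExtend (by norm_num) u r := rfl

/-- An analytic vector field has an analytic local flow. The time `ε` is introduced as a parameter
by solving `u = s + ε ∫₀ F(u)` for `u ∈ C([-1, 1], Z)` with the analytic implicit function theorem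
near `ε = 0`; then `u(1)` is the flow at time `ε`. -/
theorem exists_analytic_flow {F : Z → Z} {s₀ : Z} (hF : ContDiffAt ℝ ω F s₀) :
    ∃ Φ : Z × ℝ → Z, ContDiffAt ℝ ω Φ (s₀, 0) ∧ (∀ᶠ s in 𝓝 s₀, Φ (s, 0) = s) ∧
      ∀ᶠ z in 𝓝 (s₀, (0 : ℝ)), HasDerivAt (fun t => Φ (z.1, t)) (F (Φ z)) z.2 := by
  have hI : (-1 : ℝ) ≤ 1 := by norm_num
  obtain ⟨N, hN, hNF⟩ := exists_analytic_superposition (K := Icc (-1 : ℝ) 1) hF.analyticAt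
  let c : Z →L[ℝ] C(Icc (-1 : ℝ) 1, Z) :=
    LinearMap.mkContinuous
      { toFun := fun s => ContinuousMap.const _ s
        map_add' := fun _ _ => rfl
        map_smul' := fun _ _ => rfl } 1 (by
        intro s
        rw [one_mul]
        exact (ContinuousMap.norm_le _ (norm_nonneg s)).2 fun t => le_rfl)
  have hc : ∀ s, c s = ContinuousMap.const _ s := fun s => rfl
  let H : (Z × ℝ) × C(Icc (-1 : ℝ) 1, Z) → C(Icc (-1 : ℝ) 1, Z) :=
    fun q => q.2 - c q.1.1 - q.1.2 • integrateFromZero Z (N q.2)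
  -- At `ε = 0` the partial derivative of `H` with respect to `u` is the identity.
  let u₀ := c s₀
  have hH : ContDiffAt ℝ ω H ((s₀, 0), u₀) := by
    have hN' : ContDiffAt ℝ ω (fun q : (Z × ℝ) × C(Icc (-1 : ℝ) 1, Z) => N q.2) ((s₀, 0), u₀) :=
      ContDiffAt.comp ((s₀, 0), u₀) (f := Prod.snd) (g := N) hN.contDiffAt contDiffAt_snd
    have h1 : ContDiffAt ℝ ω (fun q : (Z × ℝ) × C(Icc (-1 : ℝ) 1, Z) =>
        integrateFromZero Z (N q.2)) ((s₀, 0), u₀) :=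
      (integrateFromZero Z).contDiff.contDiffAt.comp _ hN'
    have h2 : ContDiffAt ℝ ω (fun q : (Z × ℝ) × C(Icc (-1 : ℝ) 1, Z) => c q.1.1) ((s₀, 0), u₀) :=
      c.contDiff.contDiffAt.comp _ (contDiffAt_fst.comp _ contDiffAt_fst)
    exact (contDiffAt_snd.sub h2).sub ((contDiffAt_snd.comp _ contDiffAt_fst).smul h1)
  have hinv : (fderiv ℝ H ((s₀, 0), u₀) ∘L .inr ℝ (Z × ℝ) C(Icc (-1 : ℝ) 1, Z)).IsInvertible := by
    have h1 : HasFDerivAt (H ∘ fun u => ((s₀, (0 : ℝ)), u))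
        (fderiv ℝ H ((s₀, 0), u₀) ∘L .inr ℝ (Z × ℝ) C(Icc (-1 : ℝ) 1, Z)) u₀ :=
      HasFDerivAt.comp u₀ (hH.differentiableAt (by simp)).hasFDerivAt
        (hasFDerivAt_prodMk_right (s₀, (0 : ℝ)) u₀)
    have h2 : HasFDerivAt (H ∘ fun u => ((s₀, (0 : ℝ)), u)) (ContinuousLinearMap.id ℝ _) u₀ := by
      have : (H ∘ fun u => ((s₀, (0 : ℝ)), u)) = fun u => u - c s₀ := by
        ext1 u; simp [H]
      rw [this]
      exact (hasFDerivAt_id u₀).sub_const _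
    rw [h1.unique h2]
    exact ⟨ContinuousLinearEquiv.refl ℝ _, rfl⟩
  let ψ := hH.implicitFunction (by simp) hinv
  have hψ0 : ψ (s₀, 0) = u₀ := hH.implicitFunction_apply_self (by simp) hinv
  have hψ : ContDiffAt ℝ ω ψ (s₀, 0) := hH.contDiffAt_implicitFunction (by simp) hinv
  have hHu : H ((s₀, 0), u₀) = 0 := by simp [H, u₀]
  have hiff := hH.eventually_apply_eq_iff_implicitFunction (by simp) hinv
  rw [hHu] at hiff
  -- A common radius `r` for the local uniqueness of `ψ` and the description of `N`.
  obtain ⟨r, hr, hball⟩ := Metric.eventually_nhds_iff_ball.1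
    (hiff.and ((continuousAt_snd (p := ((s₀, (0 : ℝ)), u₀))).eventually hNF))
  obtain ⟨δ, hδ, hψball⟩ := Metric.eventually_nhds_iff_ball.1
    ((hψ.continuousAt.eventually (by rw [hψ0]; exact Metric.ball_mem_nhds u₀ hr)).and
      (Metric.ball_mem_nhds (s₀, (0 : ℝ)) hr))
  have mem : ∀ {s ε}, dist s s₀ < δ → |ε| < δ → (s, ε) ∈ Metric.ball (s₀, (0 : ℝ)) δ := by
    intro s ε hs hε
    rw [Metric.mem_ball, Prod.dist_eq]
    simpa using ⟨hs, hε⟩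
  have mem' : ∀ {q : Z × ℝ} {u}, q ∈ Metric.ball (s₀, (0 : ℝ)) r → u ∈ Metric.ball u₀ r →
      (q, u) ∈ Metric.ball ((s₀, (0 : ℝ)), u₀) r := by
    intro q u hq hu
    rw [Metric.mem_ball, Prod.dist_eq]
    exact max_lt hq hu
  -- The integral equation.
  have heq : ∀ {s ε}, dist s s₀ < δ → |ε| < δ → ∀ t : Icc (-1 : ℝ) 1,
      ψ (s, ε) t = s + ε • ∫ r in (0 : ℝ)..t, IccExtend hI (N (ψ (s, ε))) r := by
    intro s ε hs hε t
    obtain ⟨h1, h2⟩ := hψball _ (mem hs hε)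
    have h3 : H ((s, ε), ψ (s, ε)) = 0 := ((hball _ (mem' h2 h1)).1).2 rfl
    have h4 := DFunLike.congr_fun h3 t
    simp only [H, ContinuousMap.sub_apply, ContinuousMap.smul_apply, hc,
      ContinuousMap.const_apply, ContinuousMap.zero_apply, integrateFromZero_apply] at h4
    rw [sub_sub, sub_eq_zero] at h4
    exact h4
  -- By uniqueness, the solution with parameter `ε θ` is the one with parameter `ε`, run for the
  -- times `θ t`: thus `ψ (s, τ) 1` is, as a function of `τ`, one solution with time rescaled.
  have hscale : ∀ {s ε θ : _}, dist s s₀ < δ → |ε| < δ → ∀ (hθ : θ ∈ Icc (-1 : ℝ) 1),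
      ∀ t : Icc (-1 : ℝ) 1, ψ (s, ε * θ) t = IccExtend hI (ψ (s, ε)) (θ * t) := by
    intro s ε θ hs hε hθ
    have hmul : ∀ t : Icc (-1 : ℝ) 1, θ * t ∈ Icc (-1 : ℝ) 1 := by
      intro t
      rw [mem_Icc, ← abs_le, abs_mul]
      exact mul_le_one₀ (abs_le.2 hθ) (abs_nonneg _) (abs_le.2 t.2)
    let v : C(Icc (-1 : ℝ) 1, Z) := ⟨fun t => ψ (s, ε) ⟨θ * t, hmul t⟩, by fun_prop⟩
    obtain ⟨h1, h2⟩ := hψball _ (mem hs hε)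
    have hε' : |ε * θ| < δ := by
      rw [abs_mul]
      exact lt_of_le_of_lt (mul_le_of_le_one_right (abs_nonneg _) (abs_le.2 hθ)) hε
    have h2' := (hψball _ (mem hs hε')).2
    have hv : v ∈ Metric.ball u₀ r := by
      rw [Metric.mem_ball]
      refine lt_of_le_of_lt ((ContinuousMap.dist_le dist_nonneg).2 fun t => ?_) h1
      exact ContinuousMap.dist_apply_le_dist (f := ψ (s, ε)) (g := u₀) ⟨θ * t, hmul t⟩
    have hNv : ∀ t, N v t = N (ψ (s, ε)) ⟨θ * t, hmul t⟩ := by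
      intro t
      rw [(hball _ (mem' h2' hv)).2 t, (hball _ (mem' h2 h1)).2]
      rfl
    have hHv : H ((s, ε * θ), v) = 0 := by
      ext t
      simp only [H, ContinuousMap.sub_apply, ContinuousMap.smul_apply, hc,
        ContinuousMap.const_apply, ContinuousMap.zero_apply, integrateFromZero_apply]
      rw [sub_sub, sub_eq_zero]
      have h5 : ∫ r in (0 : ℝ)..t, IccExtend hI (N v) r
          = ∫ r in (0 : ℝ)..t, IccExtend hI (N (ψ (s, ε))) (θ * r) := by
        refine intervalIntegral.integral_congr fun r hr => ?_
        have hr' : r ∈ Icc (-1 : ℝ) 1 := by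
          have h0 : (0 : ℝ) ∈ Icc (-1 : ℝ) 1 := by constructor <;> norm_num
          exact (uIcc_subset_Icc h0 t.2) hr
        rw [IccExtend_of_mem _ _ hr', IccExtend_of_mem _ _ (hmul ⟨r, hr'⟩), hNv]
      rw [h5, mul_smul, intervalIntegral.smul_integral_comp_mul_left, mul_zero]
      exact heq hs hε ⟨θ * t, hmul t⟩
    have h6 : ψ (s, ε * θ) = v := (hball _ (mem' h2' hv)).1.1 hHv
    intro t
    rw [h6, IccExtend_of_mem _ _ (hmul t)]
    rfl
  let one : Icc (-1 : ℝ) 1 := ⟨1, by constructor <;> norm_num⟩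
  let zero : Icc (-1 : ℝ) 1 := ⟨0, by constructor <;> norm_num⟩
  refine ⟨fun q => ψ q one, ?_, ?_, ?_⟩
  · exact (ContinuousMap.evalCLM ℝ one).contDiff.contDiffAt.comp _ hψ
  · filter_upwards [Metric.ball_mem_nhds s₀ hδ] with s hs
    have := heq (s := s) (ε := 0) hs (by simpa using hδ) one
    simpa using this
  · have hev : ∀ᶠ z in 𝓝 (s₀, (0 : ℝ)), z ∈ Metric.ball s₀ δ ×ˢ Ioo (-(δ / 2)) (δ / 2) :=
      prod_mem_nhds (Metric.ball_mem_nhds s₀ hδ) (Ioo_mem_nhds (by linarith) (by linarith))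
    filter_upwards [hev] with ⟨s, t⟩ ⟨hs, ht⟩
    simp only at hs ht
    have hε : |δ / 2| < δ := by rw [abs_of_pos (by linarith)]; linarith
    have hmem : ∀ τ ∈ Ioo (-(δ / 2)) (δ / 2), τ / (δ / 2) ∈ Icc (-1 : ℝ) 1 := by
      intro τ hτ
      constructor
      · rw [le_div_iff₀ (by linarith)]; linarith [hτ.1]
      · rw [div_le_iff₀ (by linarith)]; linarith [hτ.2]
    have hrep : ∀ τ ∈ Ioo (-(δ / 2)) (δ / 2), ψ (s, τ) one =
        IccExtend hI (ψ (s, δ / 2)) (τ / (δ / 2)) := by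
      intro τ hτ
      have := hscale (s := s) (ε := δ / 2) hs hε (hmem τ hτ) one
      rw [mul_div_cancel₀ _ (by linarith)] at this
      rw [this]
      simp [one]
    have hform : ∀ τ ∈ Ioo (-(δ / 2)) (δ / 2), ψ (s, τ) one =
        s + (δ / 2) • ∫ r in (0 : ℝ)..(τ / (δ / 2)), IccExtend hI (N (ψ (s, δ / 2))) r := by
      intro τ hτ
      rw [hrep τ hτ, IccExtend_of_mem _ _ (hmem τ hτ)]
      exact heq (s := s) (ε := δ / 2) hs hε ⟨_, hmem τ hτ⟩
    have hcont : Continuous (IccExtend hI (N (ψ (s, δ / 2)))) :=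
      (N (ψ (s, δ / 2))).continuous.Icc_extend'
    have hder := ((((hcont.integral_hasStrictDerivAt 0 (t / (δ / 2))).hasDerivAt.scomp t
      ((hasDerivAt_id t).div_const (δ / 2))).const_smul (δ / 2)).const_add s)
    have hval : (δ / 2) • (1 / (δ / 2)) • IccExtend hI (N (ψ (s, δ / 2))) (t / (δ / 2))
        = F (ψ (s, t) one) := by
      rw [smul_smul, mul_one_div_cancel (by linarith), one_smul, hrep t ht,
        IccExtend_of_mem _ _ (hmem t ht), IccExtend_of_mem _ _ (hmem t ht)]
      obtain ⟨h1, h2⟩ := hψball _ (mem (s := s) (ε := δ / 2) hs hε)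
      exact (hball _ (mem' h2 h1)).2 _
    rw [hval] at hder
    refine hder.congr_of_eventuallyEq ?_
    filter_upwards [Ioo_mem_nhds ht.1 ht.2] with τ hτ
    exact hform τ hτ

end Flow

/-! ### The metric in local coordinates -/

/-- The model space `ℝⁿ`. -/
abbrev Coord (n : ℕ) : Type := EuclideanSpace ℝ (Fin n)

section Charts

variable {n : ℕ} {M : Type*} [TopologicalSpace M] [ChartedSpace (EuclideanSpace ℝ (Fin n)) M]

/-- The derivative of the inverse of the chart at `p`: it maps coordinates of tangent vectors to
tangent vectors, which are elements of `ℝⁿ` by the definition of `TangentSpace`. -/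
def chartFrame (p : M) (y : Coord n) : Coord n →L[ℝ] Coord n :=
  mfderiv 𝓘(ℝ, Coord n) (𝓡 n) (extChartAt (𝓡 n) p).symm y

/-- The change of coordinates from the chart at `p` to the chart at `q`. -/
def transition (p q : M) (y : Coord n) : Coord n :=
  extChartAt (𝓡 n) q ((extChartAt (𝓡 n) p).symm y)

lemma target_mem_nhds {p : M} {y : Coord n} (hy : y ∈ (extChartAt (𝓡 n) p).target) :
    (extChartAt (𝓡 n) p).target ∈ 𝓝 y :=
  (isOpen_extChartAt_target p).mem_nhds hy

lemma source_mem_nhds {p x : M} (hx : x ∈ (extChartAt (𝓡 n) p).source) :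
    (extChartAt (𝓡 n) p).source ∈ 𝓝 x :=
  (isOpen_extChartAt_source p).mem_nhds hx

variable [IsManifold (𝓡 n) ω M]

lemma contMDiffAt_chart {p x : M} (hx : x ∈ (extChartAt (𝓡 n) p).source) :
    ContMDiffAt (𝓡 n) 𝓘(ℝ, Coord n) ω (extChartAt (𝓡 n) p) x :=
  contMDiffAt_extChartAt' (by rwa [extChartAt_source] at hx)

lemma contMDiffAt_chart_symm {p : M} {y : Coord n} (hy : y ∈ (extChartAt (𝓡 n) p).target) :
    ContMDiffAt 𝓘(ℝ, Coord n) (𝓡 n) ω (extChartAt (𝓡 n) p).symm y :=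
  (contMDiffOn_extChartAt_symm p).contMDiffAt (target_mem_nhds hy)

lemma mdifferentiableAt_chart_symm {p : M} {y : Coord n}
    (hy : y ∈ (extChartAt (𝓡 n) p).target) :
    MDifferentiableAt 𝓘(ℝ, Coord n) (𝓡 n) (extChartAt (𝓡 n) p).symm y :=
  (contMDiffAt_chart_symm hy).mdifferentiableAt (by simp)

lemma contDiffAt_transition {p q : M} {y : Coord n} (hy : y ∈ (extChartAt (𝓡 n) p).target)
    (hq : (extChartAt (𝓡 n) p).symm y ∈ (extChartAt (𝓡 n) q).source) :
    ContDiffAt ℝ ω (transition p q) y :=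
  (ContMDiffAt.comp y (contMDiffAt_chart hq) (contMDiffAt_chart_symm hy)).contDiffAt

lemma eventually_mem_transition {p q : M} {y : Coord n} (hy : y ∈ (extChartAt (𝓡 n) p).target)
    (hq : (extChartAt (𝓡 n) p).symm y ∈ (extChartAt (𝓡 n) q).source) :
    ∀ᶠ z in 𝓝 y, z ∈ (extChartAt (𝓡 n) p).target ∧
      (extChartAt (𝓡 n) p).symm z ∈ (extChartAt (𝓡 n) q).source :=
  (eventually_mem_set.2 (target_mem_nhds hy)).and
    ((contMDiffAt_chart_symm hy).continuousAt.eventually (source_mem_nhds hq))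

/-- The chain rule for the derivatives of the inverses of two charts. -/
lemma chartFrame_transition {p q : M} {y : Coord n} (hy : y ∈ (extChartAt (𝓡 n) p).target)
    (hq : (extChartAt (𝓡 n) p).symm y ∈ (extChartAt (𝓡 n) q).source) (a : Coord n) :
    chartFrame p y a = chartFrame q (transition p q y) (fderiv ℝ (transition p q) y a) := by
  have h1 : (extChartAt (𝓡 n) p).symm =ᶠ[𝓝 y]
      (extChartAt (𝓡 n) q).symm ∘ transition p q := by
    filter_upwards [eventually_mem_transition hy hq] with z hz
    exact ((extChartAt (𝓡 n) q).left_inv hz.2).symm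
  have h2 : HasMFDerivAt 𝓘(ℝ, Coord n) (𝓡 n) ((extChartAt (𝓡 n) q).symm ∘ transition p q) y
      ((chartFrame q (transition p q y)).comp (fderiv ℝ (transition p q) y)) :=
    HasMFDerivAt.comp y
      (mdifferentiableAt_chart_symm ((extChartAt (𝓡 n) q).map_source hq)).hasMFDerivAt
      ((contDiffAt_transition hy hq).differentiableAt (by simp)).hasFDerivAt.hasMFDerivAt
  have h3 := (h2.congr_of_eventuallyEq h1).mfderiv
  exact DFunLike.congr_fun h3 a

/-- The derivative of a chart is a left inverse of the derivative of its inverse. -/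
lemma mfderiv_chart_chartFrame {p : M} {y : Coord n} (hy : y ∈ (extChartAt (𝓡 n) p).target)
    (a : Coord n) :
    (mfderiv (𝓡 n) 𝓘(ℝ, Coord n) (extChartAt (𝓡 n) p) ((extChartAt (𝓡 n) p).symm y) :
      Coord n →L[ℝ] Coord n) (chartFrame p y a) = a := by
  have h := mfderiv_extChartAt_comp_mfderivWithin_extChartAt_symm (I := 𝓡 n) hy
  rw [ModelWithCorners.range_eq_univ, mfderivWithin_univ] at h
  exact DFunLike.congr_fun h a

lemma chartFrame_mfderiv_chart {p : M} {y : Coord n} (hy : y ∈ (extChartAt (𝓡 n) p).target)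
    (a : Coord n) :
    chartFrame p y ((mfderiv (𝓡 n) 𝓘(ℝ, Coord n) (extChartAt (𝓡 n) p)
      ((extChartAt (𝓡 n) p).symm y) : Coord n →L[ℝ] Coord n) a) = a := by
  have h := mfderivWithin_extChartAt_symm_comp_mfderiv_extChartAt (I := 𝓡 n) hy
  rw [ModelWithCorners.range_eq_univ, mfderivWithin_univ] at h
  exact DFunLike.congr_fun h a

lemma chartFrame_injective {p : M} {y : Coord n} (hy : y ∈ (extChartAt (𝓡 n) p).target) :
    Function.Injective (chartFrame p y) :=
  Function.LeftInverse.injective (mfderiv_chart_chartFrame hy)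

lemma chartFrame_surjective {p : M} {y : Coord n} (hy : y ∈ (extChartAt (𝓡 n) p).target) :
    Function.Surjective (chartFrame p y) :=
  Function.RightInverse.surjective (chartFrame_mfderiv_chart hy)

/-- The metric at `x` as a bilinear form on `ℝⁿ`, the type underlying `TangentSpace`. -/
def metricAt (g : AnalyticMetric n M) (x : M) : Coord n →L[ℝ] Coord n →L[ℝ] ℝ := g.inner x

lemma coordMetric_apply (g : AnalyticMetric n M) (p : M) (y a b : Coord n) :
    coordMetric g p y a b =
      metricAt g ((extChartAt (𝓡 n) p).symm y) (chartFrame p y a) (chartFrame p y b) := rfl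

lemma coordMetric_symm (g : AnalyticMetric n M) (p : M) (y a b : Coord n) :
    coordMetric g p y a b = coordMetric g p y b a :=
  g.symm _ _ _

lemma coordMetric_pos (g : AnalyticMetric n M) {p : M} {y : Coord n}
    (hy : y ∈ (extChartAt (𝓡 n) p).target) {a : Coord n} (ha : a ≠ 0) :
    0 < coordMetric g p y a a :=
  g.pos _ _ fun h => ha (chartFrame_injective hy (h.trans (map_zero (chartFrame p y)).symm))

lemma coordMetric_transition (g : AnalyticMetric n M) {p q : M} {y : Coord n}
    (hy : y ∈ (extChartAt (𝓡 n) p).target)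
    (hq : (extChartAt (𝓡 n) p).symm y ∈ (extChartAt (𝓡 n) q).source) (a b : Coord n) :
    coordMetric g p y a b = coordMetric g q (transition p q y)
      (fderiv ℝ (transition p q) y a) (fderiv ℝ (transition p q) y b) := by
  rw [coordMetric_apply, coordMetric_apply, chartFrame_transition hy hq,
    chartFrame_transition hy hq b, transition, (extChartAt (𝓡 n) q).left_inv hq]

lemma contMDiffAt_chartFrame {p : M} {y : Coord n} (hy : y ∈ (extChartAt (𝓡 n) p).target)
    (a : Coord n) :
    ContMDiffAt 𝓘(ℝ, Coord n) (𝓡 n).tangent ω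
      (fun z => (⟨(extChartAt (𝓡 n) p).symm z, chartFrame p z a⟩ : TangentBundle (𝓡 n) M)) y := by
  have hopen := isOpen_extChartAt_target (I := 𝓡 n) p
  have h1 := ContMDiffOn.contMDiffOn_tangentMapWithin (m := ω)
    (contMDiffOn_extChartAt_symm (I := 𝓡 n) (n := ω) p) (by simp) hopen.uniqueMDiffOn
  have h2 : ContMDiff 𝓘(ℝ, Coord n) 𝓘(ℝ, Coord n).tangent ω
      (fun z => (⟨z, a⟩ : TangentBundle 𝓘(ℝ, Coord n) (Coord n))) := by
    rw [contMDiff_vectorSpace_iff_contDiff (V := fun _ => a)]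
    exact contDiff_const
  have h3 := (h1.comp h2.contMDiffOn (s := (extChartAt (𝓡 n) p).target)
    (fun z hz => hz)).contMDiffAt (target_mem_nhds hy)
  refine h3.congr_of_eventuallyEq ?_
  filter_upwards [target_mem_nhds hy] with z hz
  simp only [Function.comp, tangentMapWithin, chartFrame]
  rw [mfderivWithin_of_isOpen hopen hz]
  rfl

/-- The coefficients of the metric are analytic since the analytic section `g` is evaluated on the
analytic coordinate vector fields. -/
lemma contDiffAt_coordMetric (g : AnalyticMetric n M) {p : M} {y : Coord n}
    (hy : y ∈ (extChartAt (𝓡 n) p).target) : ContDiffAt ℝ ω (coordMetric g p) y := by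
  have key : ContDiffOn ℝ ω (coordMetric g p) (extChartAt (𝓡 n) p).target := by
    refine contDiffOn_clm_apply.2 fun a => contDiffOn_clm_apply.2 fun b => ?_
    intro z hz
    have hg := (g.contMDiff ((extChartAt (𝓡 n) p).symm z)).comp z (contMDiffAt_chart_symm hz)
    have h := ContMDiffAt.clm_bundle_apply₂ (F₁ := Coord n) (F₂ := Coord n) (F₃ := ℝ)
      (E₃ := Bundle.Trivial M ℝ) hg
      (contMDiffAt_chartFrame hz a) (contMDiffAt_chartFrame hz b)
    have h' := (contMDiffAt_totalSpace.1 h).2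
    exact h'.contDiffAt.contDiffWithinAt
  exact key.contDiffAt (target_mem_nhds hy)

end Charts

/-! ### The geodesic equation -/

section EulerLagrange

variable {E : Type*} [NormedAddCommGroup E] [NormedSpace ℝ E]

/-- A shortcut: the general search for this instance is slow. -/
instance instNormedAddCommGroupBilin : NormedAddCommGroup (E →L[ℝ] E →L[ℝ] ℝ) := inferInstance

/-- A shortcut: the general search for this instance is slow. -/
instance instNormedSpaceBilin : NormedSpace ℝ (E →L[ℝ] E →L[ℝ] ℝ) := inferInstance

/-- The left-hand side, paired with `w`, of the geodesic equation with lowered index for the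
curve `u` and the metric `G` in coordinates. -/
def geodesicResidual (G : E → E →L[ℝ] E →L[ℝ] ℝ) (u : ℝ → E) (t : ℝ) (w : E) : ℝ :=
  G (u t) (deriv (deriv u) t) w +
    (fderiv ℝ G (u t) (deriv u t) (deriv u t) w + fderiv ℝ G (u t) (deriv u t) (deriv u t) w
      - fderiv ℝ G (u t) w (deriv u t) (deriv u t)) / 2

lemma eventually_hasDerivAt {u : ℝ → E} {t : ℝ} (hu : ContDiffAt ℝ 2 u t) :
    ∀ᶠ s in 𝓝 t, HasDerivAt u (deriv u s) s := by
  filter_upwards [hu.eventually (by simp)] with s hs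
  exact (hs.differentiableAt (by simp)).hasDerivAt

lemma hasDerivAt_deriv {u : ℝ → E} {t : ℝ} (hu : ContDiffAt ℝ 2 u t) :
    HasDerivAt (deriv u) (deriv (deriv u) t) t := by
  have h : ContDiffAt ℝ 1 (fderiv ℝ u) t := hu.fderiv_right (by norm_num)
  have h' : DifferentiableAt ℝ (fun s => fderiv ℝ u s 1) t :=
    (h.differentiableAt (by simp)).clm_apply (differentiableAt_const _)
  exact h'.hasDerivAt

/-- The geodesic equation is covariant: if `Gt` is the pull-back of `G` by `ψ`, the residual of
`u` with respect to `Gt` is that of `ψ ∘ u` with respect to `G`. The terms with second derivatives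
of `ψ` cancel since these are symmetric. -/
lemma geodesicResidual_pullback {G Gt : E → E →L[ℝ] E →L[ℝ] ℝ} {ψ : E → E} {u : ℝ → E} {t : ℝ}
    (hu : ContDiffAt ℝ 2 u t) (hψ : ContDiffAt ℝ 2 ψ (u t))
    (hG : DifferentiableAt ℝ G (ψ (u t))) (hGt : DifferentiableAt ℝ Gt (u t))
    (hsymm : ∀ a b, G (ψ (u t)) a b = G (ψ (u t)) b a)
    (h : ∀ᶠ y in 𝓝 (u t), ∀ a b, Gt y a b = G (ψ y) (fderiv ℝ ψ y a) (fderiv ℝ ψ y b)) (w : E) :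
    geodesicResidual Gt u t w = geodesicResidual G (ψ ∘ u) t (fderiv ℝ ψ (u t) w) := by
  have hψ1 : HasFDerivAt ψ (fderiv ℝ ψ (u t)) (u t) :=
    (hψ.differentiableAt (by simp)).hasFDerivAt
  have hψ2 : HasFDerivAt (fderiv ℝ ψ) (fderiv ℝ (fderiv ℝ ψ) (u t)) (u t) :=
    ((hψ.fderiv_right (m := 1) (by norm_num)).differentiableAt (by simp)).hasFDerivAt
  have hu1 := (eventually_hasDerivAt hu)
  have hv1 : deriv (ψ ∘ u) =ᶠ[𝓝 t] fun s => fderiv ℝ ψ (u s) (deriv u s) := by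
    filter_upwards [hu1, hu.continuousAt.eventually (hψ.eventually (by simp))] with s hs hs'
    exact ((hs'.differentiableAt (by simp)).hasFDerivAt.comp_hasDerivAt s hs).deriv
  have hv2 : deriv (deriv (ψ ∘ u)) t = fderiv ℝ (fderiv ℝ ψ) (u t) (deriv u t) (deriv u t)
      + fderiv ℝ ψ (u t) (deriv (deriv u) t) := by
    rw [hv1.deriv_eq]
    exact ((hψ2.comp_hasDerivAt t hu1.self_of_nhds).clm_apply (hasDerivAt_deriv hu)).deriv
  have hD : ∀ c a b, fderiv ℝ Gt (u t) c a b =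
      fderiv ℝ G (ψ (u t)) (fderiv ℝ ψ (u t) c) (fderiv ℝ ψ (u t) a) (fderiv ℝ ψ (u t) b)
      + G (ψ (u t)) (fderiv ℝ (fderiv ℝ ψ) (u t) c a) (fderiv ℝ ψ (u t) b)
      + G (ψ (u t)) (fderiv ℝ ψ (u t) a) (fderiv ℝ (fderiv ℝ ψ) (u t) c b) := by
    intro c a b
    have h1 : HasFDerivAt (fun y => Gt y a b) _ (u t) :=
      (hGt.hasFDerivAt.clm_apply (hasFDerivAt_const a (u t))).clm_apply (hasFDerivAt_const b (u t))
    have h2 : HasFDerivAt (fun y => G (ψ y) (fderiv ℝ ψ y a) (fderiv ℝ ψ y b)) _ (u t) :=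
      ((hG.hasFDerivAt.comp (u t) hψ1).clm_apply
        (hψ2.clm_apply (hasFDerivAt_const a (u t)))).clm_apply
        (hψ2.clm_apply (hasFDerivAt_const b (u t)))
    have h3 : (fun y => Gt y a b) =ᶠ[𝓝 (u t)]
        fun y => G (ψ y) (fderiv ℝ ψ y a) (fderiv ℝ ψ y b) := h.mono fun y hy => hy a b
    have h4 := DFunLike.congr_fun (h1.unique (h2.congr_of_eventuallyEq h3)) c
    simp at h4
    rw [h4]
    ring
  have hD2 : ∀ a b, fderiv ℝ (fderiv ℝ ψ) (u t) a b = fderiv ℝ (fderiv ℝ ψ) (u t) b a :=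
    fun a b => (hψ.isSymmSndFDerivAt (by simp)) a b
  simp only [geodesicResidual, hD, hv2, hv1.self_of_nhds, Function.comp_apply,
    h.self_of_nhds, map_add, add_apply]
  rw [hD2 w (deriv u t), hsymm (fderiv ℝ (fderiv ℝ ψ) (u t) (deriv u t) w)
    (fderiv ℝ ψ (u t) (deriv u t))]
  ring

/-- The derivative of the energy `G(u', u')` along a curve. -/
lemma hasDerivAt_energy {G : E → E →L[ℝ] E →L[ℝ] ℝ} {u : ℝ → E} {t : ℝ}
    (hu : ContDiffAt ℝ 2 u t) (hG : DifferentiableAt ℝ G (u t))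
    (hsymm : ∀ a b, G (u t) a b = G (u t) b a) :
    HasDerivAt (fun s => G (u s) (deriv u s) (deriv u s))
      (2 * geodesicResidual G u t (deriv u t)) t := by
  have h1 := ((hG.hasFDerivAt.comp_hasDerivAt t (eventually_hasDerivAt hu).self_of_nhds).clm_apply
    (hasDerivAt_deriv hu)).clm_apply (hasDerivAt_deriv hu)
  convert! h1 using 1
  simp only [geodesicResidual, add_apply, Function.comp_apply]
  rw [hsymm (deriv u t) (deriv (deriv u) t)]
  ring

lemma geodesicResidual_congr {G : E → E →L[ℝ] E →L[ℝ] ℝ} {u v : ℝ → E} {t : ℝ}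
    (h : u =ᶠ[𝓝 t] v) (w : E) : geodesicResidual G u t w = geodesicResidual G v t w := by
  simp only [geodesicResidual, h.deriv.deriv_eq, h.deriv_eq, h.self_of_nhds]

lemma geodesicResidual_comp_sub (G : E → E →L[ℝ] E →L[ℝ] ℝ) (u : ℝ → E) (T t : ℝ) (w : E) :
    geodesicResidual G (fun s => u (s - T)) t w = geodesicResidual G u (t - T) w := by
  have h1 : deriv (fun s => u (s - T)) = fun s => deriv u (s - T) := by
    ext1 s; exact deriv_comp_sub_const ..
  have h2 : deriv (fun s => deriv u (s - T)) t = deriv (deriv u) (t - T) :=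
    deriv_comp_sub_const ..
  simp only [geodesicResidual, h1, h2]

lemma geodesicResidual_comp_neg (G : E → E →L[ℝ] E →L[ℝ] ℝ) (u : ℝ → E) (t : ℝ) (w : E) :
    geodesicResidual G (fun s => u (-s)) t w = geodesicResidual G u (-t) w := by
  have h1 : deriv (fun s => u (-s)) = fun s => -deriv u (-s) := by
    ext1 s; exact deriv_comp_neg u s
  have h2 : deriv (fun s => -deriv u (-s)) t = deriv (deriv u) (-t) := by
    rw [deriv.fun_neg, deriv_comp_neg (deriv u) t, neg_neg]
  simp only [geodesicResidual, h1, h2, map_neg, neg_apply, neg_neg]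

end EulerLagrange

section Geodesics

variable {n : ℕ} {M : Type*} [TopologicalSpace M] [ChartedSpace (EuclideanSpace ℝ (Fin n)) M]
  [IsManifold (𝓡 n) ω M]

/-- The curve `c` satisfies the geodesic equation at time `t`, an interior point of its interval
of definition: derivatives are two-sided. -/
def GeodesicAt (g : AnalyticMetric n M) (c : ℝ → M) (t : ℝ) : Prop :=
  ∀ w, geodesicResidual (coordMetric g (c t)) (coordCurve (n := n) c (c t)) t w = 0

lemma contDiffAt_coordCurve {m : WithTop ℕ∞} {c : ℝ → M} {p : M} {t : ℝ}
    (hc : ContMDiffAt 𝓘(ℝ, ℝ) (𝓡 n) m c t) (hp : c t ∈ (extChartAt (𝓡 n) p).source) :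
    ContDiffAt ℝ m (coordCurve (n := n) c p) t :=
  (ContMDiffAt.comp t ((contMDiffAt_chart hp).of_le le_top) hc).contDiffAt

lemma residual_eq_zero_of_chart (g : AnalyticMetric n M) {c : ℝ → M} {p q : M} {t : ℝ}
    (hc : ContMDiffAt 𝓘(ℝ, ℝ) (𝓡 n) 2 c t) (hp : c t ∈ (extChartAt (𝓡 n) p).source)
    (hq : c t ∈ (extChartAt (𝓡 n) q).source)
    (h : ∀ w, geodesicResidual (coordMetric g q) (coordCurve (n := n) c q) t w = 0) (w : Coord n) :
    geodesicResidual (coordMetric g p) (coordCurve (n := n) c p) t w = 0 := by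
  have hy : coordCurve (n := n) c p t ∈ (extChartAt (𝓡 n) p).target :=
    (extChartAt (𝓡 n) p).map_source hp
  have hyc : (extChartAt (𝓡 n) p).symm (coordCurve (n := n) c p t) = c t :=
    (extChartAt (𝓡 n) p).left_inv hp
  have hy' : (extChartAt (𝓡 n) p).symm (coordCurve (n := n) c p t) ∈
      (extChartAt (𝓡 n) q).source := by rwa [hyc]
  have hψ : transition p q (coordCurve (n := n) c p t) ∈ (extChartAt (𝓡 n) q).target :=
    (extChartAt (𝓡 n) q).map_source hy'
  have hcomp : coordCurve (n := n) c q =ᶠ[𝓝 t] transition p q ∘ coordCurve (n := n) c p := by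
    filter_upwards [hc.continuousAt.eventually (source_mem_nhds hp)] with s hs
    simp only [Function.comp, transition, coordCurve]
    rw [(extChartAt (𝓡 n) p).left_inv hs]
  rw [geodesicResidual_pullback (ψ := transition p q) (G := coordMetric g q)
    (contDiffAt_coordCurve hc hp) ((contDiffAt_transition hy hy').of_le le_top)
    ((contDiffAt_coordMetric g hψ).differentiableAt (by simp))
    ((contDiffAt_coordMetric g hy).differentiableAt (by simp))
    (coordMetric_symm g q _), ← geodesicResidual_congr hcomp, h]
  filter_upwards [eventually_mem_transition hy hy'] with z hz a b
  exact coordMetric_transition g hz.1 hz.2 a b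

/-- The geodesic equation may be checked in any chart. -/
lemma geodesicAt_iff (g : AnalyticMetric n M) {c : ℝ → M} {p : M} {t : ℝ}
    (hc : ContMDiffAt 𝓘(ℝ, ℝ) (𝓡 n) 2 c t) (hp : c t ∈ (extChartAt (𝓡 n) p).source) :
    GeodesicAt g c t ↔
      ∀ w, geodesicResidual (coordMetric g p) (coordCurve (n := n) c p) t w = 0 :=
  ⟨residual_eq_zero_of_chart g hc hp (mem_extChartAt_source (c t)),
    residual_eq_zero_of_chart g hc (mem_extChartAt_source (c t)) hp⟩

lemma GeodesicAt.congr {g : AnalyticMetric n M} {c d : ℝ → M} {t : ℝ} (h : GeodesicAt g c t)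
    (hcd : d =ᶠ[𝓝 t] c) : GeodesicAt g d t := by
  intro w
  have h1 : coordCurve (n := n) d (d t) =ᶠ[𝓝 t] coordCurve (n := n) c (c t) := by
    filter_upwards [hcd] with s hs
    simp only [coordCurve, hs, hcd.self_of_nhds]
  rw [geodesicResidual_congr h1, hcd.self_of_nhds]
  exact h w

lemma GeodesicAt.comp_sub {g : AnalyticMetric n M} {c : ℝ → M} {T t : ℝ}
    (h : GeodesicAt g c (t - T)) : GeodesicAt g (fun s => c (s - T)) t := fun w =>
  (geodesicResidual_comp_sub _ (coordCurve (n := n) c (c (t - T))) T t w).trans (h w)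

lemma GeodesicAt.comp_neg {g : AnalyticMetric n M} {c : ℝ → M} {t : ℝ}
    (h : GeodesicAt g c (-t)) : GeodesicAt g (fun s => c (-s)) t := fun w =>
  (geodesicResidual_comp_neg _ (coordCurve (n := n) c (c (-t))) t w).trans (h w)

/-- The velocity of a curve in terms of its coordinate expression. -/
lemma mfderiv_apply_one_eq_chartFrame {c : ℝ → M} {p : M} {t : ℝ}
    (hc : ContMDiffAt 𝓘(ℝ, ℝ) (𝓡 n) 1 c t) (hp : c t ∈ (extChartAt (𝓡 n) p).source) :
    (mfderiv 𝓘(ℝ, ℝ) (𝓡 n) c t : ℝ →L[ℝ] Coord n) 1 =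
      chartFrame p (coordCurve (n := n) c p t) (deriv (coordCurve (n := n) c p) t) := by
  have hy : coordCurve (n := n) c p t ∈ (extChartAt (𝓡 n) p).target :=
    (extChartAt (𝓡 n) p).map_source hp
  have h1 : c =ᶠ[𝓝 t] (extChartAt (𝓡 n) p).symm ∘ coordCurve (n := n) c p := by
    filter_upwards [hc.continuousAt.eventually (source_mem_nhds hp)] with s hs
    exact ((extChartAt (𝓡 n) p).left_inv hs).symm
  have h2 : HasMFDerivAt 𝓘(ℝ, ℝ) (𝓡 n) ((extChartAt (𝓡 n) p).symm ∘ coordCurve (n := n) c p) t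
      ((chartFrame p (coordCurve (n := n) c p t)).comp (fderiv ℝ (coordCurve (n := n) c p) t)) :=
    HasMFDerivAt.comp t (mdifferentiableAt_chart_symm hy).hasMFDerivAt
      ((contDiffAt_coordCurve hc hp).differentiableAt (by simp)).hasFDerivAt.hasMFDerivAt
  exact DFunLike.congr_fun (h2.congr_of_eventuallyEq h1).mfderiv 1

/-- The squared speed of a geodesic is locally constant. -/
lemma GeodesicAt.hasDerivAt_speed {g : AnalyticMetric n M} {c : ℝ → M} {t : ℝ}
    (hc : ContMDiffAt 𝓘(ℝ, ℝ) (𝓡 n) 2 c t) (h : GeodesicAt g c t) :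
    HasDerivAt (fun s => metricAt g (c s) ((mfderiv 𝓘(ℝ, ℝ) (𝓡 n) c s : ℝ →L[ℝ] Coord n) 1)
      ((mfderiv 𝓘(ℝ, ℝ) (𝓡 n) c s : ℝ →L[ℝ] Coord n) 1)) 0 t := by
  have hp := mem_extChartAt_source (I := 𝓡 n) (c t)
  have hy : coordCurve (n := n) c (c t) t ∈ (extChartAt (𝓡 n) (c t)).target :=
    (extChartAt (𝓡 n) (c t)).map_source hp
  have h1 := hasDerivAt_energy (contDiffAt_coordCurve hc hp)
    ((contDiffAt_coordMetric g hy).differentiableAt (by simp)) (coordMetric_symm g (c t) _)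
  rw [h, mul_zero] at h1
  refine h1.congr_of_eventuallyEq ?_
  filter_upwards [(contMDiffAt_iff_contMDiffAt_nhds (by simp)).1 hc,
    hc.continuousAt.eventually (source_mem_nhds hp)] with s hs hs'
  rw [mfderiv_apply_one_eq_chartFrame (hs.of_le (by norm_num)) hs', coordMetric_apply, coordCurve,
    (extChartAt (𝓡 n) (c t)).left_inv hs']

end Geodesics

/-! ### The geodesic vector field in a chart -/

section GeodesicField

variable {n : ℕ} {M : Type*} [TopologicalSpace M] [ChartedSpace (EuclideanSpace ℝ (Fin n)) M]
  [IsManifold (𝓡 n) ω M]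

lemma coordMetric_isInvertible (g : AnalyticMetric n M) {p : M} {y : Coord n}
    (hy : y ∈ (extChartAt (𝓡 n) p).target) : (coordMetric g p y).IsInvertible := by
  have hinj : Function.Injective (coordMetric g p y : Coord n →ₗ[ℝ] Coord n →L[ℝ] ℝ) := by
    rw [injective_iff_map_eq_zero]
    intro a ha
    by_contra hne
    have h1 := coordMetric_pos g hy hne
    have h2 : coordMetric g p y a a = 0 := by
      have : coordMetric g p y a = 0 := ha
      rw [this]; rfl
    linarith
  have hdim : Module.finrank ℝ (Coord n) = Module.finrank ℝ (Coord n →L[ℝ] ℝ) := by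
    rw [← LinearEquiv.finrank_eq
      (LinearMap.toContinuousLinearMap (𝕜 := ℝ) (E := Coord n) (F' := ℝ))]
    exact (Subspace.dual_finrank_eq (K := ℝ) (V := Coord n)).symm
  exact ⟨(LinearEquiv.ofInjectiveOfFinrankEq _ hinj hdim).toContinuousLinearEquiv, by ext; rfl⟩

/-- The covector `w ↦ Γ_{jk,l} v^j v^k w^l` at the point with coordinates `y`. -/
def christoffelCovector (g : AnalyticMetric n M) (p : M) (y v : Coord n) : Coord n →L[ℝ] ℝ :=
  fderiv ℝ (coordMetric g p) y v v -
    (1 / 2 : ℝ) • ((fderiv ℝ (coordMetric g p) y).flip v).flip v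

/-- The acceleration `-Γ^j_{kl} v^k v^l` of a geodesic with velocity `v` at the point with
coordinates `y`. -/
def geodesicAcceleration (g : AnalyticMetric n M) (p : M) (y v : Coord n) : Coord n :=
  -(coordMetric g p y).inverse (christoffelCovector g p y v)

/-- The geodesic equation in the chart at `p` as a first order system for position and velocity. -/
def geodesicField (g : AnalyticMetric n M) (p : M) (z : Coord n × Coord n) : Coord n × Coord n :=
  (z.2, geodesicAcceleration g p z.1 z.2)

/-- The geodesic equation solved for the acceleration. -/
lemma geodesicResidual_eq_zero_iff (g : AnalyticMetric n M) {p : M} {u : ℝ → Coord n} {t : ℝ}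
    (hu : u t ∈ (extChartAt (𝓡 n) p).target) :
    (∀ w, geodesicResidual (coordMetric g p) u t w = 0) ↔
      deriv (deriv u) t = geodesicAcceleration g p (u t) (deriv u t) := by
  have hinv := coordMetric_isInvertible g hu
  have key : ∀ w, geodesicResidual (coordMetric g p) u t w =
      (coordMetric g p (u t) (deriv (deriv u) t) +
        christoffelCovector g p (u t) (deriv u t)) w := by
    intro w
    simp only [geodesicResidual, christoffelCovector, add_apply, sub_apply, smul_apply,
      ContinuousLinearMap.flip_apply, smul_eq_mul]
    ring
  have h1 : (∀ w, geodesicResidual (coordMetric g p) u t w = 0) ↔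
      coordMetric g p (u t) (deriv (deriv u) t) = -christoffelCovector g p (u t) (deriv u t) := by
    rw [← add_eq_zero_iff_eq_neg, ContinuousLinearMap.ext_iff]
    exact forall_congr' fun w => by rw [key]; rfl
  rw [h1, geodesicAcceleration, ← map_neg]
  obtain ⟨e, he⟩ := hinv
  rw [← he, ContinuousLinearMap.inverse_equiv]
  exact e.eq_symm_apply.symm

lemma contDiffAt_christoffelCovector (g : AnalyticMetric n M) {p : M} {z : Coord n × Coord n}
    (hz : z.1 ∈ (extChartAt (𝓡 n) p).target) :
    ContDiffAt ℝ ω (fun q : Coord n × Coord n => christoffelCovector g p q.1 q.2) z := by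
  have key : ContDiffOn ℝ ω (fun q : Coord n × Coord n => christoffelCovector g p q.1 q.2)
      (Prod.fst ⁻¹' (extChartAt (𝓡 n) p).target) := by
    refine contDiffOn_clm_apply.2 fun w q hq => ContDiffAt.contDiffWithinAt ?_
    have hD : ContDiffAt ℝ ω (fun q : Coord n × Coord n => fderiv ℝ (coordMetric g p) q.1) q :=
      ((contDiffAt_coordMetric g hq).fderiv_right (by simp)).comp q contDiffAt_fst
    have hw : ContDiffAt ℝ ω (fun _ : Coord n × Coord n => w) q := contDiffAt_const
    exact (((hD.clm_apply contDiffAt_snd).clm_apply contDiffAt_snd).clm_apply hw).sub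
      ((((hD.clm_apply hw).clm_apply contDiffAt_snd).clm_apply contDiffAt_snd).const_smul
        (1 / 2 : ℝ))
  exact key.contDiffAt (((isOpen_extChartAt_target p).preimage continuous_fst).mem_nhds hz)

set_option synthInstance.maxHeartbeats 200000 in
lemma contDiffAt_geodesicField (g : AnalyticMetric n M) {p : M} {z : Coord n × Coord n}
    (hz : z.1 ∈ (extChartAt (𝓡 n) p).target) : ContDiffAt ℝ ω (geodesicField g p) z := by
  have hinv : ContDiffAt ℝ ω
      (fun q : Coord n × Coord n => (coordMetric g p q.1).inverse) z :=
    ContDiffAt.comp z (g := ContinuousLinearMap.inverse)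
      (f := fun q : Coord n × Coord n => coordMetric g p q.1)
      ((coordMetric_isInvertible g hz).contDiffAt_map_inverse)
      ((contDiffAt_coordMetric g hz).comp z contDiffAt_fst)
  exact contDiffAt_snd.prodMk (hinv.clm_apply (contDiffAt_christoffelCovector g hz)).neg

end GeodesicField

/-! ### Analytic families of geodesics -/

section Slice

variable {n : ℕ} {M : Type*} [TopologicalSpace M] [ChartedSpace (EuclideanSpace ℝ (Fin n)) M]
  {P : Type*} [NormedAddCommGroup P] [NormedSpace ℝ P]

lemma contMDiffAt_slice {Γ : P × ℝ → M} {q : P × ℝ}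
    (h : ContMDiffAt 𝓘(ℝ, P × ℝ) (𝓡 n) ω Γ q) :
    ContMDiffAt 𝓘(ℝ, ℝ) (𝓡 n) ω (fun t => Γ (q.1, t)) q.2 := by
  have h1 : ContMDiffAt 𝓘(ℝ, ℝ) 𝓘(ℝ, P × ℝ) ω (fun t : ℝ => (q.1, t)) q.2 :=
    (contDiffAt_const.prodMk contDiffAt_id).contMDiffAt
  exact ContMDiffAt.comp q.2 h h1

end Slice

section Families

variable {n : ℕ} {M : Type*} [TopologicalSpace M] [ChartedSpace (EuclideanSpace ℝ (Fin n)) M]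
  [IsManifold (𝓡 n) ω M]
  {P : Type*} [NormedAddCommGroup P] [NormedSpace ℝ P]
  {P' : Type*} [NormedAddCommGroup P'] [NormedSpace ℝ P']

/-- Near the point `q₀` of `P × ℝ`, the map `Γ` is an analytic family of geodesics
`t ↦ Γ (z, t)` with parameter `z ∈ P`. -/
def IsGeodesicFamilyAt (g : AnalyticMetric n M) (Γ : P × ℝ → M) (q₀ : P × ℝ) : Prop :=
  ∀ᶠ q in 𝓝 q₀, ContMDiffAt 𝓘(ℝ, P × ℝ) (𝓡 n) ω Γ q ∧ GeodesicAt g (fun t => Γ (q.1, t)) q.2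

/-- Position and velocity, in the chart at `p`, of the curve `t ↦ Γ (q.1, t)` at time `q.2`. -/
def chartState (p : M) (Γ : P × ℝ → M) (q : P × ℝ) : Coord n × Coord n :=
  (extChartAt (𝓡 n) p (Γ q), deriv (coordCurve (fun t => Γ (q.1, t)) p) q.2)

lemma IsGeodesicFamilyAt.congr {g : AnalyticMetric n M} {Γ Γ' : P × ℝ → M} {q₀ : P × ℝ}
    (h : IsGeodesicFamilyAt g Γ q₀) (h' : Γ' =ᶠ[𝓝 q₀] Γ) : IsGeodesicFamilyAt g Γ' q₀ := by
  filter_upwards [h, h'.eventuallyEq_nhds] with q hq hq'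
  refine ⟨hq.1.congr_of_eventuallyEq hq', hq.2.congr ?_⟩
  have hc : Tendsto (fun t : ℝ => (q.1, t)) (𝓝 q.2) (𝓝 q) :=
    (Continuous.prodMk_right q.1).tendsto q.2
  exact hc.eventually hq'

/-- Reparametrization of a family of geodesics with a time shift. -/
lemma IsGeodesicFamilyAt.comp_sub {g : AnalyticMetric n M} {Γ : P × ℝ → M} {σ : P' → P} {z₀ : P'}
    {T t₀ : ℝ} (hσ : ContDiffAt ℝ ω σ z₀) (h : IsGeodesicFamilyAt g Γ (σ z₀, t₀ - T)) :
    IsGeodesicFamilyAt g (fun q : P' × ℝ => Γ (σ q.1, q.2 - T)) (z₀, t₀) := by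
  have hcont : ContinuousAt (fun q : P' × ℝ => (σ q.1, q.2 - T)) (z₀, t₀) :=
    (hσ.continuousAt.comp (x := (z₀, t₀)) continuousAt_fst).prodMk
      (continuousAt_snd.sub continuousAt_const)
  have hσ' : ∀ᶠ q : P' × ℝ in 𝓝 (z₀, t₀), ContDiffAt ℝ ω σ q.1 :=
    continuousAt_fst.eventually (hσ.eventually (by simp))
  filter_upwards [hcont.eventually h, hσ'] with q hq hq'
  have hC : ContMDiffAt 𝓘(ℝ, P' × ℝ) 𝓘(ℝ, P × ℝ) ω (fun q : P' × ℝ => (σ q.1, q.2 - T)) q :=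
    ((hq'.comp q contDiffAt_fst).prodMk (contDiffAt_snd.sub contDiffAt_const)).contMDiffAt
  exact ⟨ContMDiffAt.comp q hq.1 hC, GeodesicAt.comp_sub (c := fun t => Γ (σ q.1, t)) hq.2⟩

/-- Reparametrization of a family of geodesics with time reversed. -/
lemma IsGeodesicFamilyAt.comp_neg {g : AnalyticMetric n M} {Γ : P × ℝ → M} {σ : P' → P} {z₀ : P'}
    {t₀ : ℝ} (hσ : ContDiffAt ℝ ω σ z₀) (h : IsGeodesicFamilyAt g Γ (σ z₀, -t₀)) :
    IsGeodesicFamilyAt g (fun q : P' × ℝ => Γ (σ q.1, -q.2)) (z₀, t₀) := by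
  have hcont : ContinuousAt (fun q : P' × ℝ => (σ q.1, -q.2)) (z₀, t₀) :=
    (hσ.continuousAt.comp (x := (z₀, t₀)) continuousAt_fst).prodMk continuousAt_snd.neg
  have hσ' : ∀ᶠ q : P' × ℝ in 𝓝 (z₀, t₀), ContDiffAt ℝ ω σ q.1 :=
    continuousAt_fst.eventually (hσ.eventually (by simp))
  filter_upwards [hcont.eventually h, hσ'] with q hq hq'
  have hC : ContMDiffAt 𝓘(ℝ, P' × ℝ) 𝓘(ℝ, P × ℝ) ω (fun q : P' × ℝ => (σ q.1, -q.2)) q :=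
    ((hq'.comp q contDiffAt_fst).prodMk (contDiffAt_snd.neg)).contMDiffAt
  exact ⟨ContMDiffAt.comp q hq.1 hC, GeodesicAt.comp_neg (c := fun t => Γ (σ q.1, t)) hq.2⟩

/-- In a chart, a family of geodesics is an analytic family of solutions of the first order
system. -/
lemma IsGeodesicFamilyAt.chartState_solution {g : AnalyticMetric n M} {Γ : P × ℝ → M} {q₀ : P × ℝ}
    (h : IsGeodesicFamilyAt g Γ q₀) {p : M} (hp : Γ q₀ ∈ (extChartAt (𝓡 n) p).source) :
    ∀ᶠ q in 𝓝 q₀, Γ q ∈ (extChartAt (𝓡 n) p).source ∧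
      ContDiffAt ℝ ω (chartState (n := n) p Γ) q ∧
      HasDerivAt (fun t => chartState (n := n) p Γ (q.1, t))
        (geodesicField g p (chartState (n := n) p Γ q)) q.2 := by
  have hcont := h.self_of_nhds.1.continuousAt
  have hev : ∀ᶠ q in 𝓝 q₀, (ContMDiffAt 𝓘(ℝ, P × ℝ) (𝓡 n) ω Γ q ∧
      GeodesicAt g (fun t => Γ (q.1, t)) q.2) ∧ Γ q ∈ (extChartAt (𝓡 n) p).source :=
    h.and (hcont.eventually (source_mem_nhds hp))
  filter_upwards [hev.eventually_nhds] with q hq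
  have hu : ∀ᶠ r in 𝓝 q, ContDiffAt ℝ ω (fun r => extChartAt (𝓡 n) p (Γ r)) r := by
    filter_upwards [hq] with r hr
    exact (ContMDiffAt.comp r (contMDiffAt_chart hr.2) hr.1.1).contDiffAt
  have hderiv : ∀ᶠ r in 𝓝 q, deriv (coordCurve (n := n) (fun t => Γ (r.1, t)) p) r.2 =
      fderiv ℝ (fun r => extChartAt (𝓡 n) p (Γ r)) r (0, 1) := by
    filter_upwards [hu] with r hr
    have h1 : HasDerivAt (fun t : ℝ => (r.1, t)) ((0, 1) : P × ℝ) r.2 :=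
      (hasDerivAt_const r.2 r.1).prodMk (hasDerivAt_id r.2)
    exact ((hr.differentiableAt (by simp)).hasFDerivAt.comp_hasDerivAt r.2 h1).deriv
  obtain ⟨⟨hq1, hq2⟩, hq3⟩ := hq.self_of_nhds
  have hsl := contMDiffAt_slice hq1
  refine ⟨hq3, ?_, ?_⟩
  · have h2 : ContDiffAt ℝ ω (fun r => fderiv ℝ (fun r => extChartAt (𝓡 n) p (Γ r)) r (0, 1)) q :=
      (hu.self_of_nhds.fderiv_right (by simp)).clm_apply contDiffAt_const
    refine hu.self_of_nhds.prodMk (h2.congr_of_eventuallyEq ?_)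
    exact hderiv
  · have hcu : ContDiffAt ℝ 2 (coordCurve (n := n) (fun t => Γ (q.1, t)) p) q.2 :=
      contDiffAt_coordCurve (hsl.of_le le_top) hq3
    have hres := (geodesicResidual_eq_zero_iff g
      (u := coordCurve (n := n) (fun t => Γ (q.1, t)) p) (t := q.2)
      ((extChartAt (𝓡 n) p).map_source hq3)).1
      ((geodesicAt_iff g (hsl.of_le le_top) hq3).1 hq2)
    have h3 := (eventually_hasDerivAt hcu).self_of_nhds.prodMk (hasDerivAt_deriv hcu)
    rw [hres] at h3
    exact h3

/-- Solutions of the first order system in a chart are geodesics. -/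
lemma isGeodesicFamilyAt_of_solution {g : AnalyticMetric n M} {p : M}
    {Φ : P × ℝ → Coord n × Coord n} {q₀ : P × ℝ} (hΦ : ContDiffAt ℝ ω Φ q₀)
    (hp : (Φ q₀).1 ∈ (extChartAt (𝓡 n) p).target)
    (h : ∀ᶠ q in 𝓝 q₀, HasDerivAt (fun t => Φ (q.1, t)) (geodesicField g p (Φ q)) q.2) :
    IsGeodesicFamilyAt g (fun q => (extChartAt (𝓡 n) p).symm (Φ q).1) q₀ ∧
      ∀ᶠ q in 𝓝 q₀, chartState (n := n) p (fun q => (extChartAt (𝓡 n) p).symm (Φ q).1) q = Φ q := by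
  have hev : ∀ᶠ q in 𝓝 q₀, ContDiffAt ℝ ω Φ q ∧ (Φ q).1 ∈ (extChartAt (𝓡 n) p).target ∧
      HasDerivAt (fun t => Φ (q.1, t)) (geodesicField g p (Φ q)) q.2 := by
    refine (hΦ.eventually (by simp)).and (Eventually.and ?_ h)
    exact hΦ.continuousAt.fst.eventually (target_mem_nhds hp)
  have main : ∀ᶠ q in 𝓝 q₀,
      (ContMDiffAt 𝓘(ℝ, P × ℝ) (𝓡 n) ω (fun q => (extChartAt (𝓡 n) p).symm (Φ q).1) q ∧
      GeodesicAt g (fun t => (extChartAt (𝓡 n) p).symm (Φ (q.1, t)).1) q.2) ∧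
      chartState (n := n) p (fun q => (extChartAt (𝓡 n) p).symm (Φ q).1) q = Φ q := by
    filter_upwards [hev.eventually_nhds] with q hq
    obtain ⟨h1, h2, h3⟩ := hq.self_of_nhds
    have hC : ContMDiffAt 𝓘(ℝ, P × ℝ) (𝓡 n) ω (fun q => (extChartAt (𝓡 n) p).symm (Φ q).1) q :=
      ContMDiffAt.comp q (contMDiffAt_chart_symm h2) h1.fst.contMDiffAt
    have hq' : ∀ᶠ t in 𝓝 q.2, (Φ (q.1, t)).1 ∈ (extChartAt (𝓡 n) p).target ∧
        HasDerivAt (fun t => Φ (q.1, t)) (geodesicField g p (Φ (q.1, t))) t := by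
      have hc : Tendsto (fun t : ℝ => (q.1, t)) (𝓝 q.2) (𝓝 q) :=
        (Continuous.prodMk_right q.1).tendsto q.2
      exact (hc.eventually hq).mono fun t ht => ht.2
    have hu : ∀ᶠ t in 𝓝 q.2,
        coordCurve (n := n) (fun t => (extChartAt (𝓡 n) p).symm (Φ (q.1, t)).1) p t =
          (Φ (q.1, t)).1 := by
      filter_upwards [hq'] with t ht
      exact (extChartAt (𝓡 n) p).right_inv ht.1
    have hv : deriv (coordCurve (n := n) (fun t => (extChartAt (𝓡 n) p).symm (Φ (q.1, t)).1) p)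
        =ᶠ[𝓝 q.2] fun t => (Φ (q.1, t)).2 := by
      filter_upwards [hu.eventually_nhds, hq'] with t ht ht'
      rw [EventuallyEq.deriv_eq ht]
      simpa [geodesicField] using (HasFDerivAt.fst ht'.2.hasFDerivAt).hasDerivAt.deriv
    have ha : deriv (deriv (coordCurve (n := n)
        (fun t => (extChartAt (𝓡 n) p).symm (Φ (q.1, t)).1) p)) q.2 =
        geodesicAcceleration g p (Φ q).1 (Φ q).2 := by
      rw [hv.deriv_eq]
      simpa [geodesicField] using (HasFDerivAt.snd h3.hasFDerivAt).hasDerivAt.deriv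
    refine ⟨⟨hC, ?_⟩, ?_⟩
    · rw [geodesicAt_iff g ((contMDiffAt_slice hC).of_le le_top)
        ((extChartAt (𝓡 n) p).map_target h2), geodesicResidual_eq_zero_iff g, ha,
        hv.self_of_nhds, hu.self_of_nhds]
      rw [hu.self_of_nhds]
      exact h2
    · exact Prod.ext hu.self_of_nhds hv.self_of_nhds
  exact ⟨main.mono fun q hq => hq.1, main.mono fun q hq => hq.2⟩

/-- Two families of geodesics with the same initial data at time `t₀` agree. -/
lemma IsGeodesicFamilyAt.eventuallyEq {g : AnalyticMetric n M} {Γ Γ' : P × ℝ → M} {z₀ : P} {t₀ : ℝ}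
    (h : IsGeodesicFamilyAt g Γ (z₀, t₀)) (h' : IsGeodesicFamilyAt g Γ' (z₀, t₀)) {p : M}
    (hp : Γ (z₀, t₀) ∈ (extChartAt (𝓡 n) p).source)
    (hp' : Γ' (z₀, t₀) ∈ (extChartAt (𝓡 n) p).source)
    (heq : ∀ᶠ z in 𝓝 z₀, chartState (n := n) p Γ (z, t₀) =
      chartState (n := n) p Γ' (z, t₀)) :
    Γ =ᶠ[𝓝 (z₀, t₀)] Γ' := by
  have hS := h.chartState_solution hp
  have hS' := h'.chartState_solution hp'
  have hcont := hS.self_of_nhds.2.1.continuousAt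
  have hcont' := hS'.self_of_nhds.2.1.continuousAt
  obtain ⟨K, U, hU, hK⟩ := ((contDiffAt_geodesicField g (p := p)
    (z := chartState (n := n) p Γ (z₀, t₀))
    ((extChartAt (𝓡 n) p).map_source hp)).of_le le_top).exists_lipschitzOnWith
  have hU' : U ∈ 𝓝 (chartState (n := n) p Γ' (z₀, t₀)) := by
    rwa [← heq.self_of_nhds]
  have hev := (hS.and (hcont.eventually hU)).and (hS'.and (hcont'.eventually hU'))
  rw [nhds_prod_eq, eventually_prod_iff] at hev
  obtain ⟨A, hA, B, hB, hAB⟩ := hev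
  obtain ⟨δ, hδ, hBδ⟩ := Metric.eventually_nhds_iff_ball.1 hB
  rw [Real.ball_eq_Ioo] at hBδ
  have hgoal : ∀ᶠ q : P × ℝ in 𝓝 (z₀, t₀), (A q.1 ∧
      chartState (n := n) p Γ (q.1, t₀) =
        chartState (n := n) p Γ' (q.1, t₀)) ∧ q.2 ∈ Ioo (t₀ - δ) (t₀ + δ) := by
    refine Eventually.and ((continuous_fst.tendsto (z₀, t₀)).eventually (hA.and heq)) ?_
    exact continuousAt_snd.eventually (Ioo_mem_nhds (by linarith) (by linarith))
  filter_upwards [hgoal] with q ⟨⟨hqA, hqe⟩, hqt⟩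
  have hun := ODE_solution_unique_of_mem_Ioo (v := fun _ => geodesicField g p) (s := fun _ => U)
    (K := K) (a := t₀ - δ) (b := t₀ + δ) (t₀ := t₀)
    (f := fun t => chartState (n := n) p Γ (q.1, t))
    (g := fun t => chartState (n := n) p Γ' (q.1, t)) (fun _ _ => hK)
    ⟨by linarith, by linarith⟩
    (fun t ht => ⟨(hAB hqA (hBδ t ht)).1.1.2.2, (hAB hqA (hBδ t ht)).1.2⟩)
    (fun t ht => ⟨(hAB hqA (hBδ t ht)).2.1.2.2, (hAB hqA (hBδ t ht)).2.2⟩) hqe hqt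
  have h5 := congrArg Prod.fst hun
  exact (extChartAt (𝓡 n) p).injOn (hAB hqA (hBδ _ hqt)).1.1.1 (hAB hqA (hBδ _ hqt)).2.1.1 h5

end Families

/-! ### Continuation along a given geodesic -/

section Continuation

variable {n : ℕ} {M : Type*} [TopologicalSpace M] [ChartedSpace (EuclideanSpace ℝ (Fin n)) M]

/-- Position and velocity at time `t`, in the chart at `p`, of a curve `γ : [A, B] → M`. -/
def curveState (γ : ℝ → M) (A B : ℝ) (p : M) (t : ℝ) : Coord n × Coord n :=
  (extChartAt (𝓡 n) p (γ t), derivWithin (coordCurve γ p) (Icc A B) t)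

lemma chartState_congr {P : Type*} [TopologicalSpace P] (p : M) {Γ Γ' : P × ℝ → M} {q : P × ℝ}
    (h : Γ' =ᶠ[𝓝 q] Γ) : chartState (n := n) p Γ' q = chartState p Γ q := by
  have h1 : ∀ᶠ t in 𝓝 q.2, Γ' (q.1, t) = Γ (q.1, t) :=
    ((Continuous.prodMk_right q.1).tendsto q.2).eventually h
  have h2 : coordCurve (n := n) (fun t => Γ' (q.1, t)) p =ᶠ[𝓝 q.2]
      coordCurve (fun t => Γ (q.1, t)) p := by
    filter_upwards [h1] with t ht
    simp only [coordCurve, ht]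
  exact Prod.ext (congrArg (extChartAt (𝓡 n) p) h.self_of_nhds) h2.deriv_eq

/-- Two families of curves which agree near `(z₀, T)` can be glued at time `T`. -/
lemma exists_glue {P X : Type*} [TopologicalSpace P] {Γ Γ' : P × ℝ → X} {z₀ : P} {T : ℝ}
    (h : Γ =ᶠ[𝓝 (z₀, T)] Γ') :
    ∃ Γ'' : P × ℝ → X, (∀ t ≤ T, Γ'' =ᶠ[𝓝 (z₀, t)] Γ) ∧ ∀ t, T ≤ t → Γ'' =ᶠ[𝓝 (z₀, t)] Γ' := by
  let Γ'' : P × ℝ → X := fun q => if q.2 ≤ T then Γ q else Γ' q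
  have hT : Γ'' =ᶠ[𝓝 (z₀, T)] Γ := by
    filter_upwards [h] with q hq
    simp only [Γ'']
    split_ifs
    · rfl
    · exact hq.symm
  refine ⟨Γ'', fun t ht => ?_, fun t ht => ?_⟩
  · rcases ht.lt_or_eq with ht | rfl
    · filter_upwards [(continuous_snd.tendsto (z₀, t)).eventually (Iio_mem_nhds ht)] with q hq
      exact if_pos (le_of_lt hq)
    · exact hT
  · rcases ht.lt_or_eq with ht | rfl
    · filter_upwards [(continuous_snd.tendsto (z₀, t)).eventually (Ioi_mem_nhds ht)] with q hq
      exact if_neg (not_le.2 hq)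
    · exact hT.trans h

variable [IsManifold (𝓡 n) ω M]

/-- Local analytic flow of the geodesic vector field in the chart at `p`, on a neighbourhood where
the vector field is Lipschitz continuous. -/
lemma exists_geodesic_flowBox (g : AnalyticMetric n M) {p : M} {s₀ : Coord n × Coord n}
    (hs₀ : s₀.1 ∈ (extChartAt (𝓡 n) p).target) :
    ∃ (Φ : (Coord n × Coord n) × ℝ → Coord n × Coord n) (ε : ℝ) (U L : Set (Coord n × Coord n))
      (K : NNReal), 0 < ε ∧ U ∈ 𝓝 s₀ ∧ U ⊆ L ∧ LipschitzOnWith K (geodesicField g p) L ∧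
      (∀ s ∈ U, Φ (s, 0) = s) ∧
      ∀ s ∈ U, ∀ t ∈ Ioo (-ε) ε,
        HasDerivAt (fun t => Φ (s, t)) (geodesicField g p (Φ (s, t))) t ∧ Φ (s, t) ∈ L ∧
        (Φ (s, t)).1 ∈ (extChartAt (𝓡 n) p).target ∧
        IsGeodesicFamilyAt g (fun q => (extChartAt (𝓡 n) p).symm (Φ q).1) (s, t) ∧
        chartState p (fun q => (extChartAt (𝓡 n) p).symm (Φ q).1) (s, t) = Φ (s, t) := by
  have hF := contDiffAt_geodesicField g hs₀
  obtain ⟨Φ, hΦ, hΦ0, hΦd⟩ := exists_analytic_flow hF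
  obtain ⟨K, L, hL, hK⟩ := (hF.of_le le_top).exists_lipschitzOnWith
  have hs : Φ (s₀, 0) = s₀ := hΦ0.self_of_nhds
  have hev : ∀ᶠ q in 𝓝 (s₀, (0 : ℝ)), (ContDiffAt ℝ ω Φ q ∧
      HasDerivAt (fun t => Φ (q.1, t)) (geodesicField g p (Φ q)) q.2) ∧ Φ q ∈ L ∧
      (Φ q).1 ∈ (extChartAt (𝓡 n) p).target := by
    refine ((hΦ.eventually (by simp)).and hΦd).and (Eventually.and ?_ ?_)
    · exact hΦ.continuousAt.eventually (by rwa [hs])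
    · exact hΦ.continuousAt.fst.eventually (target_mem_nhds (by simpa only [hs] using hs₀))
  have hev' := hev.eventually_nhds
  rw [nhds_prod_eq, eventually_prod_iff] at hev'
  obtain ⟨a, ha, b, hb, hab⟩ := hev'
  obtain ⟨ε, hε, hbε⟩ := Metric.eventually_nhds_iff_ball.1 hb
  rw [Real.ball_eq_Ioo, zero_sub, zero_add] at hbε
  have hb0 : b 0 := hb.self_of_nhds
  refine ⟨Φ, ε, {s | a s ∧ Φ (s, 0) = s}, L, K, hε, ha.and hΦ0, ?_, hK, fun s hs => hs.2, ?_⟩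
  · intro s hs
    have := (hab hs.1 hb0).self_of_nhds.2.1
    rwa [hs.2] at this
  · intro s hs t ht
    have h := hab hs.1 (hbε t ht)
    obtain ⟨⟨h1, h2⟩, h3, h4⟩ := h.self_of_nhds
    obtain ⟨h5, h6⟩ := isGeodesicFamilyAt_of_solution (g := g) h1 h4 (h.mono fun q hq => hq.1.2)
    exact ⟨h2, h3, h4, h5, h6.self_of_nhds⟩

variable {g : AnalyticMetric n M} {γ : ℝ → M} {A B : ℝ}

lemma contDiffWithinAt_coordCurve (hγ : ContMDiffOn 𝓘(ℝ, ℝ) (𝓡 n) 2 γ (Icc A B)) {p : M} {t : ℝ}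
    (ht : t ∈ Icc A B) (hp : γ t ∈ (extChartAt (𝓡 n) p).source) :
    ContDiffWithinAt ℝ 2 (coordCurve (n := n) γ p) (Icc A B) t :=
  (ContMDiffAt.comp_contMDiffWithinAt t ((contMDiffAt_chart hp).of_le le_top)
    (hγ t ht)).contDiffWithinAt

lemma continuousWithinAt_curveState (hAB : A < B)
    (hγ : ContMDiffOn 𝓘(ℝ, ℝ) (𝓡 n) 2 γ (Icc A B)) {p : M} {t : ℝ}
    (ht : t ∈ Icc A B) (hp : γ t ∈ (extChartAt (𝓡 n) p).source) :
    ContinuousWithinAt (curveState (n := n) γ A B p) (Icc A B) t := by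
  have hu := contDiffWithinAt_coordCurve hγ ht hp
  have h1 : ContDiffWithinAt ℝ 1 (fderivWithin ℝ (coordCurve (n := n) γ p) (Icc A B))
      (Icc A B) t := hu.fderivWithin_right (uniqueDiffOn_Icc hAB) (by norm_num) ht
  exact hu.continuousWithinAt.prodMk (h1.continuousWithinAt.clm_apply continuousWithinAt_const)

lemma hasDerivAt_curveState (hγ : ContMDiffOn 𝓘(ℝ, ℝ) (𝓡 n) 2 γ (Icc A B))
    (hgeo : ∀ t ∈ Ioo A B, GeodesicAt g γ t) {p : M} {t : ℝ}
    (ht : t ∈ Ioo A B) (hp : γ t ∈ (extChartAt (𝓡 n) p).source) :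
    HasDerivAt (curveState (n := n) γ A B p)
      (geodesicField g p (curveState γ A B p t)) t := by
  have hc : ContMDiffAt 𝓘(ℝ, ℝ) (𝓡 n) 2 γ t :=
    hγ.contMDiffAt (Icc_mem_nhds ht.1 ht.2)
  have hu := contDiffAt_coordCurve hc hp
  have heq : curveState (n := n) γ A B p =ᶠ[𝓝 t]
      fun s => (coordCurve γ p s, deriv (coordCurve γ p) s) := by
    filter_upwards [Ioo_mem_nhds ht.1 ht.2] with s hs
    exact Prod.ext rfl (derivWithin_of_mem_nhds (Icc_mem_nhds hs.1 hs.2))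
  have h3 := (eventually_hasDerivAt hu).self_of_nhds.prodMk (hasDerivAt_deriv hu)
  rw [(geodesicResidual_eq_zero_iff g (u := coordCurve (n := n) γ p) (t := t)
    ((extChartAt (𝓡 n) p).map_source hp)).1
    ((geodesicAt_iff g hc hp).1 (hgeo t ht))] at h3
  rw [heq.self_of_nhds]
  exact h3.congr_of_eventuallyEq heq

/-- The geodesic `γ` is embedded, on `[-δ, T]`, in a family of geodesics that is analytic near
`[0, T]` and is parametrized by position and velocity at time `0` in the chart at `γ 0`. Agreement
to the left of `0`, for some `δ > 0`, ensures that at `T`, too, both curves have the same velocity,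
even for `T = 0` or at the end point of the domain of `γ`. -/
def HasFamilyUpTo (g : AnalyticMetric n M) (γ : ℝ → M) (z₀ : Coord n × Coord n) (δ T : ℝ) : Prop :=
  ∃ Γ : (Coord n × Coord n) × ℝ → M, (∀ t ∈ Icc 0 T, IsGeodesicFamilyAt g Γ (z₀, t)) ∧
    (∀ t ∈ Icc (-δ) T, Γ (z₀, t) = γ t) ∧ ∀ᶠ z in 𝓝 z₀, chartState (γ 0) Γ (z, 0) = z

lemma exists_hasFamilyUpTo_zero (hA : A < 0) (hB : 0 < B)
    (hγ : ContMDiffOn 𝓘(ℝ, ℝ) (𝓡 n) 2 γ (Icc A B)) (hgeo : ∀ t ∈ Ioo A B, GeodesicAt g γ t) :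
    ∃ δ, 0 < δ ∧ A ≤ -δ ∧ HasFamilyUpTo g γ (curveState γ A B (γ 0) 0) δ 0 := by
  have hp := mem_extChartAt_source (I := 𝓡 n) (γ 0)
  obtain ⟨Φ, ε, U, L, K, hε, hU, hUL, hK, hΦ0, hΦ⟩ := exists_geodesic_flowBox g
    (p := γ 0) (s₀ := curveState γ A B (γ 0) 0) ((extChartAt (𝓡 n) (γ 0)).map_source hp)
  have h0 : (0 : ℝ) ∈ Ioo A B := ⟨hA, hB⟩
  have hcont := (hasDerivAt_curveState hγ hgeo h0 hp).continuousAt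
  have hcγ : ContinuousAt γ 0 :=
    (hγ.contMDiffAt (Icc_mem_nhds h0.1 h0.2)).continuousAt
  obtain ⟨η, hη, hball⟩ := Metric.eventually_nhds_iff_ball.1
    (((hcont.eventually hU).and (hcγ.eventually (source_mem_nhds hp))).and
      (Ioo_mem_nhds h0.1 h0.2))
  rw [Real.ball_eq_Ioo, zero_sub, zero_add] at hball
  have hs₀ := mem_of_mem_nhds hU
  have hδ : 0 < min ε η := lt_min hε hη
  have hun := ODE_solution_unique_of_mem_Ioo (v := fun _ => geodesicField g (γ 0))
    (s := fun _ => L) (K := K) (a := -(min ε η)) (b := min ε η) (t₀ := 0)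
    (f := fun t => Φ (curveState γ A B (γ 0) 0, t))
    (g := curveState γ A B (γ 0)) (fun _ _ => hK) ⟨by linarith, hδ⟩
    (fun t ht => by
      have := hΦ _ hs₀ t ⟨by linarith [ht.1, min_le_left ε η], by linarith [ht.2, min_le_left ε η]⟩
      exact ⟨this.1, this.2.1⟩)
    (fun t ht => by
      have := hball t ⟨by linarith [ht.1, min_le_right ε η],
        by linarith [ht.2, min_le_right ε η]⟩
      exact ⟨hasDerivAt_curveState hγ hgeo this.2 this.1.2, hUL this.1.1⟩)
    (hΦ0 _ hs₀)
  refine ⟨min ε η / 2, by linarith, ?_, fun q => (extChartAt (𝓡 n) (γ 0)).symm (Φ q).1,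
    ?_, ?_, ?_⟩
  · have := hball (-(min ε η / 2)) ⟨by linarith [min_le_right ε η],
      by linarith [min_le_right ε η]⟩
    exact this.2.1.le
  · intro t ht
    obtain rfl : t = 0 := le_antisymm ht.2 ht.1
    exact (hΦ _ hs₀ 0 ⟨by linarith, hε⟩).2.2.2.1
  · intro t ht
    have ht' : t ∈ Ioo (-(min ε η)) (min ε η) := ⟨by linarith [ht.1], by linarith [ht.2]⟩
    have h1 := hun ht'
    simp only at h1 ⊢
    rw [h1]
    exact (extChartAt (𝓡 n) (γ 0)).left_inv (hball t ⟨by linarith [ht'.1, min_le_right ε η],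
        by linarith [ht'.2, min_le_right ε η]⟩).1.2
  · filter_upwards [hU] with z hz
    rw [(hΦ z hz 0 ⟨by linarith, hε⟩).2.2.2.2, hΦ0 z hz]

/-- Within a flow box around the state of `γ` at time `τ`, a family can be continued from `T` to
`T'`: its states at time `T` are transported by the flow. -/
lemma exists_hasFamilyUpTo_step (hA : A < 0)
    (hγ : ContMDiffOn 𝓘(ℝ, ℝ) (𝓡 n) 2 γ (Icc A B)) (hgeo : ∀ t ∈ Ioo A B, GeodesicAt g γ t)
    {z₀ : Coord n × Coord n} {δ : ℝ} (hδ : 0 < δ) (hAδ : A ≤ -δ) {τ : ℝ} (hτ : τ ∈ Icc 0 B) :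
    ∃ η, 0 < η ∧ ∀ T ∈ Icc 0 B, ∀ T' ∈ Icc 0 B, |T - τ| < η → |T' - τ| < η → T ≤ T' →
      HasFamilyUpTo g γ z₀ δ T → HasFamilyUpTo g γ z₀ δ T' := by
  have hAB : A < B := by linarith [hτ.1, hτ.2]
  have hsub : Icc 0 B ⊆ Icc A B := Icc_subset_Icc_left hA.le
  set p := γ τ with hpdef
  have hp : γ τ ∈ (extChartAt (𝓡 n) p).source := mem_extChartAt_source (I := 𝓡 n) (γ τ)
  obtain ⟨Φ, ε, U, L, K, hε, hU, hUL, hK, hΦ0, hΦ⟩ := exists_geodesic_flowBox g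
    (p := p) (s₀ := curveState γ A B p τ) ((extChartAt (𝓡 n) p).map_source hp)
  have hev : ∀ᶠ t in 𝓝[Icc A B] τ, curveState γ A B p t ∈ interior U ∧
      γ t ∈ (extChartAt (𝓡 n) p).source :=
    ((continuousWithinAt_curveState hAB hγ (hsub hτ) hp).eventually
      (interior_mem_nhds.2 hU)).and
      ((hγ τ (hsub hτ)).continuousWithinAt.eventually (source_mem_nhds hp))
  rw [eventually_nhdsWithin_iff] at hev
  obtain ⟨η, hη, hball⟩ := Metric.eventually_nhds_iff_ball.1 hev
  have hball' : ∀ t ∈ Icc A B, |t - τ| < η → curveState γ A B p t ∈ interior U ∧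
      γ t ∈ (extChartAt (𝓡 n) p).source := fun t ht h => hball t h ht
  refine ⟨min η (ε / 2), lt_min hη (by linarith), ?_⟩
  intro T hT T' hT' hTτ hT'τ hTT' ⟨Γ, hΓ, hΓγ, hΓ0⟩
  have hη1 := min_le_left η (ε / 2)
  have hη2 := min_le_right η (ε / 2)
  have hnear : ∀ t ∈ Icc T T', |t - τ| < min η (ε / 2) := by
    intro t ht
    rw [abs_lt] at hTτ hT'τ ⊢
    exact ⟨by linarith [ht.1], by linarith [ht.2]⟩
  have htime : ∀ t ∈ Icc T T', t - T ∈ Ioo (-ε) ε := by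
    intro t ht
    have h1 := hnear t ht
    rw [abs_lt] at hTτ h1
    exact ⟨by linarith [ht.1], by linarith⟩
  have hIcc : ∀ t ∈ Icc T T', t ∈ Icc A B := fun t ht =>
    ⟨by linarith [hT.1, ht.1], ht.2.trans hT'.2⟩
  have hTmem : T ∈ Icc T T' := ⟨le_rfl, hTT'⟩
  obtain ⟨hTU, hTp⟩ := hball' T (hIcc T hTmem) ((hnear T hTmem).trans_le hη1)
  have hΓT : Γ (z₀, T) = γ T := hΓγ T ⟨by linarith [hT.1], le_rfl⟩
  have hΓp : Γ (z₀, T) ∈ (extChartAt (𝓡 n) p).source := by rwa [hΓT]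
  have hsol := (hΓ T ⟨hT.1, le_rfl⟩).chartState_solution hΓp
  -- Both curves have the same velocity at time `T`: they agree to the left of `T`.
  have hstate : chartState (n := n) p Γ (z₀, T) = curveState γ A B p T := by
    refine Prod.ext ?_ ?_
    · simp only [chartState, curveState, hΓT]
    · have hu : HasDerivAt (coordCurve (n := n) (fun t => Γ (z₀, t)) p)
          (chartState (n := n) p Γ (z₀, T)).2 T := by
        have h1 : DifferentiableAt ℝ (coordCurve (n := n) (fun t => Γ (z₀, t)) p) T :=
          hsol.self_of_nhds.2.2.differentiableAt.fst
        exact h1.hasDerivAt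
      have hv : HasDerivWithinAt (coordCurve (n := n) γ p) (curveState (n := n) γ A B p T).2
          (Icc A B) T :=
        ((contDiffWithinAt_coordCurve hγ (hIcc T hTmem) hTp).differentiableWithinAt
          (by simp)).hasDerivWithinAt
      have hlt : -δ < T := by linarith [hT.1]
      have huniq : UniqueDiffWithinAt ℝ (Icc (-δ) T) T :=
        uniqueDiffOn_Icc hlt T ⟨hlt.le, le_rfl⟩
      refine huniq.eq_deriv _ hu.hasDerivWithinAt ((hv.mono
        (Icc_subset_Icc hAδ hT.2)).congr ?_ ?_)
      · intro t ht
        simp only [coordCurve, hΓγ t ht]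
      · simp only [coordCurve, hΓT]
  set Ψ : (Coord n × Coord n) × ℝ → M := fun q => (extChartAt (𝓡 n) p).symm (Φ q).1 with hΨ
  set σ : Coord n × Coord n → Coord n × Coord n := fun z => chartState p Γ (z, T) with hσdef
  have hσ : ContDiffAt ℝ ω σ z₀ :=
    ContDiffAt.comp z₀ (f := fun z : Coord n × Coord n => (z, T)) hsol.self_of_nhds.2.1
      (contDiffAt_id.prodMk contDiffAt_const)
  have hσ0 : σ z₀ = curveState γ A B p T := hstate
  have hσU : ∀ᶠ z in 𝓝 z₀, σ z ∈ U :=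
    hσ.continuousAt.eventually (by rw [hσ0]; exact mem_interior_iff_mem_nhds.1 hTU)
  let Γb : (Coord n × Coord n) × ℝ → M := fun q => Ψ (σ q.1, q.2 - T)
  have hΓb : ∀ t ∈ Icc T T', IsGeodesicFamilyAt g Γb (z₀, t) := fun t ht =>
    IsGeodesicFamilyAt.comp_sub hσ (hΦ _ hσU.self_of_nhds _ (htime t ht)).2.2.2.1
  have hΓbγ : ∀ t ∈ Icc T T', Γb (z₀, t) = γ t := by
    have hun := ODE_solution_unique_of_mem_Icc_right (v := fun _ => geodesicField g p)
      (s := fun _ => L) (K := K) (a := T) (b := T')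
      (f := fun t => Φ (curveState γ A B p T, t - T))
      (g := curveState γ A B p) (fun _ _ => hK) ?_ ?_ ?_ ?_ ?_ ?_ ?_
    · intro t ht
      have h1 := hun ht
      simp only [Γb, hΨ, hσ0] at h1 ⊢
      rw [h1]
      exact (extChartAt (𝓡 n) p).left_inv (hball' t (hIcc t ht) ((hnear t ht).trans_le hη1)).2
    · intro t ht
      exact ((hΦ _ (interior_subset hTU) _ (htime t ht)).1.comp_sub_const
        t T).continuousAt.continuousWithinAt
    · intro t ht
      exact ((hΦ _ (interior_subset hTU) _
        (htime t (Ico_subset_Icc_self ht))).1.comp_sub_const t T).hasDerivWithinAt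
    · intro t ht
      exact (hΦ _ (interior_subset hTU) _ (htime t (Ico_subset_Icc_self ht))).2.1
    · intro t ht
      exact (continuousWithinAt_curveState hAB hγ (hIcc t ht)
        (hball' t (hIcc t ht) ((hnear t ht).trans_le hη1)).2).mono hIcc
    · intro t ht
      have ht' := Ico_subset_Icc_self ht
      exact (hasDerivAt_curveState hγ hgeo ⟨by linarith [hT.1, ht.1], ht.2.trans_le hT'.2⟩
        (hball' t (hIcc t ht') ((hnear t ht').trans_le hη1)).2).hasDerivWithinAt
    · intro t ht
      have ht' := Ico_subset_Icc_self ht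
      exact hUL (interior_subset (hball' t (hIcc t ht') ((hnear t ht').trans_le hη1)).1)
    · simp only [sub_self]
      exact hΦ0 _ (interior_subset hTU)
  have hagree : Γ =ᶠ[𝓝 (z₀, T)] Γb := by
    refine (hΓ T ⟨hT.1, le_rfl⟩).eventuallyEq (hΓb T hTmem) hΓp
      (by rw [hΓbγ T hTmem]; exact hTp) ?_
    filter_upwards [hσU] with z hz
    have h1 : chartState (n := n) p Γb (z, T) = chartState p Ψ (σ z, T - T) := by
      refine Prod.ext rfl ?_
      simp only [chartState]
      exact deriv_comp_sub_const
        (f := coordCurve (n := n) (fun t => Ψ (σ z, t)) p) ..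
    rw [h1, sub_self, (hΦ _ hz 0 ⟨by linarith, hε⟩).2.2.2.2, hΦ0 _ hz]
  -- The two families are glued at time `T`.
  obtain ⟨Γ', hleft, hright⟩ := exists_glue hagree
  refine ⟨Γ', ?_, ?_, ?_⟩
  · intro t ht
    rcases le_total t T with h | h
    · exact (hΓ t ⟨ht.1, h⟩).congr (hleft t h)
    · exact (hΓb t ⟨h, ht.2⟩).congr (hright t h)
  · intro t ht
    rcases le_total t T with h | h
    · exact (hleft t h).self_of_nhds.trans (hΓγ t ⟨ht.1, h⟩)
    · exact (hright t h).self_of_nhds.trans (hΓbγ t ⟨h, ht.2⟩)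
  · have h2 : ∀ᶠ z in 𝓝 z₀, Γ' =ᶠ[𝓝 (z, 0)] Γ := by
      have := (hleft 0 hT.1).eventuallyEq_nhds
      exact ((Continuous.prodMk_left (0 : ℝ)).tendsto z₀).eventually this
    filter_upwards [h2, hΓ0] with z hz hz'
    exact (chartState_congr (γ 0) hz).trans hz'

/-- Continuation to the end of the interval, in finitely many steps by compactness. -/
lemma exists_hasFamilyUpTo (hA : A < 0) (hB : 0 < B)
    (hγ : ContMDiffOn 𝓘(ℝ, ℝ) (𝓡 n) 2 γ (Icc A B)) (hgeo : ∀ t ∈ Ioo A B, GeodesicAt g γ t) :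
    ∃ δ, 0 < δ ∧ HasFamilyUpTo g γ (curveState γ A B (γ 0) 0) δ B := by
  obtain ⟨δ, hδ, hAδ, hbase⟩ := exists_hasFamilyUpTo_zero hA hB hγ hgeo
  refine ⟨δ, hδ, ?_⟩
  choose! η hη hstep using fun τ (hτ : τ ∈ Icc 0 B) =>
    exists_hasFamilyUpTo_step (g := g) (z₀ := curveState γ A B (γ 0) 0) hA hγ hgeo hδ hAδ hτ
  obtain ⟨t, ht0, htm, ⟨m, hm⟩, ht⟩ := exists_monotone_Icc_subset_open_cover_Icc hB.le
    (c := fun τ : Icc (0 : ℝ) B => ((↑) : Icc (0 : ℝ) B → ℝ) ⁻¹' Metric.ball (τ : ℝ) (η τ))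
    (fun τ => Metric.isOpen_ball.preimage continuous_subtype_val)
    (fun s _ => mem_iUnion.2 ⟨s, Metric.mem_ball_self (hη s s.2)⟩)
  have hind : ∀ k, HasFamilyUpTo g γ (curveState γ A B (γ 0) 0) δ (t k) := by
    intro k
    induction k with
    | zero => rw [ht0]; exact hbase
    | succ k ih =>
      obtain ⟨τ, hτ⟩ := ht k
      have hle : t k ≤ t (k + 1) := htm (Nat.le_succ k)
      exact hstep τ τ.2 (t k) (t k).2 (t (k + 1)) (t (k + 1)).2
        (hτ ⟨le_rfl, hle⟩) (hτ ⟨hle, le_rfl⟩) hle ih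
  have := hind m
  rwa [hm m le_rfl] at this

/-- A geodesic `γ : [A, B] → M` with `A < 0 < B` is embedded in a family of geodesics that is
analytic near `[A, B]` and is parametrized by position and velocity at time `0` in the chart at
`γ 0`. -/
theorem exists_geodesicFamily (hA : A < 0) (hB : 0 < B)
    (hγ : ContMDiffOn 𝓘(ℝ, ℝ) (𝓡 n) 2 γ (Icc A B)) (hgeo : ∀ t ∈ Ioo A B, GeodesicAt g γ t) :
    ∃ Γ : (Coord n × Coord n) × ℝ → M,
      (∀ t ∈ Icc A B, IsGeodesicFamilyAt g Γ (curveState γ A B (γ 0) 0, t)) ∧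
      (∀ t ∈ Icc A B, Γ (curveState γ A B (γ 0) 0, t) = γ t) ∧
      ∀ᶠ z in 𝓝 (curveState γ A B (γ 0) 0), chartState (γ 0) Γ (z, 0) = z := by
  set z₀ : Coord n × Coord n := curveState γ A B (γ 0) 0 with hz₀
  obtain ⟨δ, hδ, Γ, hΓ, hΓγ, hΓ0⟩ := exists_hasFamilyUpTo hA hB hγ hgeo
  have hneg : MapsTo (fun t : ℝ => -t) (Icc (-B) (-A)) (Icc A B) := fun t ht =>
    ⟨by linarith [ht.2], by linarith [ht.1]⟩
  have hγ' : ContMDiffOn 𝓘(ℝ, ℝ) (𝓡 n) 2 (fun t => γ (-t)) (Icc (-B) (-A)) :=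
    hγ.comp (contDiff_neg.contDiffOn.contMDiffOn) hneg
  obtain ⟨δ', hδ', Γb, hΓb, hΓbγ, hΓb0⟩ := exists_hasFamilyUpTo (g := g) (neg_lt_zero.2 hB)
    (neg_pos.2 hA) hγ'
    (fun t ht => (hgeo (-t) ⟨by linarith [ht.2], by linarith [ht.1]⟩).comp_neg)
  -- Backward in time, the reversed geodesic is continued instead; `R` reverses initial states.
  let R : Coord n × Coord n → Coord n × Coord n := fun z => (z.1, -z.2)
  have hR : ContDiff ℝ ω R := contDiff_fst.prodMk contDiff_snd.neg
  have hRz : curveState (n := n) (fun t => γ (-t)) (-B) (-A) (γ (-0)) 0 = R z₀ := by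
    simp only [neg_zero, R, hz₀, curveState]
    refine Prod.ext rfl ?_
    simp only
    rw [derivWithin_of_mem_nhds (Icc_mem_nhds hA hB), derivWithin_of_mem_nhds
      (Icc_mem_nhds (by linarith) (by linarith))]
    have := deriv_comp_neg (f := coordCurve (n := n) γ (γ 0)) 0
    rw [neg_zero] at this
    exact this
  simp only [hRz] at hΓb hΓbγ hΓb0
  rw [neg_zero] at hΓb0
  have hp := mem_extChartAt_source (I := 𝓡 n) (γ 0)
  let Γn : (Coord n × Coord n) × ℝ → M := fun q => Γb (R q.1, -q.2)
  have hΓn : ∀ t ∈ Icc A 0, IsGeodesicFamilyAt g Γn (z₀, t) := fun t ht =>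
    IsGeodesicFamilyAt.comp_neg hR.contDiffAt
      (hΓb (-t) ⟨by linarith [ht.2], by linarith [ht.1]⟩)
  have hΓnγ : ∀ t ∈ Icc A 0, Γn (z₀, t) = γ t := by
    intro t ht
    have := hΓbγ (-t) ⟨by linarith [ht.2], by linarith [ht.1]⟩
    rwa [neg_neg] at this
  have h0 : (0 : ℝ) ∈ Icc A 0 := ⟨hA.le, le_rfl⟩
  have hagree : Γn =ᶠ[𝓝 (z₀, 0)] Γ := by
    refine (hΓn 0 h0).eventuallyEq (hΓ 0 ⟨le_rfl, hB.le⟩) (p := γ 0)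
      (by rw [hΓnγ 0 h0]; exact hp) (by rw [hΓγ 0 ⟨by linarith, hB.le⟩]; exact hp) ?_
    filter_upwards [hΓ0, hR.continuous.continuousAt.eventually hΓb0] with z hz hz'
    rw [hz]
    have h1 : chartState (n := n) (γ 0) Γn (z, 0) = R (chartState (γ 0) Γb (R z, 0)) := by
      refine Prod.ext (by simp [chartState, Γn, R]) ?_
      have := deriv_comp_neg (f := coordCurve (n := n) (fun t => Γb (R z, t)) (γ 0)) 0
      rw [neg_zero] at this
      exact this
    rw [h1, hz']
    simp [R]
  obtain ⟨Γ', hleft, hright⟩ := exists_glue hagree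
  refine ⟨Γ', ?_, ?_, ?_⟩
  · intro t ht
    rcases le_total t 0 with h | h
    · exact (hΓn t ⟨ht.1, h⟩).congr (hleft t h)
    · exact (hΓ t ⟨h, ht.2⟩).congr (hright t h)
  · intro t ht
    rcases le_total t 0 with h | h
    · exact (hleft t h).self_of_nhds.trans (hΓnγ t ⟨ht.1, h⟩)
    · exact (hright t h).self_of_nhds.trans (hΓγ t ⟨by linarith, ht.2⟩)
  · have h2 : ∀ᶠ z in 𝓝 z₀, Γ' =ᶠ[𝓝 (z, 0)] Γ :=
      ((Continuous.prodMk_left (0 : ℝ)).tendsto z₀).eventually (hright 0 le_rfl).eventuallyEq_nhds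
    filter_upwards [h2, hΓ0] with z hz hz'
    exact (chartState_congr (γ 0) hz).trans hz'

end Continuation

/-! ### Choice of the initial velocities -/

section InitialVelocities

set_option synthInstance.maxHeartbeats 200000 in
set_option maxHeartbeats 2000000 in
/-- Two unit vectors with sum `t₀ ξ`, `ξ` a unit covector, extend to analytic functions of the
point and of `ξ` with the same properties. With `s` the vector dual to `ξ`, the given vectors are
`(t₀ / 2) s ± w₀` for a vector `w₀` orthogonal to `s`; for nearby `ξ` the vector `w₀` is projected
to the orthogonal complement of `s` and rescaled to its length `(1 - t₀ ^ 2 / 4) ^ (1 / 2)`. -/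
lemma exists_analytic_initialVelocities {n : ℕ} {G : Coord n → Coord n →L[ℝ] Coord n →L[ℝ] ℝ}
    {y₀ : Coord n} (hG : ContDiffAt ℝ ω G y₀) (hsymm : ∀ y a b, G y a b = G y b a)
    (hinv : ∀ᶠ y in 𝓝 y₀, (G y).IsInvertible) {ξ₀ : Coord n →L[ℝ] ℝ} {s₀ : Coord n}
    (hs₀ : G y₀ s₀ = ξ₀) (hξ₀ : ξ₀ s₀ = 1) {t₀ : ℝ} (ht₀ : 0 < t₀) (ht₀' : t₀ < 2)
    {v₁ v₂ : Coord n} (hv₁ : G y₀ v₁ v₁ = 1) (hv₂ : G y₀ v₂ v₂ = 1)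
    (hsum : G y₀ (v₁ + v₂) = t₀ • ξ₀) :
    ∃ V₁ V₂ : Coord n × (Coord n →L[ℝ] ℝ) → Coord n,
      ContDiffAt ℝ ω V₁ (y₀, ξ₀) ∧ ContDiffAt ℝ ω V₂ (y₀, ξ₀) ∧
      V₁ (y₀, ξ₀) = v₁ ∧ V₂ (y₀, ξ₀) = v₂ ∧
      ∀ᶠ q in 𝓝 (y₀, ξ₀), ∀ s, G q.1 s = q.2 → q.2 s = 1 →
        G q.1 (V₁ q) (V₁ q) = 1 ∧ G q.1 (V₂ q) (V₂ q) = 1 ∧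
          G q.1 (V₁ q + V₂ q) = t₀ • q.2 := by
  have hleft : ∀ {y : Coord n} {s : Coord n} {ξ : Coord n →L[ℝ] ℝ}, (G y).IsInvertible →
      G y s = ξ → (G y).inverse ξ = s := by
    rintro y s ξ ⟨e, he⟩ rfl
    rw [← he, ContinuousLinearMap.inverse_equiv]
    exact e.symm_apply_apply s
  have hinv0 := hinv.self_of_nhds
  have hsum' : v₁ + v₂ = t₀ • s₀ := by
    have h1 := hleft hinv0 hsum
    rw [← h1, map_smul, hleft hinv0 hs₀]
  set w₀ : Coord n := v₁ - (t₀ / 2) • s₀ with hw₀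
  have hv₁' : v₁ = (t₀ / 2) • s₀ + w₀ := by rw [hw₀]; abel
  have hv₂' : v₂ = (t₀ / 2) • s₀ - w₀ := by
    have : v₂ = t₀ • s₀ - v₁ := by rw [← hsum']; abel
    rw [this, hw₀, show t₀ • s₀ = (t₀ / 2) • s₀ + (t₀ / 2) • s₀ by rw [← add_smul]; ring_nf]
    abel
  have hss : G y₀ s₀ s₀ = 1 := by rw [hs₀, hξ₀]
  have hexp : ∀ ε : ℝ, G y₀ ((t₀ / 2) • s₀ + ε • w₀) ((t₀ / 2) • s₀ + ε • w₀) =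
      t₀ ^ 2 / 4 + ε * t₀ * G y₀ s₀ w₀ + ε ^ 2 * G y₀ w₀ w₀ := by
    intro ε
    simp only [map_add, map_smul, add_apply, smul_apply, smul_eq_mul, hss, hsymm y₀ w₀ s₀]
    ring
  have e1 := hexp 1
  rw [one_smul, ← hv₁', hv₁] at e1
  have e2 := hexp (-1)
  rw [neg_one_smul, ← sub_eq_add_neg, ← hv₂', hv₂] at e2
  have horth : G y₀ s₀ w₀ = 0 := by
    have : t₀ * G y₀ s₀ w₀ = 0 := by linarith
    exact (mul_eq_zero.1 this).resolve_left ht₀.ne'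
  set c : ℝ := 1 - t₀ ^ 2 / 4 with hc
  have hww : G y₀ w₀ w₀ = c := by rw [hc]; rw [horth] at e1; linarith
  have hcpos : 0 < c := by rw [hc]; nlinarith
  let S : Coord n × (Coord n →L[ℝ] ℝ) → Coord n := fun q => (G q.1).inverse q.2
  let w : Coord n × (Coord n →L[ℝ] ℝ) → Coord n := fun q => w₀ - q.2 w₀ • S q
  let N : Coord n × (Coord n →L[ℝ] ℝ) → ℝ := fun q => G q.1 (w q) (w q)
  let r : Coord n × (Coord n →L[ℝ] ℝ) → ℝ := fun q => Real.sqrt (c * (N q)⁻¹)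
  have hS0 : S (y₀, ξ₀) = s₀ := hleft hinv0 hs₀
  have hw0 : w (y₀, ξ₀) = w₀ := by
    simp only [w, hS0]
    rw [← hs₀, horth, zero_smul, sub_zero]
  have hN0 : N (y₀, ξ₀) = c := by simp only [N, hw0, hww]
  have hr0 : r (y₀, ξ₀) = 1 := by simp only [r, hN0, mul_inv_cancel₀ hcpos.ne', Real.sqrt_one]
  have hG' : ContDiffAt ℝ ω (fun q : Coord n × (Coord n →L[ℝ] ℝ) => G q.1) (y₀, ξ₀) :=
    ContDiffAt.comp (y₀, ξ₀) hG contDiffAt_fst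
  have hS : ContDiffAt ℝ ω S (y₀, ξ₀) := by
    have h1 : ContDiffAt ℝ ω
        (fun q : Coord n × (Coord n →L[ℝ] ℝ) => (G q.1).inverse) (y₀, ξ₀) :=
      ContDiffAt.comp (y₀, ξ₀) (g := ContinuousLinearMap.inverse)
        (f := fun q : Coord n × (Coord n →L[ℝ] ℝ) => G q.1) hinv0.contDiffAt_map_inverse hG'
    exact h1.clm_apply contDiffAt_snd
  have hw : ContDiffAt ℝ ω w (y₀, ξ₀) :=
    contDiffAt_const.sub ((contDiffAt_snd.clm_apply contDiffAt_const).smul hS)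
  have hN : ContDiffAt ℝ ω N (y₀, ξ₀) := (hG'.clm_apply hw).clm_apply hw
  have hr : ContDiffAt ℝ ω r (y₀, ξ₀) := by
    refine ContDiffAt.sqrt (contDiffAt_const.mul (hN.inv ?_)) ?_
    · rw [hN0]; exact hcpos.ne'
    · rw [hN0, mul_inv_cancel₀ hcpos.ne']; exact one_ne_zero
  refine ⟨fun q => (t₀ / 2) • S q + r q • w q, fun q => (t₀ / 2) • S q - r q • w q,
    (hS.const_smul (t₀ / 2)).add (hr.smul hw), (hS.const_smul (t₀ / 2)).sub (hr.smul hw),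
    ?_, ?_, ?_⟩
  · simp only [hS0, hr0, hw0, one_smul]; exact hv₁'.symm
  · simp only [hS0, hr0, hw0, one_smul]; exact hv₂'.symm
  · have hNpos : ∀ᶠ q in 𝓝 (y₀, ξ₀), 0 < N q :=
      hN.continuousAt.eventually (Ioi_mem_nhds (by rw [hN0]; exact hcpos))
    filter_upwards [hNpos, (continuous_fst.tendsto (y₀, ξ₀)).eventually hinv] with q hq hq' s h1 h2
    have hSq : S q = s := hleft hq' h1
    have hsw : G q.1 s (w q) = 0 := by
      rw [h1]
      simp only [w, hSq, map_sub, map_smul, smul_eq_mul, h2]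
      ring
    have hrr : r q * r q * N q = c := by
      simp only [r]
      rw [Real.mul_self_sqrt (mul_nonneg hcpos.le (inv_nonneg.2 hq.le)), mul_assoc,
        inv_mul_cancel₀ hq.ne', mul_one]
    have hss' : G q.1 s s = 1 := by rw [h1, h2]
    have hwN : G q.1 (w q) (w q) = N q := rfl
    have hexp : ∀ ε : ℝ, G q.1 ((t₀ / 2) • s + ε • r q • w q) ((t₀ / 2) • s + ε • r q • w q) =
        t₀ ^ 2 / 4 + ε ^ 2 * c := by
      intro ε
      simp only [map_add, map_smul, add_apply, smul_apply, smul_eq_mul, hss', hsymm q.1 (w q) s,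
        hsw, hwN]
      rw [← hrr]
      ring
    simp only [hSq]
    refine ⟨?_, ?_, ?_⟩
    · have := hexp 1
      rw [one_smul] at this
      rw [this, hc]; ring
    · have := hexp (-1)
      rw [neg_one_smul, ← sub_eq_add_neg] at this
      rw [this, hc]; ring
    · rw [show (t₀ / 2) • s + r q • w q + ((t₀ / 2) • s - r q • w q) = t₀ • s by
        rw [show t₀ • s = (t₀ / 2) • s + (t₀ / 2) • s by rw [← add_smul]; ring_nf]; abel,
        map_smul, h1]

end InitialVelocities

section Cotangent

variable {n : ℕ} {M : Type*} [TopologicalSpace M] [ChartedSpace (EuclideanSpace ℝ (Fin n)) M]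

/-- The fibre component, in the chart at `p`, of a cotangent vector. -/
def covectorCoord (p : M) (α : CotangentBundle n M) : Coord n →L[ℝ] ℝ :=
  (α.snd : Coord n →L[ℝ] ℝ).comp (chartFrame p (extChartAt (𝓡 n) p α.proj))

variable [IsManifold (𝓡 n) ω M]

/-- The model with corners of the cotangent bundle. -/
abbrev cotangentModel (n : ℕ) := (𝓡 n).prod 𝓘(ℝ, EuclideanSpace ℝ (Fin n) →L[ℝ] ℝ)

instance instIsManifoldCotangentBundle : IsManifold (cotangentModel n) ω (CotangentBundle n M) :=
  Bundle.TotalSpace.isManifold (n := ω) (IB := 𝓡 n) _ _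

/-- The coordinates `(x, ξ)` on the cotangent bundle are analytic. -/
lemma contMDiffAt_cotangentCoord (α₀ : CotangentBundle n M) :
    ContMDiffAt (cotangentModel n) 𝓘(ℝ, Coord n × (Coord n →L[ℝ] ℝ)) ω
      (fun α : CotangentBundle n M =>
        (extChartAt (𝓡 n) α₀.proj α.proj, covectorCoord α₀.proj α)) α₀ := by
  have hid : ContMDiffAt (cotangentModel n) (cotangentModel n) ω
    (id : CotangentBundle n M → CotangentBundle n M) α₀ := contMDiffAt_id
  obtain ⟨h1, h2⟩ := (contMDiffAt_hom_bundle _).1 hid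
  refine ContMDiffAt.prodMk_space ?_ ?_
  · exact ContMDiffAt.comp α₀ (contMDiffAt_chart (mem_extChartAt_source α₀.proj)) h1
  · refine h2.congr_of_eventuallyEq ?_
    have h3 : ∀ᶠ α : CotangentBundle n M in 𝓝 α₀,
        α.proj ∈ (chartAt (EuclideanSpace ℝ (Fin n)) α₀.proj).source := by
      refine h1.continuousAt.eventually ?_
      exact (chartAt _ α₀.proj).open_source.mem_nhds (mem_chart_source _ _)
    filter_upwards [h3] with α hα
    have h4 := TangentBundle.symmL_trivializationAt (I := 𝓡 n) (𝕜 := ℝ) hα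
    rw [ModelWithCorners.range_eq_univ, mfderivWithin_univ] at h4
    simp only [ContinuousLinearMap.inCoordinates, id, covectorCoord, chartFrame]
    rw [h4]
    ext v
    simp

end Cotangent

/-! ### Exit times -/

section ExitTime

lemma eventually_pos_of_hasDerivAt {φ : ℝ → ℝ} {t d : ℝ} (h : HasDerivAt φ d t) (hd : 0 < d)
    (h0 : φ t = 0) : ∀ᶠ s in 𝓝[>] t, 0 < φ s := by
  have h1 := (hasDerivAt_iff_tendsto_slope.1 h).eventually (Ioi_mem_nhds hd)
  have h2 : ∀ᶠ s in 𝓝[>] t, 0 < slope φ t s :=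
    h1.filter_mono (nhdsWithin_mono t fun s hs => (ne_of_gt hs : s ≠ t))
  filter_upwards [h2, self_mem_nhdsWithin] with s hs hst
  have h3 : (0 : ℝ) < s - t := sub_pos.2 hst
  rw [slope_def_field, h0, sub_zero] at hs
  exact (div_pos_iff_of_pos_right h3).1 hs

/-- A zero at which a function increases with nonzero speed depends continuously on parameters. -/
lemma exists_continuous_zero {P : Type*} [TopologicalSpace P] {f : P × ℝ → ℝ} {z₀ : P} {T : ℝ}
    (h0 : f (z₀, T) = 0)
    (hf : ∀ᶠ q in 𝓝 (z₀, T), ContinuousAt f q ∧ 0 < deriv (fun t => f (q.1, t)) q.2) :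
    ∃ τ : P → ℝ, τ z₀ = T ∧ (∀ᶠ z in 𝓝 z₀, ContinuousAt τ z) ∧
      ∀ᶠ q in 𝓝 (z₀, T), (q.2 < τ q.1 → f q < 0) ∧ (q.2 = τ q.1 → f q = 0) ∧
        (τ q.1 < q.2 → 0 < f q) := by
  have hf' := hf
  rw [nhds_prod_eq, eventually_prod_iff] at hf'
  obtain ⟨a, ha, b, hb, hab⟩ := hf'
  obtain ⟨δ, hδ, hbδ⟩ := Metric.eventually_nhds_iff_ball.1 hb
  rw [Real.ball_eq_Ioo] at hbδ
  have hslice : ∀ {z t}, a z → t ∈ Ioo (T - δ) (T + δ) →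
      ContinuousAt (fun s => f (z, s)) t := fun hz ht =>
    ContinuousAt.comp (f := fun s : ℝ => (_, s)) (hab hz (hbδ _ ht)).1
      (Continuous.prodMk_right _).continuousAt
  have hmono : ∀ {z}, a z → StrictMonoOn (fun t => f (z, t)) (Ioo (T - δ) (T + δ)) := by
    intro z hz
    refine strictMonoOn_of_deriv_pos (convex_Ioo _ _)
      (fun t ht => (hslice hz ht).continuousWithinAt) fun t ht => ?_
    rw [interior_Ioo] at ht
    exact (hab hz (hbδ t ht)).2
  have ha0 : a z₀ := ha.self_of_nhds
  have hTmem : T ∈ Ioo (T - δ) (T + δ) := ⟨by linarith, by linarith⟩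
  have hlmem : T - δ / 2 ∈ Ioo (T - δ) (T + δ) := ⟨by linarith, by linarith⟩
  have hrmem : T + δ / 2 ∈ Ioo (T - δ) (T + δ) := ⟨by linarith, by linarith⟩
  have hl0 : f (z₀, T - δ / 2) < 0 := h0 ▸ hmono ha0 hlmem hTmem (by linarith)
  have hr0 : 0 < f (z₀, T + δ / 2) := by
    have := hmono ha0 hTmem hrmem (by linarith)
    simpa only [h0] using this
  have hpar : ∀ {z t}, a z → t ∈ Ioo (T - δ) (T + δ) → ContinuousAt (fun y => f (y, t)) z :=
    fun hz ht => ContinuousAt.comp (f := fun y => (y, _)) (hab hz (hbδ _ ht)).1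
      (Continuous.prodMk_left _).continuousAt
  have hgood : ∀ᶠ z in 𝓝 z₀, a z ∧ f (z, T - δ / 2) < 0 ∧ 0 < f (z, T + δ / 2) :=
    ha.and (((hpar ha0 hlmem).eventually (Iio_mem_nhds hl0)).and
      ((hpar ha0 hrmem).eventually (Ioi_mem_nhds hr0)))
  have hex : ∀ z, (a z ∧ f (z, T - δ / 2) < 0 ∧ 0 < f (z, T + δ / 2)) →
      ∃ t, t ∈ Ioo (T - δ / 2) (T + δ / 2) ∧ f (z, t) = 0 := by
    rintro z ⟨h1, h2, h3⟩
    have hc : ContinuousOn (fun t => f (z, t)) (Icc (T - δ / 2) (T + δ / 2)) := fun t ht =>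
      (hslice h1 ⟨by linarith [ht.1], by linarith [ht.2]⟩).continuousWithinAt
    obtain ⟨t, ht, ht'⟩ := intermediate_value_Ioo (by linarith) hc ⟨h2, h3⟩
    exact ⟨t, ht, ht'⟩
  choose! τ hτ hτ0 using hex
  have hsub : ∀ {t}, t ∈ Ioo (T - δ / 2) (T + δ / 2) → t ∈ Ioo (T - δ) (T + δ) := fun ht =>
    ⟨by linarith [ht.1], by linarith [ht.2]⟩
  refine ⟨τ, ?_, ?_, ?_⟩
  · exact (hmono ha0).injOn (hsub (hτ z₀ hgood.self_of_nhds)) hTmem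
      ((hτ0 z₀ hgood.self_of_nhds).trans h0.symm)
  · filter_upwards [hgood.eventually_nhds] with z hz
    have hz0 := hz.self_of_nhds
    have hτz := hsub (hτ z hz0)
    refine tendsto_order.2 ⟨fun c hc => ?_, fun c hc => ?_⟩
    · rcases le_or_gt c (T - δ / 2) with h | h
      · filter_upwards [hz] with y hy
        exact h.trans_lt (hτ y hy).1
      · have hcm : c ∈ Ioo (T - δ) (T + δ) := ⟨by linarith, hc.trans hτz.2⟩
        have h1 : f (z, c) < 0 := by
          have := hmono hz0.1 hcm hτz hc
          simpa only [hτ0 z hz0] using this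
        filter_upwards [hz, (hpar hz0.1 hcm).eventually (Iio_mem_nhds h1)] with y hy hy'
        by_contra hle
        have h2 := (hmono hy.1).monotoneOn (hsub (hτ y hy)) hcm (not_lt.1 hle)
        simp only [hτ0 y hy] at h2
        exact absurd hy' (not_lt.2 h2)
    · rcases le_or_gt (T + δ / 2) c with h | h
      · filter_upwards [hz] with y hy
        exact (hτ y hy).2.trans_le h
      · have hcm : c ∈ Ioo (T - δ) (T + δ) := ⟨hτz.1.trans hc, by linarith⟩
        have h1 : 0 < f (z, c) := by
          have := hmono hz0.1 hτz hcm hc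
          simpa only [hτ0 z hz0] using this
        filter_upwards [hz, (hpar hz0.1 hcm).eventually (Ioi_mem_nhds h1)] with y hy hy'
        by_contra hle
        have h2 := (hmono hy.1).monotoneOn hcm (hsub (hτ y hy)) (not_lt.1 hle)
        simp only [hτ0 y hy] at h2
        exact absurd hy' (not_lt.2 h2)
  · filter_upwards [(continuous_fst.tendsto (z₀, T)).eventually hgood,
      (continuous_snd.tendsto (z₀, T)).eventually (Ioo_mem_nhds hTmem.1 hTmem.2)] with q hq hqt
    have hτq := hsub (hτ q.1 hq)
    refine ⟨fun h => ?_, fun h => ?_, fun h => ?_⟩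
    · have := hmono hq.1 hqt hτq h
      simpa only [hτ0 q.1 hq] using this
    · have := hτ0 q.1 hq
      rwa [← h] at this
    · have := hmono hq.1 hτq hqt h
      simpa only [hτ0 q.1 hq] using this

end ExitTime

section DefiningFunctions

/-- If `f` and `h` vanish at `y` and have the same sublevel set `{f ≤ 0} = {h ≤ 0}` near `y`, the
kernel of `dh(y) ≠ 0` is contained in the kernel of `df(y)`. -/
lemma fderiv_apply_ne_zero_of_sublevel_eq {E : Type*} [NormedAddCommGroup E] [NormedSpace ℝ E]
    {f h : E → ℝ} {f' h' : E →L[ℝ] ℝ} {y : E} (hf : HasFDerivAt f f' y) (hh : HasFDerivAt h h' y)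
    (hf0 : f y = 0) (hh0 : h y = 0) (hiff : ∀ᶠ z in 𝓝 y, f z ≤ 0 ↔ h z ≤ 0) (hne : h' ≠ 0)
    {v : E} (hv : f' v ≠ 0) : h' v ≠ 0 := by
  have hline : ∀ u : E, HasDerivAt (fun t : ℝ => y + t • u) u 0 := fun u => by
    simpa using ((hasDerivAt_id (0 : ℝ)).smul_const u).const_add y
  have hcomp : ∀ {k : E → ℝ} {k' : E →L[ℝ] ℝ} (u : E), HasFDerivAt k k' y →
      HasDerivAt (fun t : ℝ => k (y + t • u)) (k' u) 0 := fun {k k'} u hk => by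
    have hk' : HasFDerivAt k k' (y + (0 : ℝ) • u) := by simpa using hk
    exact hk'.comp_hasDerivAt 0 (hline u)
  have key : ∀ u, f' u < 0 → h' u ≤ 0 := by
    intro u hu
    by_contra hpos
    have h1 := eventually_pos_of_hasDerivAt (hcomp u hh) (not_le.1 hpos) (by simp [hh0])
    have h2 := eventually_pos_of_hasDerivAt (hcomp u hf).neg (neg_pos.2 hu) (by simp [hf0])
    have h3 : ∀ᶠ t : ℝ in 𝓝[>] 0, (f (y + t • u) ≤ 0 ↔ h (y + t • u) ≤ 0) := by
      have : Tendsto (fun t : ℝ => y + t • u) (𝓝[>] 0) (𝓝 y) := by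
        have := (hline u).continuousAt.tendsto
        rw [zero_smul, add_zero] at this
        exact this.mono_left nhdsWithin_le_nhds
      exact this.eventually hiff
    obtain ⟨t, ht1, ht2, ht3⟩ := (h1.and (h2.and h3)).exists
    have h4 : f (y + t • u) < 0 := neg_pos.1 ht2
    linarith [ht3.1 h4.le]
  intro h0
  obtain ⟨u, hu, hu0⟩ : ∃ u, f' u < 0 ∧ h' u = 0 := by
    rcases lt_or_gt_of_ne hv with hlt | hgt
    · exact ⟨v, hlt, h0⟩
    · exact ⟨-v, by rw [map_neg]; linarith, by rw [map_neg, h0, neg_zero]⟩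
  obtain ⟨w, hw⟩ : ∃ w, 0 < h' w := by
    by_contra! hcon
    refine hne (ContinuousLinearMap.ext fun w => le_antisymm (hcon w) ?_)
    have := hcon (-w)
    rw [map_neg] at this
    exact neg_nonpos.1 this
  have h5 : Tendsto (fun ε : ℝ => f' (u + ε • w)) (𝓝[>] 0) (𝓝 (f' u)) := by
    have hc : Continuous fun ε : ℝ => f' (u + ε • w) := by fun_prop
    have := hc.tendsto 0
    rw [zero_smul, add_zero] at this
    exact this.mono_left nhdsWithin_le_nhds
  obtain ⟨ε, hε1, hε2⟩ := ((h5.eventually (Iio_mem_nhds hu)).and self_mem_nhdsWithin).exists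
  have h6 := key _ hε1
  rw [map_add, map_smul, hu0, zero_add, smul_eq_mul] at h6
  exact absurd h6 (not_le.2 (mul_pos hε2 hw))

variable {n : ℕ} {M : Type*} [TopologicalSpace M] [ChartedSpace (EuclideanSpace ℝ (Fin n)) M]

/-- A function `ρ` which defines `X` near `q` and is `C^1` there has, if its derivative does not
vanish at a vector `v`, the same property with respect to `v` as the defining functions of `X`. -/
lemma isNontangentialVector_of_mfderiv_ne_zero {X : Set M} {q : M} {ρ ρ' : M → ℝ}
    (hρ' : IsLocalDefiningFunction (n := n) X q ρ') (hρ : MDifferentiableAt (𝓡 n) 𝓘(ℝ, ℝ) ρ q)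
    (h0 : ρ q = 0) (hiff : ∀ᶠ x in 𝓝 q, x ∈ X ↔ ρ x ≤ 0) {v : TangentSpace (𝓡 n) q}
    (hv : mfderiv (𝓡 n) 𝓘(ℝ, ℝ) ρ q v ≠ (0 : ℝ)) : IsNontangentialVector (n := n) X q v := by
  have hchart : ∀ {r : M → ℝ}, MDifferentiableAt (𝓡 n) 𝓘(ℝ, ℝ) r q →
      HasFDerivAt (r ∘ (extChartAt (𝓡 n) q).symm)
        (mfderiv (𝓡 n) 𝓘(ℝ, ℝ) r q : Coord n →L[ℝ] ℝ) (extChartAt (𝓡 n) q q) := by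
    intro r hr
    have huniv : ∀ {F : Coord n → ℝ} {L : Coord n →L[ℝ] ℝ} {y : Coord n},
        HasFDerivWithinAt F L (range (𝓡 n)) y → HasFDerivAt F L y := fun h => by
      rwa [ModelWithCorners.range_eq_univ, hasFDerivWithinAt_univ] at h
    exact huniv hr.hasMFDerivAt.2
  have hsymm : (extChartAt (𝓡 n) q).symm (extChartAt (𝓡 n) q q) = q := extChartAt_to_inv q
  have hcont : Tendsto (extChartAt (𝓡 n) q).symm (𝓝 (extChartAt (𝓡 n) q q)) (𝓝 q) := by
    have := continuousAt_extChartAt_symm (I := 𝓡 n) q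
    rw [ContinuousAt, hsymm] at this
    exact this
  refine ⟨ρ', hρ', ?_⟩
  refine fderiv_apply_ne_zero_of_sublevel_eq (hchart hρ)
    (hchart (hρ'.smooth.mdifferentiableAt (by simp))) (by simp [h0])
    (by simp [hρ'.zero]) ?_ hρ'.deriv_ne_zero hv
  filter_upwards [hcont.eventually hiff, hcont.eventually hρ'.mem_iff] with z h1 h2
  exact h1.symm.trans h2

end DefiningFunctions

section Exit

variable {n : ℕ} {M : Type*} [TopologicalSpace M] [ChartedSpace (EuclideanSpace ℝ (Fin n)) M]
  [IsManifold (𝓡 n) ω M] {P : Type*} [NormedAddCommGroup P] [NormedSpace ℝ P]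

/-- If the curve `t ↦ Γ (z₀, t)` leaves `X` at time `T` transversally to the boundary, the nearby
curves do so at times that depend continuously on the parameter. -/
lemma exists_exitTime {X : Set M} (hX : IsCompactWithSmoothBoundary n X) {Γ : P × ℝ → M} {z₀ : P}
    {T : ℝ} (hΓ : ContMDiffAt 𝓘(ℝ, P × ℝ) (𝓡 n) ω Γ (z₀, T))
    (hin : ∀ᶠ t in 𝓝[<] T, Γ (z₀, t) ∈ X) {ρ : M → ℝ}
    (hρ : IsLocalDefiningFunction (n := n) X (Γ (z₀, T)) ρ)
    (hv : (mfderiv (𝓡 n) 𝓘(ℝ, ℝ) ρ (Γ (z₀, T)) : Coord n →L[ℝ] ℝ)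
      ((mfderiv 𝓘(ℝ, ℝ) (𝓡 n) (fun t => Γ (z₀, t)) T : ℝ →L[ℝ] Coord n) 1) ≠ 0) :
    ∃ τ : P → ℝ, τ z₀ = T ∧ (∀ᶠ z in 𝓝 z₀, ContinuousAt τ z ∧ Γ (z, τ z) ∈ frontier X ∧
        IsNontangentialVector (n := n) X (Γ (z, τ z))
          ((mfderiv 𝓘(ℝ, ℝ) (𝓡 n) (fun t => Γ (z, t)) (τ z) : ℝ →L[ℝ] Coord n) 1)) ∧
      ∀ᶠ q in 𝓝 (z₀, T), q.2 < τ q.1 → Γ q ∈ interior X := by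
  let f : P × ℝ → ℝ := fun q => ρ (Γ q)
  have hρ1 : ∀ᶠ x in 𝓝 (Γ (z₀, T)), ContMDiffAt (𝓡 n) 𝓘(ℝ, ℝ) 1 ρ x :=
    (contMDiffAt_iff_contMDiffAt_nhds (by simp)).1 (hρ.smooth.of_le (by norm_cast))
  have hΓ1 : ∀ᶠ q in 𝓝 (z₀, T), ContMDiffAt 𝓘(ℝ, P × ℝ) (𝓡 n) ω Γ q :=
    (contMDiffAt_iff_contMDiffAt_nhds (by simp)).1 hΓ
  have hev : ∀ᶠ q in 𝓝 (z₀, T), ContMDiffAt 𝓘(ℝ, P × ℝ) (𝓡 n) ω Γ q ∧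
      ContMDiffAt (𝓡 n) 𝓘(ℝ, ℝ) 1 ρ (Γ q) ∧ ∀ᶠ x in 𝓝 (Γ q), x ∈ X ↔ ρ x ≤ 0 :=
    hΓ1.and ((hΓ.continuousAt.eventually hρ1).and
      (hΓ.continuousAt.eventually hρ.mem_iff.eventually_nhds))
  have hf : ∀ {q}, ContMDiffAt 𝓘(ℝ, P × ℝ) (𝓡 n) ω Γ q →
      ContMDiffAt (𝓡 n) 𝓘(ℝ, ℝ) 1 ρ (Γ q) → ContDiffAt ℝ 1 f q := fun h1 h2 =>
    (ContMDiffAt.comp _ h2 (h1.of_le le_top)).contDiffAt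
  -- The chain rule for `f` along the curves of the family.
  have hchain : ∀ {q}, ContMDiffAt 𝓘(ℝ, P × ℝ) (𝓡 n) ω Γ q →
      ContMDiffAt (𝓡 n) 𝓘(ℝ, ℝ) 1 ρ (Γ q) →
      HasDerivAt (fun t => f (q.1, t)) ((mfderiv (𝓡 n) 𝓘(ℝ, ℝ) ρ (Γ q) : Coord n →L[ℝ] ℝ)
        ((mfderiv 𝓘(ℝ, ℝ) (𝓡 n) (fun t => Γ (q.1, t)) q.2 : ℝ →L[ℝ] Coord n) 1)) q.2 := by
    intro q h1 h2
    have h3 : HasMFDerivAt 𝓘(ℝ, ℝ) 𝓘(ℝ, ℝ) (fun t => f (q.1, t)) q.2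
        ((mfderiv (𝓡 n) 𝓘(ℝ, ℝ) ρ (Γ q) : Coord n →L[ℝ] ℝ).comp
        (mfderiv 𝓘(ℝ, ℝ) (𝓡 n) (fun t => Γ (q.1, t)) q.2 : ℝ →L[ℝ] Coord n)) :=
      HasMFDerivAt.comp q.2 (g := ρ) (f := fun t => Γ (q.1, t))
        (h2.mdifferentiableAt (by simp)).hasMFDerivAt
        ((contMDiffAt_slice h1).mdifferentiableAt (by simp)).hasMFDerivAt
    have hone : ∀ {F : ℝ → ℝ} {L : ℝ →L[ℝ] ℝ} {t : ℝ}, HasFDerivAt F L t →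
        HasDerivAt F (L 1) t := fun h => h.hasDerivAt
    exact hone (hasMFDerivAt_iff_hasFDerivAt.1 h3)
  have hderiv : ∀ {q}, ContDiffAt ℝ 1 f q → deriv (fun t => f (q.1, t)) q.2 =
      fderiv ℝ f q (0, 1) := by
    intro q hq
    have h1 : HasDerivAt (fun t : ℝ => (q.1, t)) ((0, 1) : P × ℝ) q.2 :=
      (hasDerivAt_const q.2 q.1).prodMk (hasDerivAt_id q.2)
    exact ((hq.differentiableAt (by simp)).hasFDerivAt.comp_hasDerivAt q.2 h1).deriv
  have h00 : f (z₀, T) = 0 := hρ.zero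
  have hd0 := hchain hev.self_of_nhds.1 hev.self_of_nhds.2.1
  -- `ρ` increases along the given curve at time `T` since it is nonpositive before.
  have hpos : 0 < deriv (fun t => f (z₀, t)) T := by
    rw [hd0.deriv]
    refine lt_of_le_of_ne ?_ hv.symm
    by_contra hneg
    have h1 : HasDerivAt (fun t => f (z₀, -t))
        (-((mfderiv (𝓡 n) 𝓘(ℝ, ℝ) ρ (Γ (z₀, T)) : Coord n →L[ℝ] ℝ)
        ((mfderiv 𝓘(ℝ, ℝ) (𝓡 n) (fun t => Γ (z₀, t)) T : ℝ →L[ℝ] Coord n) 1))) (-T) := by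
      have hrev : ∀ {F : ℝ → ℝ} {d t : ℝ}, HasDerivAt F d t →
          HasDerivAt (fun s => F (-s)) (-d) (-t) := fun {F d t} h => by
        have h2 : HasDerivAt F d (-(-t)) := by rwa [neg_neg]
        have h3 : HasDerivAt (fun s => F (-s)) (d * -1) (-t) := h2.comp (-t) (hasDerivAt_neg (-t))
        rwa [mul_neg_one] at h3
      exact hrev hd0
    have h3 := eventually_pos_of_hasDerivAt h1 (neg_pos.2 (not_le.1 hneg)) (by simpa using h00)
    have h4 : ∀ᶠ t in 𝓝[<] T, 0 < f (z₀, t) := by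
      have := (tendsto_neg_nhdsLT (a := T)).eventually h3
      simpa using this
    have h5 : ∀ᶠ t in 𝓝[<] T, (Γ (z₀, t) ∈ X ↔ f (z₀, t) ≤ 0) := by
      have h6 : Tendsto (fun t : ℝ => Γ (z₀, t)) (𝓝[<] T) (𝓝 (Γ (z₀, T))) :=
        ((contMDiffAt_slice hΓ).continuousAt.tendsto).mono_left nhdsWithin_le_nhds
      exact h6.eventually hρ.mem_iff
    obtain ⟨t, ht1, ht2, ht3⟩ := (h4.and (h5.and hin)).exists
    linarith [ht2.1 ht3]
  have hf0 := hf hev.self_of_nhds.1 hev.self_of_nhds.2.1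
  have hall : ∀ᶠ q in 𝓝 (z₀, T), ContinuousAt f q ∧ 0 < deriv (fun t => f (q.1, t)) q.2 := by
    have hc : ContinuousAt (fun q => fderiv ℝ f q (0, 1)) (z₀, T) :=
      (hf0.fderiv_right (m := 0) (by norm_num)).continuousAt.clm_apply continuousAt_const
    have h1 : (0 : ℝ) < fderiv ℝ f (z₀, T) (0, 1) := by rw [← hderiv hf0]; exact hpos
    filter_upwards [hev, hc.eventually (Ioi_mem_nhds h1)] with q hq hq'
    refine ⟨(hf hq.1 hq.2.1).continuousAt, ?_⟩
    rw [hderiv (hf hq.1 hq.2.1)]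
    exact hq'
  obtain ⟨τ, hτ0, hτc, hτ⟩ := exists_continuous_zero h00 hall
  refine ⟨τ, hτ0, ?_, ?_⟩
  · have hτc0 : ContinuousAt τ z₀ := hτc.self_of_nhds
    have hgraph : Tendsto (fun z => (z, τ z)) (𝓝 z₀) (𝓝 (z₀, T)) := by
      have : ContinuousAt (fun z => (z, τ z)) z₀ := continuousAt_id.prodMk hτc0
      rwa [ContinuousAt, hτ0] at this
    filter_upwards [hτc, hgraph.eventually ((hev.and hall).and hτ.eventually_nhds)] with z h1
      ⟨⟨h2, h3⟩, h4⟩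
    have hz0 : ρ (Γ (z, τ z)) = 0 := h4.self_of_nhds.2.1 rfl
    -- The point belongs to `{ρ = 0}`, and right after `τ z` the function `ρ` is positive.
    have hfront : Γ (z, τ z) ∈ frontier X := by
      refine ⟨subset_closure (h2.2.2.self_of_nhds.2 hz0.le), fun hint => ?_⟩
      have hcz : Tendsto (fun t : ℝ => (z, t)) (𝓝[>] (τ z)) (𝓝 (z, τ z)) :=
        ((Continuous.prodMk_right z).tendsto (τ z)).mono_left nhdsWithin_le_nhds
      have h5 : ∀ᶠ t in 𝓝[>] (τ z), Γ (z, t) ∈ X ∧ (Γ (z, t) ∈ X ↔ ρ (Γ (z, t)) ≤ 0) := by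
        have h6 : ∀ᶠ x in 𝓝 (Γ (z, τ z)), x ∈ X ∧ (x ∈ X ↔ ρ x ≤ 0) :=
          (eventually_mem_set.2 (mem_interior_iff_mem_nhds.1 hint)).and h2.2.2
        exact hcz.eventually (h2.1.continuousAt.eventually h6)
      obtain ⟨t, ⟨ht1, ht2⟩, ht3, ht4⟩ :=
        (h5.and ((hcz.eventually h4).and self_mem_nhdsWithin)).exists
      have h6 : 0 < ρ (Γ (z, t)) := ht3.2.2 ht4
      linarith [ht2.1 ht1]
    refine ⟨h1, hfront, ?_⟩
    obtain ⟨ρ', hρ'⟩ := hX.boundary _ hfront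
    -- Near `Γ (z₀, T)`, the function `ρ` is known to be of class `C^m` for each finite `m` only, so
    -- at the point considered a `C^∞` defining function is taken from the assumption on `X`.
    refine isNontangentialVector_of_mfderiv_ne_zero hρ' (h2.2.1.mdifferentiableAt (by simp)) hz0
      h2.2.2 ?_
    have h7 := h3.2
    rw [(hchain h2.1 h2.2.1).deriv] at h7
    exact h7.ne'
  · filter_upwards [hev, hτ] with q h1 h2 h3
    have h4 : ρ (Γ q) < 0 := h2.1 h3
    rw [mem_interior_iff_mem_nhds]
    filter_upwards [h1.2.2, h1.2.1.continuousAt.eventually (Iio_mem_nhds h4)] with x hx hx'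
    exact hx.2 (le_of_lt hx')

end Exit

/-! ### Uniformity over compact time intervals -/

section Uniformity

/-- The tube lemma for intervals whose end points depend on the parameter. -/
lemma eventually_forall_mem_Icc {A : Type*} [TopologicalSpace A] {a₀ : A} {l r : A → ℝ}
    (hl : ContinuousAt l a₀) (hr : ContinuousAt r a₀) (hlr : l a₀ ≤ r a₀) {Q : A × ℝ → Prop}
    (hQ : ∀ t ∈ Icc (l a₀) (r a₀), ∀ᶠ q in 𝓝 (a₀, t), Q q) :
    ∀ᶠ a in 𝓝 a₀, ∀ t ∈ Icc (l a) (r a), Q (a, t) := by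
  -- The moving interval is the image of `[0, 1]` under an affine map.
  have hcont : ∀ s : ℝ, ContinuousAt
      (fun q : A × ℝ => (q.1, AffineMap.lineMap (k := ℝ) (l q.1) (r q.1) q.2)) (a₀, s) := by
    intro s
    have hl' : ContinuousAt (fun q : A × ℝ => l q.1) (a₀, s) :=
      ContinuousAt.comp (x := (a₀, s)) hl continuousAt_fst
    have hr' : ContinuousAt (fun q : A × ℝ => r q.1) (a₀, s) :=
      ContinuousAt.comp (x := (a₀, s)) hr continuousAt_fst
    simp only [AffineMap.lineMap_apply, vsub_eq_sub, vadd_eq_add, smul_eq_mul]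
    exact continuousAt_fst.prodMk ((continuousAt_snd.mul (hr'.sub hl')).add hl')
  have h1 := isCompact_Icc.eventually_forall_of_forall_eventually (x₀ := a₀)
    (K := Icc (0 : ℝ) 1) (P := fun a s => Q (a, AffineMap.lineMap (k := ℝ) (l a) (r a) s))
    fun s hs => (hcont s).eventually <| hQ _ <| by
      rw [← segment_eq_Icc hlr, segment_eq_image_lineMap]
      exact mem_image_of_mem _ hs
  filter_upwards [h1] with a ha t ht
  rw [← segment_eq_Icc (ht.1.trans ht.2), segment_eq_image_lineMap] at ht
  obtain ⟨s, hs, rfl⟩ := ht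
  exact ha s hs

variable {E : Type*} [NormedAddCommGroup E] [NormedSpace ℝ E]
  {P : Type*} [NormedAddCommGroup P] [NormedSpace ℝ P]

/-- Two families of curves which start at the same points, with initial velocities close to
linearly independent vectors `v₁`, `v₂`, do not meet again for small times. -/
lemma eventually_eq_zero_of_eq {f₁ f₂ : P × ℝ → E} {z₁ z₂ : P} {v₁ v₂ : E}
    (hf₁ : ContDiffAt ℝ 1 f₁ (z₁, 0)) (hf₂ : ContDiffAt ℝ 1 f₂ (z₂, 0))
    (hv₁ : deriv (fun t => f₁ (z₁, t)) 0 = v₁) (hv₂ : deriv (fun t => f₂ (z₂, t)) 0 = v₂)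
    (hv : ∀ a b : ℝ, a • v₁ = b • v₂ → a = 0 ∧ b = 0) :
    ∀ᶠ q : (P × ℝ) × (P × ℝ) in 𝓝 ((z₁, 0), (z₂, 0)), f₁ (q.1.1, 0) = f₂ (q.2.1, 0) →
      f₁ q.1 = f₂ q.2 → q.1.2 = 0 ∧ q.2.2 = 0 := by
  let L : ℝ × ℝ →ₗ[ℝ] E := (LinearMap.toSpanSingleton ℝ E v₁).comp (LinearMap.fst ℝ ℝ ℝ) -
    (LinearMap.toSpanSingleton ℝ E v₂).comp (LinearMap.snd ℝ ℝ ℝ)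
  have hL : ∀ x, L x = x.1 • v₁ - x.2 • v₂ := fun x => by simp [L]
  obtain ⟨K, hK, hLK⟩ := L.exists_antilipschitzWith (by
    rw [LinearMap.ker_eq_bot']
    intro x hx
    rw [hL, sub_eq_zero] at hx
    exact Prod.ext (hv _ _ hx).1 (hv _ _ hx).2)
  have hKL : ∀ x, ‖x‖ ≤ K * ‖L x‖ := fun x => by
    simpa using hLK.le_mul_dist x 0
  have hK' : (0 : ℝ) < K := hK
  -- Differentiability at `(z, 0)` in the strict sense makes the error uniform in the parameter.
  have hsmall : ∀ {f : P × ℝ → E} {z : P} {v : E}, ContDiffAt ℝ 1 f (z, 0) →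
      deriv (fun t => f (z, t)) 0 = v → ∀ᶠ q in 𝓝 (z, (0 : ℝ)),
        ‖f q - f (q.1, 0) - q.2 • v‖ ≤ 1 / (4 * K) * |q.2| := by
    intro f z v hf hfv
    have hs := hf.hasStrictFDerivAt (by simp)
    have h1 : HasDerivAt (fun t : ℝ => (z, t)) ((0, 1) : P × ℝ) 0 :=
      (hasDerivAt_const (0 : ℝ) z).prodMk (hasDerivAt_id (0 : ℝ))
    have h2 : fderiv ℝ f (z, 0) (0, 1) = v := by
      rw [← hfv]
      exact ((hs.hasFDerivAt).comp_hasDerivAt (0 : ℝ) h1).deriv.symm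
    have h3 : Tendsto (fun q : P × ℝ => (q, (q.1, (0 : ℝ)))) (𝓝 (z, 0)) (𝓝 ((z, 0), (z, 0))) :=
      (show Continuous fun q : P × ℝ => (q, (q.1, (0 : ℝ))) by fun_prop).tendsto (z, 0)
    have h4 := (hs.isLittleO.comp_tendsto h3).bound (c := 1 / (4 * K)) (by positivity)
    filter_upwards [h4] with q hq
    have h5 : q - (q.1, (0 : ℝ)) = q.2 • ((0, 1) : P × ℝ) := by
      ext <;> simp
    simp only [Function.comp, h5, map_smul, h2] at hq
    refine hq.trans_eq ?_
    rw [norm_smul]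
    simp [Prod.norm_def]
  filter_upwards [(continuous_fst.tendsto ((z₁, (0 : ℝ)), (z₂, (0 : ℝ)))).eventually
      (hsmall hf₁ hv₁), (continuous_snd.tendsto ((z₁, (0 : ℝ)), (z₂, (0 : ℝ)))).eventually
      (hsmall hf₂ hv₂)] with q h1 h2 h3 h4
  have h5 : ‖L (q.1.2, q.2.2)‖ ≤ 1 / (4 * K) * |q.1.2| + 1 / (4 * K) * |q.2.2| := by
    have : L (q.1.2, q.2.2) = (f₂ q.2 - f₂ (q.2.1, 0) - q.2.2 • v₂) -
        (f₁ q.1 - f₁ (q.1.1, 0) - q.1.2 • v₁) := by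
      rw [hL, h3, h4]; abel
    rw [this]
    exact (norm_sub_le _ _).trans (by linarith)
  have h6 := hKL (q.1.2, q.2.2)
  have h7 : |q.1.2| ≤ ‖(q.1.2, q.2.2)‖ := norm_fst_le (q.1.2, q.2.2)
  have h8 : |q.2.2| ≤ ‖(q.1.2, q.2.2)‖ := norm_snd_le (q.1.2, q.2.2)
  have h9 : (K : ℝ) * ‖L (q.1.2, q.2.2)‖ ≤ (|q.1.2| + |q.2.2|) / 4 := by
    calc (K : ℝ) * ‖L (q.1.2, q.2.2)‖ ≤ K * (1 / (4 * K) * |q.1.2| + 1 / (4 * K) * |q.2.2|) := by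
          gcongr
      _ = (|q.1.2| + |q.2.2|) / 4 := by field_simp
  have h10 : ‖(q.1.2, q.2.2)‖ ≤ 0 := by linarith
  have h11 := norm_le_zero_iff.1 h10
  exact ⟨congrArg Prod.fst h11, congrArg Prod.snd h11⟩

/-- If two curves meet only at their starting point, so do the curves of two families of which they
are members, if this holds for small times. -/
lemma eventually_forall_ne_of_ne {A M : Type*} [TopologicalSpace A] [TopologicalSpace M] [T2Space M]
    {c₁ c₂ : A × ℝ → M} {a₀ : A} {l₁ r₁ l₂ r₂ : A → ℝ}
    (hl₁ : ContinuousAt l₁ a₀) (hr₁ : ContinuousAt r₁ a₀) (hlr₁ : l₁ a₀ ≤ r₁ a₀)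
    (hl₂ : ContinuousAt l₂ a₀) (hr₂ : ContinuousAt r₂ a₀) (hlr₂ : l₂ a₀ ≤ r₂ a₀)
    (hc₁ : ∀ t ∈ Icc (l₁ a₀) (r₁ a₀), ContinuousAt c₁ (a₀, t))
    (hc₂ : ∀ t ∈ Icc (l₂ a₀) (r₂ a₀), ContinuousAt c₂ (a₀, t))
    (hne : ∀ t ∈ Icc (l₁ a₀) (r₁ a₀), ∀ s ∈ Icc (l₂ a₀) (r₂ a₀), c₁ (a₀, t) = c₂ (a₀, s) →
      t = 0 ∧ s = 0)
    (hloc : ∀ᶠ q : (A × ℝ) × ℝ in 𝓝 ((a₀, 0), 0), c₁ q.1 = c₂ (q.1.1, q.2) →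
      q.1.2 = 0 ∧ q.2 = 0) :
    ∀ᶠ a in 𝓝 a₀, ∀ t ∈ Icc (l₁ a) (r₁ a), ∀ s ∈ Icc (l₂ a) (r₂ a), c₁ (a, t) = c₂ (a, s) →
      t = 0 ∧ s = 0 := by
  refine eventually_forall_mem_Icc hl₁ hr₁ hlr₁
    (Q := fun q => ∀ s ∈ Icc (l₂ q.1) (r₂ q.1), c₁ q = c₂ (q.1, s) → q.2 = 0 ∧ s = 0) fun t ht => ?_
  refine eventually_forall_mem_Icc (a₀ := (a₀, t)) (l := fun q => l₂ q.1) (r := fun q => r₂ q.1)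
    (Q := fun q => c₁ q.1 = c₂ (q.1.1, q.2) → q.1.2 = 0 ∧ q.2 = 0)
    (ContinuousAt.comp (x := (a₀, t)) hl₂ continuousAt_fst)
    (ContinuousAt.comp (x := (a₀, t)) hr₂ continuousAt_fst) hlr₂ fun s hs => ?_
  by_cases h0 : c₁ (a₀, t) = c₂ (a₀, s)
  · obtain ⟨rfl, rfl⟩ := hne t ht s hs h0
    exact hloc
  · have h1 : ContinuousAt (fun q : (A × ℝ) × ℝ => c₁ q.1) ((a₀, t), s) :=
      ContinuousAt.comp (x := ((a₀, t), s)) (hc₁ t ht) continuousAt_fst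
    have h2 : ContinuousAt (fun q : (A × ℝ) × ℝ => c₂ (q.1.1, q.2)) ((a₀, t), s) := by
      refine ContinuousAt.comp (x := ((a₀, t), s)) (g := c₂)
        (f := fun q : (A × ℝ) × ℝ => (q.1.1, q.2)) (hc₂ s hs) ?_
      exact (show Continuous fun q : (A × ℝ) × ℝ => (q.1.1, q.2) by fun_prop).continuousAt
    filter_upwards [h1.ne_iff_eventually_ne h2 |>.1 h0] with q hq h
    exact absurd h hq

end Uniformity

/-! ### Nontangential geodesics in analytic families -/

section Geodesics

variable {n : ℕ} {M : Type*} [TopologicalSpace M] [ChartedSpace (EuclideanSpace ℝ (Fin n)) M]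

/-- The velocity, one-sided at the end points, of a curve that extends differentiably. -/
lemma velocity_eq_mfderiv {γ c : ℝ → M} {a b t : ℝ} (hab : a < b) (ht : t ∈ Icc a b)
    (hc : MDifferentiableAt 𝓘(ℝ, ℝ) (𝓡 n) c t) (hcγ : ∀ s ∈ Icc a b, c s = γ s) :
    (velocity (n := n) γ a b t : Coord n) =
      (mfderiv 𝓘(ℝ, ℝ) (𝓡 n) c t : ℝ →L[ℝ] Coord n) 1 := by
  have h1 : (mfderivWithin 𝓘(ℝ, ℝ) (𝓡 n) c (Icc a b) t : ℝ →L[ℝ] Coord n) =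
      (mfderiv 𝓘(ℝ, ℝ) (𝓡 n) c t : ℝ →L[ℝ] Coord n) :=
    mfderivWithin_eq_mfderiv ((uniqueDiffOn_Icc hab).uniqueMDiffOn t ht) hc
  have h2 : (mfderivWithin 𝓘(ℝ, ℝ) (𝓡 n) γ (Icc a b) t : ℝ →L[ℝ] Coord n) =
      (mfderivWithin 𝓘(ℝ, ℝ) (𝓡 n) c (Icc a b) t : ℝ →L[ℝ] Coord n) :=
    mfderivWithin_congr_of_mem (fun s hs => (hcγ s hs).symm) ht
  rw [← h1, ← h2]
  rfl

lemma mfderiv_comp_neg_apply_one {c : ℝ → M} {t : ℝ}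
    (hc : MDifferentiableAt 𝓘(ℝ, ℝ) (𝓡 n) c (-t)) :
    (mfderiv 𝓘(ℝ, ℝ) (𝓡 n) (fun s => c (-s)) t : ℝ →L[ℝ] Coord n) 1 =
      -(mfderiv 𝓘(ℝ, ℝ) (𝓡 n) c (-t) : ℝ →L[ℝ] Coord n) 1 := by
  have h1 : HasMFDerivAt 𝓘(ℝ, ℝ) 𝓘(ℝ, ℝ) (fun s : ℝ => -s) t (-ContinuousLinearMap.id ℝ ℝ) :=
    (hasFDerivAt_id t).neg.hasMFDerivAt
  have h2 := HasMFDerivAt.comp t (g := c) (f := fun s : ℝ => -s) hc.hasMFDerivAt h1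
  have h3 : (mfderiv 𝓘(ℝ, ℝ) (𝓡 n) (fun s => c (-s)) t : ℝ →L[ℝ] Coord n) =
      (mfderiv 𝓘(ℝ, ℝ) (𝓡 n) c (-t) : ℝ →L[ℝ] Coord n).comp (-ContinuousLinearMap.id ℝ ℝ) :=
    h2.mfderiv
  rw [h3, ← map_neg]
  rfl

variable [IsManifold (𝓡 n) ω M] {g : AnalyticMetric n M}

lemma IsGeodesic.geodesicAt {γ : ℝ → M} {a b t : ℝ} (h : IsGeodesic g γ a b) (ht : t ∈ Ioo a b) :
    GeodesicAt g γ t := by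
  intro w
  have hw : ∀ {u : ℝ → Coord n} {s : ℝ}, s ∈ Ioo a b → derivWithin u (Icc a b) s = deriv u s :=
    fun hs => derivWithin_of_mem_nhds (Icc_mem_nhds hs.1 hs.2)
  have h1 : derivWithin (coordCurve (n := n) γ (γ t)) (Icc a b) =ᶠ[𝓝 t]
      deriv (coordCurve (n := n) γ (γ t)) := by
    filter_upwards [Ioo_mem_nhds ht.1 ht.2] with s hs
    exact hw hs
  have h2 := h.2 t (Ioo_subset_Icc_self ht) w
  simp only at h2
  rw [hw ht, hw ht, h1.deriv_eq] at h2
  exact h2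

lemma isGeodesic_of_geodesicAt {c : ℝ → M} {a b : ℝ} (hab : a < b)
    (hc : ∀ t ∈ Icc a b, ContMDiffAt 𝓘(ℝ, ℝ) (𝓡 n) 2 c t)
    (h : ∀ t ∈ Icc a b, GeodesicAt g c t) : IsGeodesic g c a b := by
  refine ⟨fun t ht => (hc t ht).contMDiffWithinAt, fun t ht w => ?_⟩
  have hu := contDiffAt_coordCurve (hc t ht) (mem_extChartAt_source (I := 𝓡 n) (c t))
  have hw : ∀ {u : ℝ → Coord n} {s : ℝ}, s ∈ Icc a b → DifferentiableAt ℝ u s →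
      derivWithin u (Icc a b) s = deriv u s := fun hs hd =>
    hd.derivWithin (uniqueDiffOn_Icc hab _ hs)
  have h1 : derivWithin (coordCurve (n := n) c (c t)) (Icc a b) =ᶠ[𝓝[Icc a b] t]
      deriv (coordCurve (n := n) c (c t)) := by
    filter_upwards [self_mem_nhdsWithin,
      mem_nhdsWithin_of_mem_nhds (eventually_hasDerivAt hu)] with s hs hs'
    exact hw hs (HasDerivAt.differentiableAt hs')
  simp only
  rw [h1.derivWithin_eq_of_mem ht, hw ht (hasDerivAt_deriv hu).differentiableAt,
    hw ht (eventually_hasDerivAt hu).self_of_nhds.differentiableAt]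
  exact h t ht w

end Geodesics

section NontangentialFamily

variable {n : ℕ} {M : Type*} [TopologicalSpace M] [ChartedSpace (EuclideanSpace ℝ (Fin n)) M]

lemma isNontangentialVector_neg_iff {X : Set M} {q : M} {v : Coord n} :
    IsNontangentialVector (n := n) X q (-v : Coord n) ↔ IsNontangentialVector (n := n) X q v := by
  have hneg : ∀ {L : Coord n →L[ℝ] ℝ}, L (-v) ≠ 0 ↔ L v ≠ 0 := by simp
  exact exists_congr fun ρ => and_congr_right fun _ => hneg

variable [IsManifold (𝓡 n) ω M] {g : AnalyticMetric n M} {X : Set M}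

/-- A nontangential unit speed geodesic `γ` is embedded in an analytic family of such geodesics,
parametrized by position and velocity at time `0` in the chart at `γ 0`, the initial velocities
being of length one. -/
lemma IsNontangentialGeodesic.exists_family (hX : IsCompactWithSmoothBoundary n X) {γ : ℝ → M}
    {T₁ T₂ : ℝ} (h : IsNontangentialGeodesic g X γ T₁ T₂) {p : M} (hp : γ 0 = p) :
    ∃ (v : Coord n) (Γ : (Coord n × Coord n) × ℝ → M) (τ₁ τ₂ : Coord n × Coord n → ℝ),
      (velocity (n := n) γ (-T₁) T₂ 0 : Coord n) = chartFrame p (extChartAt (𝓡 n) p p) v ∧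
      (∀ t ∈ Icc (-T₁) T₂, Γ ((extChartAt (𝓡 n) p p, v), t) = γ t) ∧
      τ₁ (extChartAt (𝓡 n) p p, v) = T₁ ∧ τ₂ (extChartAt (𝓡 n) p p, v) = T₂ ∧
      ∀ᶠ z in 𝓝 (extChartAt (𝓡 n) p p, v), ContinuousAt τ₁ z ∧ ContinuousAt τ₂ z ∧
        (∀ t ∈ Icc (-τ₁ z) (τ₂ z), ContMDiffAt 𝓘(ℝ, (Coord n × Coord n) × ℝ) (𝓡 n) ω Γ (z, t)) ∧
        Γ (z, 0) = (extChartAt (𝓡 n) p).symm z.1 ∧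
        chartState p Γ (z, 0) = z ∧
        (coordMetric g p z.1 z.2 z.2 = 1 →
          IsNontangentialGeodesic g X (fun t => Γ (z, t)) (τ₁ z) (τ₂ z) ∧
          (velocity (n := n) (fun t => Γ (z, t)) (-τ₁ z) (τ₂ z) 0 : Coord n) =
            chartFrame p z.1 z.2) := by
  subst hp
  have hT₁ := h.pos_left
  have hT₂ := h.pos_right
  have hlt : -T₁ < T₂ := by linarith
  obtain ⟨Γ, hfam, hΓγ, hΓ0⟩ := exists_geodesicFamily (g := g) (neg_lt_zero.2 hT₁) hT₂
    h.geodesic.1 fun t ht => h.geodesic.geodesicAt ht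
  obtain ⟨v, hv⟩ : ∃ v, curveState γ (-T₁) T₂ (γ 0) 0 = (extChartAt (𝓡 n) (γ 0) (γ 0), v) :=
    ⟨_, rfl⟩
  rw [hv] at hfam hΓγ hΓ0
  set z₀ : Coord n × Coord n := (extChartAt (𝓡 n) (γ 0) (γ 0), v) with hz₀
  have h0mem : (0 : ℝ) ∈ Icc (-T₁) T₂ := ⟨by linarith, hT₂.le⟩
  have hmd : ∀ {z t}, ContMDiffAt 𝓘(ℝ, (Coord n × Coord n) × ℝ) (𝓡 n) ω Γ (z, t) →
      MDifferentiableAt 𝓘(ℝ, ℝ) (𝓡 n) (fun s => Γ (z, s)) t := fun hc =>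
    (contMDiffAt_slice hc).mdifferentiableAt (by simp)
  have hvel : ∀ t (ht : t ∈ Icc (-T₁) T₂), (velocity (n := n) γ (-T₁) T₂ t : Coord n) =
      (mfderiv 𝓘(ℝ, ℝ) (𝓡 n) (fun s => Γ (z₀, s)) t : ℝ →L[ℝ] Coord n) 1 := fun t ht =>
    velocity_eq_mfderiv hlt ht (hmd (hfam t ht).self_of_nhds.1) hΓγ
  have hlmem : -T₁ ∈ Icc (-T₁) T₂ := ⟨le_rfl, hlt.le⟩
  have hrmem : T₂ ∈ Icc (-T₁) T₂ := ⟨hlt.le, le_rfl⟩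
  -- The exit time at the right end.
  obtain ⟨ρ₂, hρ₂, hρ₂v⟩ := h.right_nontangential
  obtain ⟨τ₂, hτ₂0, hτ₂, hint₂⟩ := exists_exitTime hX (hfam T₂ hrmem).self_of_nhds.1 (by
      filter_upwards [Ioo_mem_nhdsLT hlt] with t ht
      rw [hΓγ t (Ioo_subset_Icc_self ht)]
      exact interior_subset (h.mem_interior t ht)) (ρ := ρ₂)
    (by rw [hΓγ T₂ hrmem]; exact hρ₂) (by
      rw [← hvel T₂ hrmem, hΓγ T₂ hrmem]
      exact hρ₂v)
  -- The exit time at the left end is that of the reversed curves at the right end.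
  let Γr : (Coord n × Coord n) × ℝ → M := fun q => Γ (q.1, -q.2)
  have hΓr : ContMDiffAt 𝓘(ℝ, (Coord n × Coord n) × ℝ) (𝓡 n) ω Γr (z₀, T₁) :=
    (IsGeodesicFamilyAt.comp_neg (σ := id) contDiffAt_id (hfam (-T₁) hlmem)).self_of_nhds.1
  have hΓrT : Γr (z₀, T₁) = γ (-T₁) := hΓγ (-T₁) hlmem
  obtain ⟨ρ₁, hρ₁, hρ₁v⟩ := h.left_nontangential
  obtain ⟨τ₁, hτ₁0, hτ₁, hint₁⟩ := exists_exitTime hX hΓr (by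
      filter_upwards [Ioo_mem_nhdsLT (show -T₂ < T₁ by linarith)] with t ht
      have ht' : -t ∈ Ioo (-T₁) T₂ := ⟨by linarith [ht.2], by linarith [ht.1]⟩
      rw [show Γr (z₀, t) = γ (-t) from hΓγ (-t) (Ioo_subset_Icc_self ht')]
      exact interior_subset (h.mem_interior (-t) ht')) (ρ := ρ₁)
    (by rw [hΓrT]; exact hρ₁) (by
      have h1 := mfderiv_comp_neg_apply_one (hmd (hfam (-T₁) hlmem).self_of_nhds.1)
      rw [show (mfderiv 𝓘(ℝ, ℝ) (𝓡 n) (fun t => Γr (z₀, t)) T₁ : ℝ →L[ℝ] Coord n) 1 = _ from h1,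
        ← hvel (-T₁) hlmem, hΓrT]
      have hneg : ∀ {L : Coord n →L[ℝ] ℝ} {w : Coord n}, L w ≠ 0 → L (-w) ≠ 0 := by simp
      exact hneg hρ₁v)
  have hτ₁c : ContinuousAt τ₁ z₀ := hτ₁.self_of_nhds.1
  have hτ₂c : ContinuousAt τ₂ z₀ := hτ₂.self_of_nhds.1
  refine ⟨v, Γ, τ₁, τ₂, ?_, hΓγ, hτ₁0, hτ₂0, ?_⟩
  · rw [hvel 0 h0mem, mfderiv_apply_one_eq_chartFrame (p := γ 0)
      ((contMDiffAt_slice (hfam 0 h0mem).self_of_nhds.1).of_le le_top)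
      (by simp only [hΓγ 0 h0mem]; exact mem_extChartAt_source _)]
    have h1 := congrArg Prod.snd hΓ0.self_of_nhds
    simp only [chartState, hz₀] at h1
    rw [← hz₀] at h1
    rw [h1, coordCurve, hΓγ 0 h0mem]
  -- Statements that hold near each point of `[-T₁, T₂]` hold on the intervals nearby.
  have htube : ∀ {Q : (Coord n × Coord n) × ℝ → Prop},
      (∀ t ∈ Icc (-T₁) T₂, ∀ᶠ q in 𝓝 (z₀, t), Q q) →
      ∀ᶠ z in 𝓝 z₀, ∀ t ∈ Icc (-τ₁ z) (τ₂ z), Q (z, t) := by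
    intro Q hQ
    refine eventually_forall_mem_Icc hτ₁c.neg hτ₂c ?_ ?_
    · rw [Pi.neg_apply, hτ₁0, hτ₂0]; exact hlt.le
    · rw [Pi.neg_apply, hτ₁0, hτ₂0]; exact hQ
  have hinterior : ∀ᶠ z in 𝓝 z₀, ∀ t ∈ Icc (-τ₁ z) (τ₂ z),
      t ∈ Ioo (-τ₁ z) (τ₂ z) → Γ (z, t) ∈ interior X := by
    refine htube (Q := fun q => q.2 ∈ Ioo (-τ₁ q.1) (τ₂ q.1) → Γ q ∈ interior X) fun t ht => ?_
    rcases eq_or_lt_of_le ht.1 with rfl | ht1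
    · have h1 : Tendsto (fun q : (Coord n × Coord n) × ℝ => (q.1, -q.2)) (𝓝 (z₀, -T₁))
          (𝓝 (z₀, T₁)) := by
        have := (show Continuous fun q : (Coord n × Coord n) × ℝ => (q.1, -q.2) by
          fun_prop).tendsto (z₀, -T₁)
        simpa only [neg_neg] using this
      filter_upwards [h1.eventually hint₁] with q hq hq'
      have h2 := hq (neg_lt.1 hq'.1)
      simpa only [Γr, neg_neg] using h2
    · rcases eq_or_lt_of_le ht.2 with rfl | ht2
      · filter_upwards [hint₂] with q hq hq'
        exact hq hq'.2
      · have h1 : Γ (z₀, t) ∈ interior X := by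
          rw [hΓγ t ht]; exact h.mem_interior t ⟨ht1, ht2⟩
        filter_upwards [(hfam t ht).self_of_nhds.1.continuousAt.eventually
          (isOpen_interior.mem_nhds h1)] with q hq _
        exact hq
  have hsource : ∀ᶠ z in 𝓝 z₀, Γ (z, 0) ∈ (extChartAt (𝓡 n) (γ 0)).source := by
    have h1 : ContinuousAt (fun z => Γ (z, 0)) z₀ :=
      ContinuousAt.comp (f := fun z => (z, (0 : ℝ))) (hfam 0 h0mem).self_of_nhds.1.continuousAt
        (Continuous.prodMk_left 0).continuousAt
    refine h1.eventually (source_mem_nhds ?_)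
    simp only [hΓγ 0 h0mem]
    exact mem_extChartAt_source _
  filter_upwards [hτ₁, hτ₂, htube fun t ht => hfam t ht, hinterior, hΓ0, hsource,
    hτ₁c.eventually (Ioi_mem_nhds (hτ₁0.symm ▸ hT₁)),
    hτ₂c.eventually (Ioi_mem_nhds (hτ₂0.symm ▸ hT₂))] with z h1 h2 h3 h4 h5 h6 h7 h8
  replace h7 : 0 < τ₁ z := h7
  replace h8 : 0 < τ₂ z := h8
  have hltz : -τ₁ z < τ₂ z := by linarith
  have hz0 : (0 : ℝ) ∈ Icc (-τ₁ z) (τ₂ z) := ⟨by linarith, h8.le⟩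
  have hc : ∀ t ∈ Icc (-τ₁ z) (τ₂ z),
      ContMDiffAt 𝓘(ℝ, (Coord n × Coord n) × ℝ) (𝓡 n) ω Γ (z, t) :=
    fun t ht => (h3 t ht).1
  have hc2 : ∀ t ∈ Icc (-τ₁ z) (τ₂ z), ContMDiffAt 𝓘(ℝ, ℝ) (𝓡 n) 2 (fun s => Γ (z, s)) t :=
    fun t ht => (contMDiffAt_slice (hc t ht)).of_le le_top
  have hgeo : ∀ t ∈ Icc (-τ₁ z) (τ₂ z), GeodesicAt g (fun s => Γ (z, s)) t :=
    fun t ht => (h3 t ht).2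
  have hvelz : ∀ t (ht : t ∈ Icc (-τ₁ z) (τ₂ z)),
      (velocity (n := n) (fun s => Γ (z, s)) (-τ₁ z) (τ₂ z) t : Coord n) =
      (mfderiv 𝓘(ℝ, ℝ) (𝓡 n) (fun s => Γ (z, s)) t : ℝ →L[ℝ] Coord n) 1 := fun t ht =>
    velocity_eq_mfderiv hltz ht (hmd (hc t ht)) fun _ _ => rfl
  have hstart : Γ (z, 0) = (extChartAt (𝓡 n) (γ 0)).symm z.1 := by
    rw [← congrArg Prod.fst h5]
    exact ((extChartAt (𝓡 n) (γ 0)).left_inv h6).symm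
  have hvel0 : (velocity (n := n) (fun s => Γ (z, s)) (-τ₁ z) (τ₂ z) 0 : Coord n) =
      chartFrame (γ 0) z.1 z.2 := by
    have e1 : coordCurve (n := n) (fun s => Γ (z, s)) (γ 0) 0 = z.1 := congrArg Prod.fst h5
    have e2 : deriv (coordCurve (n := n) (fun s => Γ (z, s)) (γ 0)) 0 = z.2 :=
      congrArg Prod.snd h5
    rw [hvelz 0 hz0, mfderiv_apply_one_eq_chartFrame (p := γ 0)
      ((contMDiffAt_slice (hc 0 hz0)).of_le le_top) h6, e1, e2]
  refine ⟨h1.1, h2.1, hc, hstart, h5, fun hunit => ⟨?_, hvel0⟩⟩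
  -- The speed is constant.
  have hspeed := constant_of_has_deriv_right_zero
    (fun t ht => ((hgeo t ht).hasDerivAt_speed (hc2 t ht)).continuousAt.continuousWithinAt)
    (fun t ht => ((hgeo t (Ico_subset_Icc_self ht)).hasDerivAt_speed
      (hc2 t (Ico_subset_Icc_self ht))).hasDerivWithinAt)
  exact
    { pos_left := h7
      pos_right := h8
      geodesic := isGeodesic_of_geodesicAt hltz hc2 hgeo
      unit_speed := by
        intro t ht
        change metricAt g (Γ (z, t))
          (velocity (n := n) (fun s => Γ (z, s)) (-τ₁ z) (τ₂ z) t : Coord n)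
          (velocity (n := n) (fun s => Γ (z, s)) (-τ₁ z) (τ₂ z) t : Coord n) = 1
        rw [hvelz t ht, hspeed t ht, ← hspeed 0 hz0, ← hvelz 0 hz0, hvel0, hstart,
          ← coordMetric_apply]
        exact hunit
      left_mem := h1.2.1
      right_mem := h2.2.1
      mem_interior := fun t ht => h4 t (Ioo_subset_Icc_self ht) ht
      left_nontangential := by
        have e1 := hvelz (-τ₁ z) ⟨le_rfl, hltz.le⟩
        have e2 := mfderiv_comp_neg_apply_one (hmd (hc (-τ₁ z) ⟨le_rfl, hltz.le⟩))
        have e3 := h1.2.2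
        rw [show (mfderiv 𝓘(ℝ, ℝ) (𝓡 n) (fun t => Γr (z, t)) (τ₁ z) : ℝ →L[ℝ] Coord n) 1 = _
          from e2, ← e1] at e3
        exact isNontangentialVector_neg_iff.1 e3
      right_nontangential := by
        have e1 := hvelz (τ₂ z) ⟨hltz.le, le_rfl⟩
        have e3 := h2.2.2
        rw [← e1] at e3
        exact e3 }

end NontangentialFamily

/-! ### Admissible pairs -/

section Covectors

variable {n : ℕ} {M : Type*} [TopologicalSpace M] [ChartedSpace (EuclideanSpace ℝ (Fin n)) M]

lemma tangentBundle_mk_eq_iff {x y : M} (hxy : x = y) {v w : Coord n} :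
    (⟨x, v⟩ : TangentBundle (𝓡 n) M) = ⟨y, w⟩ ↔ v = w := by
  subst hxy
  constructor
  · intro h
    cases h
    rfl
  · rintro rfl
    rfl

variable [IsManifold (𝓡 n) ω M] (g : AnalyticMetric n M)

/-- The coordinate expression of the duality between tangent vectors and covectors. -/
lemma coordMetric_eq_smul_covectorCoord_iff {p : M} {α : CotangentBundle n M}
    (hα : α.proj ∈ (extChartAt (𝓡 n) p).source) {a : Coord n} {c : ℝ} :
    coordMetric g p (extChartAt (𝓡 n) p α.proj) a = c • covectorCoord p α ↔
      metricAt g α.proj (chartFrame p (extChartAt (𝓡 n) p α.proj) a) =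
        c • (α.snd : Coord n →L[ℝ] ℝ) := by
  have hy := (extChartAt (𝓡 n) p).map_source hα
  have hx := (extChartAt (𝓡 n) p).left_inv hα
  constructor
  · intro h
    refine ContinuousLinearMap.ext fun w => ?_
    obtain ⟨b, rfl⟩ := chartFrame_surjective hy w
    have h1 := DFunLike.congr_fun h b
    rw [coordMetric_apply, hx] at h1
    exact h1
  · intro h
    refine ContinuousLinearMap.ext fun b => ?_
    rw [coordMetric_apply, hx, h]
    rfl

lemma exists_dual_of_mem_cosphereInterior {X : Set M} {p : M} {α : CotangentBundle n M}
    (hα : α ∈ cosphereInterior g X) (hp : α.proj ∈ (extChartAt (𝓡 n) p).source) :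
    ∃ s, coordMetric g p (extChartAt (𝓡 n) p α.proj) s = covectorCoord p α ∧
      covectorCoord p α s = 1 := by
  obtain ⟨-, v, hv, hvα⟩ := hα
  obtain ⟨s, hs⟩ := chartFrame_surjective ((extChartAt (𝓡 n) p).map_source hp) v
  have h1 : coordMetric g p (extChartAt (𝓡 n) p α.proj) s = (1 : ℝ) • covectorCoord p α := by
    rw [coordMetric_eq_smul_covectorCoord_iff g hp, one_smul, hs]
    exact hvα
  rw [one_smul] at h1
  refine ⟨s, h1, ?_⟩
  rw [← h1, coordMetric_apply, (extChartAt (𝓡 n) p).left_inv hp, hs]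
  exact hv

end Covectors

/-- Two unit vectors are linearly independent if their sum has length strictly between `0` and
`2`. -/
lemma eq_zero_of_smul_eq_smul {E : Type*} [NormedAddCommGroup E] [NormedSpace ℝ E]
    {G : E →L[ℝ] E →L[ℝ] ℝ} (hG : ∀ a b, G a b = G b a) {v₁ v₂ : E} {t₀ : ℝ} (h₁ : G v₁ v₁ = 1)
    (h₂ : G v₂ v₂ = 1) (ht : 0 < t₀) (ht' : t₀ < 2) (hsum : G (v₁ + v₂) (v₁ + v₂) = t₀ ^ 2)
    {a b : ℝ} (hab : a • v₁ = b • v₂) : a = 0 ∧ b = 0 := by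
  simp only [map_add, add_apply, h₁, h₂, hG v₂ v₁] at hsum
  have h3 := congrArg (G v₁) hab
  have h4 := congrArg (fun w => G w v₂) hab
  simp only [map_smul, smul_apply, smul_eq_mul, h₁, h₂, mul_one] at h3 h4
  generalize G v₁ v₂ = k at *
  have hk : 0 < 1 - k ^ 2 := by
    have e1 : -1 < k := by nlinarith
    have e2 : k < 1 := by nlinarith
    nlinarith
  have ha : a * (1 - k ^ 2) = 0 := by rw [mul_sub, mul_one]; nlinarith
  have ha0 : a = 0 := (mul_eq_zero.1 ha).resolve_right hk.ne'
  subst ha0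
  exact ⟨rfl, by linarith⟩

section Analytic

variable {n : ℕ} {M : Type*} [TopologicalSpace M] [ChartedSpace (EuclideanSpace ℝ (Fin n)) M]
  [IsManifold (𝓡 n) ω M] {P : Type*} [NormedAddCommGroup P] [NormedSpace ℝ P]

/-- Analytic dependence on covectors through an analytic parameter `z`. The domain of analyticity is
the set of all points near which the map is analytic. -/
lemma dependsAnalytically_comp {V : Set (CotangentBundle n M)} {Γ : P × ℝ → M} {τ₁ τ₂ : P → ℝ}
    {z : CotangentBundle n M → P}
    (hz : ∀ α ∈ V, ContMDiffAt (cotangentModel n) 𝓘(ℝ, P) ω z α)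
    (hτ₁ : ∀ α ∈ V, ContinuousAt τ₁ (z α)) (hτ₂ : ∀ α ∈ V, ContinuousAt τ₂ (z α))
    (hΓ : ∀ α ∈ V, ∀ t ∈ Icc (-τ₁ (z α)) (τ₂ (z α)),
      ContMDiffAt 𝓘(ℝ, P × ℝ) (𝓡 n) ω Γ (z α, t)) :
    DependsAnalytically V (fun α t => Γ (z α, t)) (fun α => τ₁ (z α)) (fun α => τ₂ (z α)) := by
  refine ⟨fun α hα => (ContinuousAt.comp (hτ₁ α hα) (hz α hα).continuousAt).continuousWithinAt,
    fun α hα => (ContinuousAt.comp (hτ₂ α hα) (hz α hα).continuousAt).continuousWithinAt,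
    interior {q | ContMDiffAt ((cotangentModel n).prod 𝓘(ℝ, ℝ)) (𝓡 n) ω
      (fun q : CotangentBundle n M × ℝ => Γ (z q.1, q.2)) q}, isOpen_interior, ?_,
    fun q hq => (interior_subset hq).contMDiffWithinAt⟩
  intro α hα t ht
  rw [mem_interior_iff_mem_nhds]
  refine (contMDiffAt_iff_contMDiffAt_nhds (by simp)).1 ?_
  have h1 : ContMDiffAt ((cotangentModel n).prod 𝓘(ℝ, ℝ)) 𝓘(ℝ, P × ℝ) ω
      (fun q : CotangentBundle n M × ℝ => (z q.1, q.2)) (α, t) :=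
    ContMDiffAt.prodMk_space (ContMDiffAt.comp (α, t) (hz α hα) contMDiffAt_fst) contMDiffAt_snd
  exact ContMDiffAt.comp (α, t) (hΓ α hα t ht) h1

end Analytic

end AdmissiblePairs

end

open AdmissiblePairs

theorem mainTheorem6 (n : ℕ) (hn : 2 ≤ n) {M : Type*} [TopologicalSpace M] [T2Space M]
    [SecondCountableTopology M] [ChartedSpace (EuclideanSpace ℝ (Fin n)) M]
    [IsManifold (𝓡 n) ω M] (g : AnalyticMetric n M)
    (X : Set M) (hX : AdmissiblePairs.IsCompactWithSmoothBoundary n X)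
    (α₀ : CotangentBundle n M) (hα₀ : α₀ ∈ AdmissiblePairs.cosphereInterior g X)
    (γ₁ γ₂ : ℝ → M) (T₁ T₂ S₁ S₂ : ℝ)
    (h : AdmissiblePairs.IsAdmissiblePair g X α₀ γ₁ T₁ T₂ γ₂ S₁ S₂) :
    ∃ V ⊆ AdmissiblePairs.cosphereInterior g X,
      V ∈ 𝓝[AdmissiblePairs.cosphereInterior g X] α₀ ∧
      ∃ (Γ₁ Γ₂ : CotangentBundle n M → ℝ → M) (τ₁ τ₂ σ₁ σ₂ : CotangentBundle n M → ℝ),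
        (∀ α ∈ V,
          AdmissiblePairs.IsAdmissiblePair g X α (Γ₁ α) (τ₁ α) (τ₂ α) (Γ₂ α) (σ₁ α) (σ₂ α)) ∧
        AdmissiblePairs.DependsAnalytically V Γ₁ τ₁ τ₂ ∧
        AdmissiblePairs.DependsAnalytically V Γ₂ σ₁ σ₂ ∧
        (τ₁ α₀ = T₁ ∧ τ₂ α₀ = T₂ ∧ σ₁ α₀ = S₁ ∧ σ₂ α₀ = S₂) ∧
        (∀ t ∈ Icc (-T₁) T₂, Γ₁ α₀ t = γ₁ t) ∧
        (∀ s ∈ Icc (-S₁) S₂, Γ₂ α₀ s = γ₂ s) := by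
  -- The given pair in the chart at its common point.
  set p : M := α₀.proj with hpdef
  set y₀ : Coord n := extChartAt (𝓡 n) p p with hy₀
  have hy₀t : y₀ ∈ (extChartAt (𝓡 n) p).target := mem_extChartAt_target p
  have hy₀p : (extChartAt (𝓡 n) p).symm y₀ = p := extChartAt_to_inv p
  have hpp : p ∈ (extChartAt (𝓡 n) p).source := mem_extChartAt_source p
  obtain ⟨v₁, Φ₁, θ₁, θ₂, hv₁, hΦ₁, hθ₁, hθ₂, hfam₁⟩ := h.nontangential₁.exists_family hX h.base₁
  obtain ⟨v₂, Φ₂, η₁, η₂, hv₂, hΦ₂, hη₁, hη₂, hfam₂⟩ := h.nontangential₂.exists_family hX h.base₂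
  obtain ⟨t₀, ht₀, ht₀', w₁, w₂, hw₁, hw₂, hsum⟩ := h.sum_eq
  have hT₁ := h.nontangential₁.pos_left
  have hT₂ := h.nontangential₁.pos_right
  have hS₁ := h.nontangential₂.pos_left
  have hS₂ := h.nontangential₂.pos_right
  have hunit : ∀ {γ : ℝ → M} {A B : ℝ} {v : Coord n}, IsNontangentialGeodesic g X γ A B →
      γ 0 = p → (velocity (n := n) γ (-A) B 0 : Coord n) = chartFrame p y₀ v →
      coordMetric g p y₀ v v = 1 := by
    intro γ A B v hγ hγ0 hγv
    have h1 : metricAt g (γ 0) (velocity (n := n) γ (-A) B 0 : Coord n)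
        (velocity (n := n) γ (-A) B 0 : Coord n) = 1 :=
      hγ.unit_speed 0 ⟨by linarith [hγ.pos_left], hγ.pos_right.le⟩
    rw [coordMetric_apply, hy₀p, ← hγv, ← hγ0]
    exact h1
  have hu₁ := hunit h.nontangential₁ h.base₁ hv₁
  have hu₂ := hunit h.nontangential₂ h.base₂ hv₂
  have hsum₀ : coordMetric g p y₀ (v₁ + v₂) = t₀ • covectorCoord p α₀ := by
    rw [hy₀, hpdef, coordMetric_eq_smul_covectorCoord_iff g hpp, map_add]
    rw [← (tangentBundle_mk_eq_iff h.base₁).1 hw₁,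
      ← (tangentBundle_mk_eq_iff h.base₂).1 hw₂] at hsum
    rw [← hv₁, ← hv₂]
    exact hsum
  obtain ⟨s₀, hs₀, hs₀'⟩ := exists_dual_of_mem_cosphereInterior g hα₀ hpp
  obtain ⟨V₁, V₂, hV₁, hV₂, hV₁0, hV₂0, hV⟩ := exists_analytic_initialVelocities
    (contDiffAt_coordMetric g hy₀t) (coordMetric_symm g p)
    (Filter.mem_of_superset (target_mem_nhds hy₀t) fun y hy => coordMetric_isInvertible g hy)
    hs₀ hs₀' ht₀ ht₀' hu₁ hu₂ hsum₀
  have hindep : ∀ a b : ℝ, a • v₁ = b • v₂ → a = 0 ∧ b = 0 := by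
    intro a b hab
    refine eq_zero_of_smul_eq_smul (coordMetric_symm g p y₀) hu₁ hu₂ ht₀ ht₀' ?_ hab
    rw [hsum₀, smul_apply, ← hs₀, coordMetric_symm, hsum₀, smul_apply, hs₀']
    simp only [smul_eq_mul]
    ring
  -- The initial states as analytic functions on the cotangent bundle.
  let κ : CotangentBundle n M → Coord n × (Coord n →L[ℝ] ℝ) := fun α =>
    (extChartAt (𝓡 n) p α.proj, covectorCoord p α)
  have hκ : ContMDiffAt (cotangentModel n) 𝓘(ℝ, Coord n × (Coord n →L[ℝ] ℝ)) ω κ α₀ :=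
    contMDiffAt_cotangentCoord α₀
  let z₁ : CotangentBundle n M → Coord n × Coord n := fun α => ((κ α).1, V₁ (κ α))
  let z₂ : CotangentBundle n M → Coord n × Coord n := fun α => ((κ α).1, V₂ (κ α))
  have hz : ∀ {W : Coord n × (Coord n →L[ℝ] ℝ) → Coord n}, ContDiffAt ℝ ω W (κ α₀) →
      ContMDiffAt (cotangentModel n) 𝓘(ℝ, Coord n × Coord n) ω
        (fun α => ((κ α).1, W (κ α))) α₀ := by
    intro W hW
    have h1 : ContDiffAt ℝ ω (fun q => (q.1, W q)) (κ α₀) := contDiffAt_fst.prodMk hW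
    exact ContMDiffAt.comp α₀ h1.contMDiffAt hκ
  have hz₁ : ContMDiffAt (cotangentModel n) 𝓘(ℝ, Coord n × Coord n) ω z₁ α₀ := hz hV₁
  have hz₂ : ContMDiffAt (cotangentModel n) 𝓘(ℝ, Coord n × Coord n) ω z₂ α₀ := hz hV₂
  have hz₁0 : z₁ α₀ = (y₀, v₁) := Prod.ext rfl hV₁0
  have hz₂0 : z₂ α₀ = (y₀, v₂) := Prod.ext rfl hV₂0
  rw [← hy₀, ← hz₁0] at hΦ₁ hθ₁ hθ₂ hfam₁
  rw [← hy₀, ← hz₂0] at hΦ₂ hη₁ hη₂ hfam₂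
  have hp : ∀ᶠ α : CotangentBundle n M in 𝓝 α₀, α.proj ∈ (extChartAt (𝓡 n) p).source :=
    (FiberBundle.continuous_proj (EuclideanSpace ℝ (Fin n) →L[ℝ] ℝ)
      (fun x : M => TangentSpace (𝓡 n) x →L[ℝ] Trivial M ℝ x)).continuousAt.eventually
      (source_mem_nhds hpp)
  obtain ⟨c₁, c₂, hΦc₁, -, hst₁, -⟩ := hfam₁.self_of_nhds
  obtain ⟨d₁, d₂, hΦc₂, -, hst₂, -⟩ := hfam₂.self_of_nhds
  have h0₁ : (0 : ℝ) ∈ Icc (-θ₁ (z₁ α₀)) (θ₂ (z₁ α₀)) := by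
    rw [hθ₁, hθ₂]; exact ⟨by linarith, hT₂.le⟩
  have h0₂ : (0 : ℝ) ∈ Icc (-η₁ (z₂ α₀)) (η₂ (z₂ α₀)) := by
    rw [hη₁, hη₂]; exact ⟨by linarith, hS₂.le⟩
  -- The curves of a pair meet at time zero only.
  have hmeet : ∀ᶠ α in 𝓝 α₀, ∀ t ∈ Icc (-θ₁ (z₁ α)) (θ₂ (z₁ α)),
      ∀ s ∈ Icc (-η₁ (z₂ α)) (η₂ (z₂ α)), Φ₁ (z₁ α, t) = Φ₂ (z₂ α, s) → t = 0 ∧ s = 0 := by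
    have hcont : ∀ {Φ : (Coord n × Coord n) × ℝ → M}
        {z : CotangentBundle n M → Coord n × Coord n} {t : ℝ},
        ContMDiffAt 𝓘(ℝ, (Coord n × Coord n) × ℝ) (𝓡 n) ω Φ (z α₀, t) → ContinuousAt z α₀ →
        ContinuousAt (fun q : CotangentBundle n M × ℝ => Φ (z q.1, q.2)) (α₀, t) := by
      intro Φ z t hΦ hz
      exact ContinuousAt.comp (x := (α₀, t)) (f := fun q : CotangentBundle n M × ℝ => (z q.1, q.2))
        hΦ.continuousAt
        ((ContinuousAt.comp (x := (α₀, t)) hz continuousAt_fst).prodMk continuousAt_snd)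
    refine eventually_forall_ne_of_ne (c₁ := fun q => Φ₁ (z₁ q.1, q.2))
      (c₂ := fun q => Φ₂ (z₂ q.1, q.2)) (ContinuousAt.comp c₁ hz₁.continuousAt).neg
      (ContinuousAt.comp c₂ hz₁.continuousAt) (h0₁.1.trans h0₁.2)
      (ContinuousAt.comp d₁ hz₂.continuousAt).neg
      (ContinuousAt.comp d₂ hz₂.continuousAt) (h0₂.1.trans h0₂.2)
      (fun t ht => hcont (hΦc₁ t ht) hz₁.continuousAt)
      (fun t ht => hcont (hΦc₂ t ht) hz₂.continuousAt) ?_ ?_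
    · intro t ht s hs hts
      simp only [hθ₁, hθ₂, hη₁, hη₂] at ht hs hts
      rw [hΦ₁ t ht, hΦ₂ s hs] at hts
      have h1 := h.only_intersection t ht s hs hts
      exact ⟨(h.no_self_intersection₁ t ht).1 h1, (h.no_self_intersection₂ s hs).1 (hts ▸ h1)⟩
    · have hf : ∀ {Φ : (Coord n × Coord n) × ℝ → M} {z : Coord n × Coord n},
          ContMDiffAt 𝓘(ℝ, (Coord n × Coord n) × ℝ) (𝓡 n) ω Φ (z, 0) →
          Φ (z, 0) ∈ (extChartAt (𝓡 n) p).source →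
          ContDiffAt ℝ 1 (fun q => extChartAt (𝓡 n) p (Φ q)) (z, 0) := fun hΦ hs =>
        ((ContMDiffAt.comp _ (contMDiffAt_chart hs) hΦ).contDiffAt).of_le le_top
      have hsrc₁ : Φ₁ (z₁ α₀, 0) ∈ (extChartAt (𝓡 n) p).source := by
        rw [hΦ₁ 0 ⟨by linarith, hT₂.le⟩, h.base₁]; exact hpp
      have hsrc₂ : Φ₂ (z₂ α₀, 0) ∈ (extChartAt (𝓡 n) p).source := by
        rw [hΦ₂ 0 ⟨by linarith, hS₂.le⟩, h.base₂]; exact hpp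
      have h1 := eventually_eq_zero_of_eq (hf (hΦc₁ 0 h0₁) hsrc₁) (hf (hΦc₂ 0 h0₂) hsrc₂)
        (congrArg Prod.snd (hst₁.trans hz₁0)) (congrArg Prod.snd (hst₂.trans hz₂0)) hindep
      have h2 : Tendsto (fun q : (CotangentBundle n M × ℝ) × ℝ =>
          ((z₁ q.1.1, q.1.2), (z₂ q.1.1, q.2))) (𝓝 ((α₀, 0), 0))
          (𝓝 ((z₁ α₀, 0), (z₂ α₀, 0))) := by
        have e1 : Tendsto (fun q : (CotangentBundle n M × ℝ) × ℝ => q.1.1) (𝓝 ((α₀, 0), 0))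
            (𝓝 α₀) := (continuous_fst.comp continuous_fst).tendsto _
        have e2 : Tendsto (fun q : (CotangentBundle n M × ℝ) × ℝ => q.1.2) (𝓝 ((α₀, 0), 0))
            (𝓝 0) := (continuous_snd.comp continuous_fst).tendsto _
        have e3 : Tendsto (fun q : (CotangentBundle n M × ℝ) × ℝ => q.2) (𝓝 ((α₀, 0), 0))
            (𝓝 0) := continuous_snd.tendsto _
        exact ((hz₁.continuousAt.tendsto.comp e1).prodMk_nhds e2).prodMk_nhds
          ((hz₂.continuousAt.tendsto.comp e1).prodMk_nhds e3)
      have e1 : Tendsto (fun q : (CotangentBundle n M × ℝ) × ℝ => q.1.1) (𝓝 ((α₀, 0), 0))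
          (𝓝 α₀) := (continuous_fst.comp continuous_fst).tendsto _
      filter_upwards [h2.eventually h1, (hz₁.continuousAt.tendsto.comp e1).eventually hfam₁,
        (hz₂.continuousAt.tendsto.comp e1).eventually hfam₂] with q hq hq₁ hq₂ heq
      refine hq ?_ (congrArg _ heq)
      exact (congrArg Prod.fst hq₁.2.2.2.2.1).trans (congrArg Prod.fst hq₂.2.2.2.2.1).symm
  -- `V` is the set of the unit covectors at which all these statements hold.
  have hgood := ((contMDiffAt_iff_contMDiffAt_nhds (by simp)).1 hz₁).and
    (((contMDiffAt_iff_contMDiffAt_nhds (by simp)).1 hz₂).and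
    ((hz₁.continuousAt.eventually hfam₁).and ((hz₂.continuousAt.eventually hfam₂).and
    ((hκ.continuousAt.eventually hV).and (hp.and hmeet)))))
  refine ⟨cosphereInterior g X ∩ {α | _}, inter_subset_left,
    inter_mem self_mem_nhdsWithin (mem_nhdsWithin_of_mem_nhds hgood), fun α t => Φ₁ (z₁ α, t),
    fun α t => Φ₂ (z₂ α, t), fun α => θ₁ (z₁ α), fun α => θ₂ (z₁ α), fun α => η₁ (z₂ α),
    fun α => η₂ (z₂ α), ?_, ?_, ?_, ⟨hθ₁, hθ₂, hη₁, hη₂⟩, hΦ₁, hΦ₂⟩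
  · rintro α ⟨hαX, -, -, ⟨-, -, -, hb₁, -, hnt₁⟩, ⟨-, -, -, hb₂, -, hnt₂⟩, hVα, hpα, hmα⟩
    obtain ⟨s, hs, hs'⟩ := exists_dual_of_mem_cosphereInterior g hαX hpα
    obtain ⟨hun₁, hun₂, hsumα⟩ := hVα s hs hs'
    obtain ⟨hn₁, hvel₁⟩ := hnt₁ hun₁
    obtain ⟨hn₂, hvel₂⟩ := hnt₂ hun₂
    have hb₁' : Φ₁ (z₁ α, 0) = α.proj := hb₁.trans ((extChartAt (𝓡 n) p).left_inv hpα)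
    have hb₂' : Φ₂ (z₂ α, 0) = α.proj := hb₂.trans ((extChartAt (𝓡 n) p).left_inv hpα)
    have h0 : (0 : ℝ) ∈ Icc (-θ₁ (z₁ α)) (θ₂ (z₁ α)) :=
      ⟨by linarith [hn₁.pos_left], hn₁.pos_right.le⟩
    have h0' : (0 : ℝ) ∈ Icc (-η₁ (z₂ α)) (η₂ (z₂ α)) :=
      ⟨by linarith [hn₂.pos_left], hn₂.pos_right.le⟩
    refine ⟨hn₁, hn₂, hb₁', hb₂', ⟨t₀, ht₀, ht₀', chartFrame p (κ α).1 (V₁ (κ α)),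
      chartFrame p (κ α).1 (V₂ (κ α)), (tangentBundle_mk_eq_iff hb₁').2 hvel₁,
      (tangentBundle_mk_eq_iff hb₂').2 hvel₂, ?_⟩, fun t ht => ⟨fun e => ?_, fun e => ?_⟩,
      fun t ht => ⟨fun e => ?_, fun e => ?_⟩, fun t ht s hs e => ?_⟩
    · have h1 := (coordMetric_eq_smul_covectorCoord_iff g hpα).1 hsumα
      rw [map_add] at h1
      exact h1
    · exact (hmα t ht 0 h0' (e.trans hb₂'.symm)).1
    · rw [e]; exact hb₁'
    · exact (hmα 0 h0 t ht (hb₁'.trans e.symm)).2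
    · rw [e]; exact hb₂'
    · rw [(hmα t ht s hs e).1]; exact hb₁'
  · exact dependsAnalytically_comp (fun α hα => hα.2.1) (fun α hα => hα.2.2.2.1.1)
      (fun α hα => hα.2.2.2.1.2.1) fun α hα => hα.2.2.2.1.2.2.1
  · exact dependsAnalytically_comp (fun α hα => hα.2.2.1) (fun α hα => hα.2.2.2.2.1.1)
      (fun α hα => hα.2.2.2.2.1.2.1) fun α hα => hα.2.2.2.2.1.2.2.1
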